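/- Let $\mathbb{T}$ be a torus of rank $r\ge 0$. We use closed subgroups only. For a closed subgroup $K$ let $H^*(B\mathbb{T}/K)=H^*(B(\mathbb{T}/K);\mathbb{Q})$, i.e. the symmetric algebra on the rationalised group of characters of $\mathbb{T}/K$, placed in degree $2$; for $L\subseteq K$ inflation gives an inclusion $H^*(B\mathbb{T}/K)\subseteq H^*(B\mathbb{T}/L)$. Let $\mathcal{F}/K$ be the set of subgroups $\bar K\supseteq K$ with $\bar K/K$ finite and $\mathcal{O}_{\mathcal{F}/K}=\prod_{\bar K\in\mathcal{F}/K}H^*(B\mathbb{T}/\bar K)$. All products of graded rings are products of graded rings (taken degreewise). For $L\subseteq K$ let $\mathcal{E}_{K/L}$ be the multiplicative set of Euler classes of the representations $V$ of $\mathbb{T}/L$ with $V^K=0$: the class $e(V)$ is the product of the first Chern classes of the characters of $V$ in $H^*(B\mathbb{T}/L)$, and in $\mathcal{O}_{\mathcal{F}/L}$ the class of $V$ is the family $(e(V^{\bar L}))_{\bar L\in \mathcal{F}/L}$. An inclusion $L\subseteq K$ is cotoral if $K/L$ is a torus. Let $\Sigma_a$ be the poset of all closed subgroups with the cotoral inclusions,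 $\Sigma_c$ the poset of connected closed subgroups with all inclusions, and $\Sigma_d=\{0,\dots,r\}$. Let $\Sigma^p$ be the poset of pairs $(K\supseteq L)$ in $\Sigma$, with $(K\supseteq L)\le(K'\supseteq L')$ if $L'\le L$ and $K\le K'$ in $\Sigma$, and $\Sigma^f$ the poset of flags (nonempty finite chains) $E=(K_0\supset\cdots\supset K_s)$ under inclusion. The diagrams of graded rings are: * $R_a^p(K\supseteq L)=\mathcal{E}_{K/L}^{-1}H^*(B\mathbb{T}/L)$ and $R_a^f(K_0\supset\cdots\supset K_s)=R_a^p(K_0\supseteq K_s)$; * $R_c^p(K\supseteq L)=\mathcal{E}_{K/L}^{-1}\mathcal{O}_{\mathcal{F}/L}$ and $R_c^f(K_0\supset\cdots\supset K_s)=R_c^p(K_0\supseteq K_s)$; * for $d=(d_0>\cdots>d_s)$ in $\Sigma_d^f$, $R_d^f(d)=\prod_{H_0}\mathcal{E}_{H_0}^{-1}\prod_{H_1\subset H_0}\mathcal{E}_{H_1}^{-1}\cdots\prod_{H_s\subset H_{s-1}}\mathcal{E}_{H_s}^{-1}\mathcal{O}_{\mathcal{F}/H_s}$, over connected subgroups $H_i$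 of dimension $d_i$, where $\mathcal{E}_{H}$ consists of the Euler classes of representations $V$ of $\mathbb{T}$ with $V^{H}=0$ (acting on a factor $H^*(B\mathbb{T}/\bar H)$ as $e(V^{\bar H})$). The structure maps are induced by the inflations; on products the factor of $\bar L\in\mathcal{F}/L$ receives from that of $\bar L K\in\mathcal{F}/K$ for $L\subseteq K$, and flags are restricted to their subflags of the dimensions concerned. For a flag $E$ with dimension vector $d$ there is the projection $R_d^f(d)\to R_c^f(E)$. A module $M$ over a diagram of graded rings consists of graded modules $M(j)$ over the rings $R(j)$ and compatible semilinear degree preserving maps $M(i)\to M(j)$ for $i\le j$; a differential module has in addition differentials of degree $1$ which are $R$-linear and commute with the structure maps. Morphisms are the natural linear maps of degree $0$ (commuting with the differentials). Write $M(K)$ for the value at $(K\supseteq K)$, respectively at the flag $(K)$. * $M$ is *qce* (quasi-coherent and extended) if for each pair $(K\supseteq L)$ the maps $M(L)\to M(K\supseteq L)$ and $M(K)\to M(K\supseteq L)$ are extensions of scalars along $R(L)\to R(K\supseteq L)$ and $R(K)\to R(K\supseteq L)$, i.e. $M(K\supseteq L)=\mathcal{E}_{K/L}^{-1}M(L)$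 and $M(K\supseteq L)=R(K\supseteq L)\otimes_{R(K)}M(K)$; for diagrams on flags the same is required for each flag $E=(K_0\supset\cdots\supset K_s)$, with $M(E)$ in place of $M(K\supseteq L)$, $K=K_0$ and $L=K_s$. * A module over $R_a^p$ (or over $R_a^f$, with $M(K)$ for $M(K\supset K)$) is *$\mathcal{F}$-continuous* if for each closed subgroup $K$, each $x\in M(K)$ and each connected subgroup $L$ there is a representation $V$ of $\mathbb{T}$ with $V^K=0$ such that for every $L'\in\mathcal{F}/L$ that is cotoral in $K$ the element $e(V^{L'})x$ of $M(K\supseteq L')$ lies in the image of $M(L')$. * A module $M$ over $R_d^f$ is *pqce* (product-quasi-coherent and extended) if there are a qce module $N$ over $R_c^f$ and maps $\pi_E:M(d)\to N(E)$, for the flags $E$ of dimension vector $d$, that are linear over $R_d^f(d)\to R_c^f(E)$, degree preserving and natural, such that: $\pi_E$ identifies $N(E)$ with $R_c^f(E)\otimes_{R_d^f(d)}M(d)$; and in each degree $(\pi_E)_E$ is injective on $M(d)$, with image the families $(x_E)_E$ whose images at all $d'\supseteq d$ are extended. Here a family $(x_E)_E$ on the flags of dimension vector $d'$ is extended if for each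 connected $H_0$ it is given, on the flags with largest term $H_0$, by a finite sum $\sum_i a_i m_i$ with $a_i\in R_d^f(d')$ and $m_i\in N(H_0)$. Let $\mathcal{A}_a^p(\mathbb{T})$, $\mathcal{A}_a^f(\mathbb{T})$ be the full subcategories of $\mathcal{F}$-continuous qce modules over $R_a^p$, $R_a^f$; $\mathcal{A}_c^p(\mathbb{T})$, $\mathcal{A}_c^f(\mathbb{T})$ those of qce modules over $R_c^p$, $R_c^f$; $\mathcal{A}_d^f(\mathbb{T})$ that of pqce modules over $R_d^f$; and let $d\mathcal{A}_a^p(\mathbb{T})$, $d\mathcal{A}_a^f(\mathbb{T})$, $d\mathcal{A}_c^p(\mathbb{T})$, $d\mathcal{A}_c^f(\mathbb{T})$, $d\mathcal{A}_d^f(\mathbb{T})$ be the corresponding categories of differential modules. **Lemma.** For every $r\ge 0$ all ten of these algebraic models, $\mathcal{A}_a^p(\mathbb{T})$, $\mathcal{A}_a^f(\mathbb{T})$, $\mathcal{A}_c^p(\mathbb{T})$, $\mathcal{A}_c^f(\mathbb{T})$, $\mathcal{A}_d^f(\mathbb{T})$ and their differential versions $d\mathcal{A}_a^p(\mathbb{T})$,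 $d\mathcal{A}_a^f(\mathbb{T})$, $d\mathcal{A}_c^p(\mathbb{T})$, $d\mathcal{A}_c^f(\mathbb{T})$, $d\mathcal{A}_d^f(\mathbb{T})$, are locally presentable categories. -/

import Mathlib

open CategoryTheory

namespace TorusModel

/-! ### Subgroups and characters of the torus -/

/-- The torus of rank `r`. -/
abbrev Torus (r : ℕ) : Type := Fin r → Circle

/-- The characters of the torus `T` are `t ↦ ∏ i, t i ^ n i` for `n : Fin r → ℤ`.
`ann K` is the group of the characters that are trivial on `K`, that is, of the characters
of `T / K`. -/
noncomputable def ann {r : ℕ} (K : Subgroup (Torus r)) : AddSubgroup (Fin r → ℤ) where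
  carrier := {n | ∀ t ∈ K, ∏ i, t i ^ n i = 1}
  zero_mem' := by intro t _; simp
  add_mem' := by
    intro a b ha hb t ht
    simp [zpow_add, Finset.prod_mul_distrib, ha t ht, hb t ht]
  neg_mem' := by
    intro a ha t ht
    simp [zpow_neg, Finset.prod_inv_distrib, ha t ht]

theorem ann_anti {r : ℕ} {K H : Subgroup (Torus r)} (h : K ≤ H) : ann H ≤ ann K :=
  fun _ hn t ht => hn t (h ht)

/-- The closed connected subgroups of the torus, ordered by inclusion. -/
@[ext]
structure ConnSub (r : ℕ) where
  toSubgroup : Subgroup (Torus r)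
  isClosed : IsClosed (toSubgroup : Set (Torus r))
  isConnected : IsConnected (toSubgroup : Set (Torus r))

noncomputable instance (r : ℕ) : PartialOrder (ConnSub r) :=
  PartialOrder.lift ConnSub.toSubgroup (fun _ _ h => ConnSub.ext h)

/-- The dimension of a closed connected subgroup: the rank of its group of characters. -/
noncomputable def ConnSub.dim {r : ℕ} (K : ConnSub r) : ℕ :=
  Module.finrank ℤ ((Fin r → ℤ) ⧸ ann K.toSubgroup)

/-- All closed subgroups of the torus. -/
@[ext]
structure AllSub (r : ℕ) where
  toSubgroup : Subgroup (Torus r)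
  isClosed : IsClosed (toSubgroup : Set (Torus r))

/-- `K ≤ H` and `H / K` is a torus; as `H` is a compact abelian Lie group, so is `H / K`, and it
is a torus if and only if it is connected. -/
def IsCotoral {r : ℕ} (K H : Subgroup (Torus r)) : Prop :=
  K ≤ H ∧ ConnectedSpace (H ⧸ K.subgroupOf H)

theorem IsCotoral.refl {r : ℕ} (K : Subgroup (Torus r)) : IsCotoral K K := by
  refine ⟨le_rfl, ?_⟩
  rw [Subgroup.subgroupOf_self]
  have : Subsingleton (K ⧸ (⊤ : Subgroup K)) := QuotientGroup.subsingleton_quotient_top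
  infer_instance

theorem IsCotoral.trans {r : ℕ} {L K H : Subgroup (Torus r)}
    (h₁ : IsCotoral L K) (h₂ : IsCotoral K H) : IsCotoral L H := by
  obtain ⟨hLK, hc₁⟩ := h₁
  obtain ⟨hKH, hc₂⟩ := h₂
  refine ⟨hLK.trans hKH, ?_⟩
  let f : H ⧸ L.subgroupOf H → H ⧸ K.subgroupOf H := Subgroup.quotientSubgroupOfMapOfLE H hLK
  have hf : Topology.IsQuotientMap f := by
    refine Topology.IsQuotientMap.of_comp (f := (QuotientGroup.mk : H → H ⧸ L.subgroupOf H))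
      QuotientGroup.continuous_mk ?_ (QuotientGroup.isQuotientMap_mk _)
    exact (QuotientGroup.isQuotientMap_mk _).continuous_iff.2 QuotientGroup.continuous_mk
  have hfib : ∀ y, IsConnected (f ⁻¹' {y}) := by
    intro y
    obtain ⟨h, rfl⟩ := QuotientGroup.mk_surjective y
    let g : K ⧸ L.subgroupOf K → H ⧸ L.subgroupOf H := fun x =>
      (QuotientGroup.mk h : H ⧸ L.subgroupOf H) * Subgroup.quotientSubgroupOfEmbeddingOfLE L hKH x
    have hg : Continuous g := by
      have hj : Continuous (Subgroup.quotientSubgroupOfEmbeddingOfLE L hKH) := by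
        refine (QuotientGroup.isQuotientMap_mk (L.subgroupOf K)).continuous_iff.2 ?_
        exact QuotientGroup.continuous_mk.comp (continuous_inclusion hKH)
      exact continuous_const.mul hj
    have hr : f ⁻¹' {QuotientGroup.mk h} = Set.range g := by
      ext x
      obtain ⟨x, rfl⟩ := QuotientGroup.mk_surjective x
      constructor
      · intro hx
        have hx' : (QuotientGroup.mk x : H ⧸ K.subgroupOf H) = QuotientGroup.mk h := hx
        rw [eq_comm, QuotientGroup.eq, Subgroup.mem_subgroupOf] at hx'
        refine ⟨QuotientGroup.mk ⟨_, hx'⟩, ?_⟩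
        change QuotientGroup.mk (h * (h⁻¹ * x)) = _
        rw [mul_inv_cancel_left]
      · rintro ⟨k, hk⟩
        obtain ⟨k, rfl⟩ := QuotientGroup.mk_surjective k
        rw [← hk]
        change QuotientGroup.mk (h * Subgroup.inclusion hKH k) = QuotientGroup.mk h
        rw [eq_comm, QuotientGroup.eq, Subgroup.mem_subgroupOf]
        simp
    rw [hr]
    exact isConnected_range hg
  have := hf.isCoinducing.isConnected_preimage_of_isClosed hfib isClosed_univ
    isConnected_univ
  rw [Set.preimage_univ] at this
  exact connectedSpace_iff_univ.2 this

/-- The closed subgroups are ordered by cotoral inclusion. -/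
instance (r : ℕ) : PartialOrder (AllSub r) where
  le K H := IsCotoral K.toSubgroup H.toSubgroup
  le_refl K := IsCotoral.refl _
  le_trans _ _ _ h₁ h₂ := h₁.trans h₂
  le_antisymm _ _ h₁ h₂ := AllSub.ext (le_antisymm h₁.1 h₂.1)

/-- `𝓕 / K`: the subgroups `K'` containing `K` with `K' / K` finite. -/
def FinOver {r : ℕ} (K : Subgroup (Torus r)) : Type :=
  {K' : Subgroup (Torus r) // K ≤ K' ∧ K.relIndex K' ≠ 0}

theorem finOver_sup {r : ℕ} {L K L' : Subgroup (Torus r)} (h : L ≤ K)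
    (hL' : L ≤ L' ∧ L.relIndex L' ≠ 0) : K ≤ L' ⊔ K ∧ K.relIndex (L' ⊔ K) ≠ 0 := by
  refine ⟨le_sup_right, ?_⟩
  rw [Subgroup.relIndex_sup_right]
  exact fun h0 => hL'.2 (Subgroup.relIndex_eq_zero_of_le_left h h0)

/-! ### Cohomology rings and Euler classes -/

/-- The field of fractions of `H^*(BT; ℚ) = ℚ[x_1, …, x_r]`. -/
abbrev Frac (r : ℕ) : Type := FractionRing (MvPolynomial (Fin r) ℚ)

/-- The first Chern class in `H^2(BT; ℚ)` of the character `n`. -/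
noncomputable def chern {r : ℕ} (n : Fin r → ℤ) : MvPolynomial (Fin r) ℚ :=
  ∑ i, MvPolynomial.C (n i : ℚ) * MvPolynomial.X i

/-- `H^*(B(T/K); ℚ)`, the symmetric algebra on the rationalised group of characters of `T / K`
(in degree two). Inflation embeds it in `H^*(BT; ℚ)` as the subalgebra generated by the Chern
classes of these characters, so that all inflation maps become inclusions. -/
noncomputable def cohomology {r : ℕ} (K : Subgroup (Torus r)) :
    Subalgebra ℚ (MvPolynomial (Fin r) ℚ) :=
  Algebra.adjoin ℚ (chern '' (ann K : Set (Fin r → ℤ)))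

theorem cohomology_anti {r : ℕ} {K H : Subgroup (Torus r)} (h : K ≤ H) :
    cohomology H ≤ cohomology K :=
  Algebra.adjoin_mono (Set.image_mono (ann_anti h))

open Classical in
/-- A finite dimensional complex representation `V` of the torus is given by the multiset of its
characters. `euler V K` is the Euler class `e(V^K)` in `H^*(B(T/K); ℚ)`. -/
noncomputable def euler {r : ℕ} (V : Multiset (Fin r → ℤ)) (K : Subgroup (Torus r)) :
    MvPolynomial (Fin r) ℚ :=
  ((V.filter (· ∈ ann K)).map chern).prod

/-- The condition `V^K = 0`. -/
def NoFixed {r : ℕ} (V : Multiset (Fin r → ℤ)) (K : Subgroup (Torus r)) : Prop :=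
  ∀ n ∈ V, n ∉ ann K

theorem euler_zero {r : ℕ} (K : Subgroup (Torus r)) : euler 0 K = 1 := by simp [euler]

theorem euler_add {r : ℕ} (V W : Multiset (Fin r → ℤ)) (K : Subgroup (Torus r)) :
    euler (V + W) K = euler V K * euler W K := by simp [euler]

theorem NoFixed.add {r : ℕ} {V W : Multiset (Fin r → ℤ)} {K : Subgroup (Torus r)}
    (hV : NoFixed V K) (hW : NoFixed W K) : NoFixed (V + W) K := by
  intro n hn
  rcases Multiset.mem_add.1 hn with h | h
  exacts [hV n h, hW n h]

theorem NoFixed.mono {r : ℕ} {V : Multiset (Fin r → ℤ)} {K H : Subgroup (Torus r)}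
    (hV : NoFixed V K) (h : K ≤ H) : NoFixed V H :=
  fun n hn hH => hV n hn (ann_anti h hH)

theorem chern_prod_mem {r : ℕ} {K : Subgroup (Torus r)} {V : Multiset (Fin r → ℤ)}
    (h : ∀ n ∈ V, n ∈ ann K) : (V.map chern).prod ∈ cohomology K := by
  refine Subalgebra.multiset_prod_mem _ ?_
  intro x hx
  obtain ⟨n, hn, rfl⟩ := Multiset.mem_map.1 hx
  exact Algebra.subset_adjoin ⟨n, h n hn, rfl⟩

theorem euler_mem {r : ℕ} (V : Multiset (Fin r → ℤ)) (K : Subgroup (Torus r)) :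
    euler V K ∈ cohomology K := by
  classical
  exact chern_prod_mem fun n hn => (Multiset.mem_filter.1 hn).2

/-- Passing to a smaller subgroup multiplies the Euler class by an element of the larger ring. -/
theorem euler_factor {r : ℕ} (V : Multiset (Fin r → ℤ)) {K H : Subgroup (Torus r)} (h : K ≤ H) :
    ∃ c ∈ cohomology K, euler V K = c * euler V H := by
  classical
  refine ⟨(((V.filter (· ∈ ann K)).filter (· ∉ ann H)).map chern).prod, ?_, ?_⟩
  · exact chern_prod_mem fun n hn => (Multiset.mem_filter.1 (Multiset.mem_filter.1 hn).1).2
  · have h1 : V.filter (· ∈ ann H) = (V.filter (· ∈ ann K)).filter (· ∈ ann H) := by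
      rw [Multiset.filter_filter]
      refine Multiset.filter_congr fun n _ => ⟨fun hn => ⟨hn, ann_anti h hn⟩, fun hn => hn.1⟩
    rw [euler, euler, h1, mul_comm, ← Multiset.prod_add, ← Multiset.map_add,
      Multiset.filter_add_not]

theorem chern_prod_isHomogeneous {r : ℕ} (V : Multiset (Fin r → ℤ)) :
    ∃ k : ℕ, (V.map chern).prod.IsHomogeneous k := by
  induction V using Multiset.induction with
  | empty => exact ⟨0, by simpa using MvPolynomial.isHomogeneous_one _ _⟩
  | cons n V ih =>
    obtain ⟨k, hk⟩ := ih
    refine ⟨1 + k, ?_⟩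
    rw [Multiset.map_cons, Multiset.prod_cons]
    refine MvPolynomial.IsHomogeneous.mul ?_ hk
    refine MvPolynomial.IsHomogeneous.sum _ _ _ fun i _ => ?_
    simpa using (MvPolynomial.isHomogeneous_C (Fin r) (n i : ℚ)).mul
      (MvPolynomial.isHomogeneous_X ℚ i)

/-- `q` is a homogeneous fraction of polynomial degree `m`, that is, of cohomological degree
`2 * m`. -/
def IsHomogFrac {r : ℕ} (m : ℤ) (q : Frac r) : Prop :=
  q = 0 ∨ ∃ (p s : MvPolynomial (Fin r) ℚ) (k l : ℕ), p.IsHomogeneous k ∧ s.IsHomogeneous l ∧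
    s ≠ 0 ∧ q * algebraMap _ _ s = algebraMap _ _ p ∧ m = (k : ℤ) - l

theorem IsHomogFrac.add {r : ℕ} {m : ℤ} {q q' : Frac r} (h : IsHomogFrac m q)
    (h' : IsHomogFrac m q') : IsHomogFrac m (q + q') := by
  rcases h with rfl | ⟨p, s, k, l, hp, hs, hs0, hq, hm⟩
  · simpa using h'
  rcases h' with rfl | ⟨p', s', k', l', hp', hs', hs0', hq', hm'⟩
  · exact Or.inr ⟨p, s, k, l, hp, hs, hs0, by simpa using hq, hm⟩
  · refine Or.inr ⟨p * s' + p' * s, s * s', k + l', l + l', ?_, hs.mul hs',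
      mul_ne_zero hs0 hs0', ?_, by push_cast; omega⟩
    · refine (hp.mul hs').add ?_
      have : k + l' = k' + l := by omega
      rw [this]
      exact hp'.mul hs
    · simp only [map_add, map_mul, ← hq, ← hq']
      ring

theorem IsHomogFrac.neg {r : ℕ} {m : ℤ} {q : Frac r} (h : IsHomogFrac m q) :
    IsHomogFrac m (-q) := by
  rcases h with rfl | ⟨p, s, k, l, hp, hs, hs0, hq, hm⟩
  · exact Or.inl neg_zero
  · exact Or.inr ⟨-p, s, k, l, hp.neg, hs, hs0, by simp [← hq], hm⟩

/-! ### Diagrams of graded rings -/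

/-- A diagram of commutative graded rings, concentrated in even degrees, on a preordered set:
`homog j m` is the group of the elements of degree `2 * m`. -/
structure RingDiagram (J : Type) [Preorder J] where
  ring : J → Type
  [commRing : ∀ j, CommRing (ring j)]
  homog : ∀ j, ℤ → AddSubgroup (ring j)
  map : ∀ {i j : J}, i ≤ j → ring i →+* ring j
  map_homog : ∀ {i j : J} (h : i ≤ j) (m : ℤ) (a : ring i), a ∈ homog i m → map h a ∈ homog j m
  map_id : ∀ (j : J) (a : ring j), map (le_refl j) a = a
  map_comp : ∀ {i j k : J} (h : i ≤ j) (h' : j ≤ k) (a : ring i),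
    map (h.trans h') a = map h' (map h a)

attribute [instance] RingDiagram.commRing

/-- The diagram of rings induced along a monotone map of indexing posets. -/
def RingDiagram.comap {J J' : Type} [Preorder J] [Preorder J'] (R : RingDiagram J)
    (f : J' →o J) : RingDiagram J' where
  ring j := R.ring (f j)
  homog j := R.homog (f j)
  map h := R.map (f.monotone h)
  map_homog h := R.map_homog (f.monotone h)
  map_id j := R.map_id (f j)
  map_comp h h' := R.map_comp (f.monotone h) (f.monotone h')

/-- The localization `S⁻¹B` of a subring `B` of the ring of functions `I → Frac r` at a
multiplicative set `S` of elements of `B`. It is used for sets `S` of functions without zeros, so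
that it is a subring of `I → Frac r`. -/
noncomputable def loc {r : ℕ} {I : Type} (B : Subring (I → Frac r)) (S : Submonoid (I → Frac r))
    (hS : ∀ s ∈ S, s ∈ B) : Subring (I → Frac r) where
  carrier := {a | ∃ s ∈ S, s * a ∈ B}
  one_mem' := ⟨1, S.one_mem, by simp⟩
  zero_mem' := ⟨1, S.one_mem, by simp⟩
  mul_mem' := by
    rintro a b ⟨s, hs, ha⟩ ⟨t, ht, hb⟩
    exact ⟨s * t, S.mul_mem hs ht, by simpa [mul_mul_mul_comm] using B.mul_mem ha hb⟩
  add_mem' := by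
    rintro a b ⟨s, hs, ha⟩ ⟨t, ht, hb⟩
    refine ⟨s * t, S.mul_mem hs ht, ?_⟩
    have : s * t * (a + b) = t * (s * a) + s * (t * b) := by ring
    rw [this]
    exact B.add_mem (B.mul_mem (hS t ht) ha) (B.mul_mem (hS s hs) hb)
  neg_mem' := by
    rintro a ⟨s, hs, ha⟩
    exact ⟨s, hs, by simpa using B.neg_mem ha⟩

/-- The graded ring attached to a ring `A` of functions `I → Frac r`: the subring generated by (and
hence the sum of) the groups of the elements of `A` all of whose values are homogeneous of one
degree. For a product of graded rings this is the product in the category of graded rings. -/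
noncomputable def gr {r : ℕ} {I : Type} (A : Subring (I → Frac r)) : Subring (I → Frac r) :=
  Subring.closure {a | a ∈ A ∧ ∃ m, ∀ i, IsHomogFrac m (a i)}

/-- The elements of `gr A` of degree `2 * m`. -/
noncomputable def grHomog {r : ℕ} {I : Type} (A : Subring (I → Frac r)) (m : ℤ) : AddSubgroup (gr A) where
  carrier := {a | ∀ i, IsHomogFrac m (a.1 i)}
  zero_mem' := fun _ => Or.inl rfl
  add_mem' := fun ha hb i => (ha i).add (hb i)
  neg_mem' := fun ha i => (ha i).neg

/-- The restriction of functions along `f : I' → I`, on the attached graded rings. -/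
noncomputable def grMap {r : ℕ} {I I' : Type} (A : Subring (I → Frac r)) (A' : Subring (I' → Frac r))
    (f : I' → I) (hf : ∀ a ∈ A, (fun i => a (f i)) ∈ A') : gr A →+* gr A' :=
  ((RingHom.pi fun i => Pi.evalRingHom (fun _ : I => Frac r) (f i)).comp (gr A).subtype).codRestrict
    (gr A') (by
      rintro ⟨a, ha⟩
      have h : gr A ≤ (gr A').comap
          (RingHom.pi fun i => Pi.evalRingHom (fun _ : I => Frac r) (f i)) := by
        refine Subring.closure_le.2 ?_
        rintro b ⟨hb, m, hm⟩
        exact Subring.subset_closure ⟨hf b hb, m, fun i => hm (f i)⟩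
      exact h ha)

theorem grMap_apply {r : ℕ} {I I' : Type} (A : Subring (I → Frac r)) (A' : Subring (I' → Frac r))
    (f : I' → I) (hf : ∀ a ∈ A, (fun i => a (f i)) ∈ A') (a : gr A) (i : I') :
    (grMap A A' f hf a).1 i = a.1 (f i) := rfl

/-- A diagram of graded rings of functions, with restriction of functions as transition maps. -/
noncomputable def functionDiagram {r : ℕ} {J : Type} [Preorder J] (I : J → Type)
    (res : ∀ {i j : J}, i ≤ j → I j → I i)
    (res_id : ∀ (j : J) (x : I j), res (le_refl j) x = x)
    (res_comp : ∀ {i j k : J} (h : i ≤ j) (h' : j ≤ k) (x : I k),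
      res (h.trans h') x = res h (res h' x))
    (A : ∀ j, Subring (I j → Frac r))
    (hA : ∀ {i j : J} (h : i ≤ j), ∀ a ∈ A i, (fun x => a (res h x)) ∈ A j) : RingDiagram J where
  ring j := gr (A j)
  homog j := grHomog (A j)
  map h := grMap (A _) (A _) (res h) (hA h)
  map_homog h _ _ ha x := ha (res h x)
  map_id j a := Subtype.ext (funext fun x => congrArg a.1 (res_id j x))
  map_comp h h' a := Subtype.ext (funext fun x => congrArg a.1 (res_comp h h' x))

/-! ### Pairs and flags -/

/-- A flag: a finite nonempty chain. Flags are ordered by inclusion. -/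
@[ext]
structure FinFlag (P : Type) [PartialOrder P] where
  carrier : Finset P
  nonempty : carrier.Nonempty
  chain : IsChain (· ≤ ·) (carrier : Set P)

namespace FinFlag

variable {P : Type} [PartialOrder P]

instance : PartialOrder (FinFlag P) :=
  PartialOrder.lift FinFlag.carrier (fun _ _ h => FinFlag.ext h)

theorem exists_top (E : FinFlag P) : ∃ x ∈ E.carrier, ∀ y ∈ E.carrier, y ≤ x := by
  obtain ⟨x, hx⟩ := E.carrier.exists_maximal E.nonempty
  refine ⟨x, hx.1, fun y hy => ?_⟩
  rcases E.chain.total hy hx.1 with h | h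
  exacts [h, hx.2 hy h]

theorem exists_bot (E : FinFlag P) : ∃ x ∈ E.carrier, ∀ y ∈ E.carrier, x ≤ y := by
  obtain ⟨x, hx⟩ := E.carrier.exists_minimal E.nonempty
  refine ⟨x, hx.1, fun y hy => ?_⟩
  rcases E.chain.total hx.1 hy with h | h
  exacts [h, hx.2 hy h]

/-- The largest term of a flag. -/
noncomputable def top (E : FinFlag P) : P := E.exists_top.choose

/-- The smallest term of a flag. -/
noncomputable def bot (E : FinFlag P) : P := E.exists_bot.choose

theorem top_mem (E : FinFlag P) : E.top ∈ E.carrier := E.exists_top.choose_spec.1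
theorem le_top (E : FinFlag P) {x : P} (h : x ∈ E.carrier) : x ≤ E.top :=
  E.exists_top.choose_spec.2 x h
theorem bot_mem (E : FinFlag P) : E.bot ∈ E.carrier := E.exists_bot.choose_spec.1
theorem bot_le (E : FinFlag P) {x : P} (h : x ∈ E.carrier) : E.bot ≤ x :=
  E.exists_bot.choose_spec.2 x h

/-- The flag of length one. -/
def single (x : P) : FinFlag P where
  carrier := {x}
  nonempty := Finset.singleton_nonempty x
  chain := by simp

open Classical in
/-- The flag with the terms `x ≤ y`. -/
noncomputable def pair {x y : P} (h : x ≤ y) : FinFlag P where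
  carrier := {x, y}
  nonempty := Finset.insert_nonempty x _
  chain := by
    rw [Finset.coe_pair]
    exact IsChain.pair h

theorem single_le {x : P} {E : FinFlag P} (h : x ∈ E.carrier) : single x ≤ E :=
  Finset.singleton_subset_iff.2 h

/-- The pair consisting of the smallest and the largest term of a flag. -/
noncomputable def toInterval : FinFlag P →o NonemptyInterval P where
  toFun E := ⟨(E.bot, E.top), E.bot_le E.top_mem⟩
  monotone' := fun E E' h => ⟨E'.bot_le (h E.bot_mem), E'.le_top (h E.top_mem)⟩

end FinFlag

/-! ### The rings of the models -/

/-- The fractions that lie in `H^*(B(T/K); ℚ)`. -/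
noncomputable def cohFrac {r : ℕ} (K : Subgroup (Torus r)) : Subring (Frac r) :=
  (cohomology K).toSubring.map (algebraMap (MvPolynomial (Fin r) ℚ) (Frac r))

/-- The product `∏ i, H^*(B(T/K i); ℚ)`, as a ring of functions. -/
noncomputable def polyFun {r : ℕ} {I : Type} (K : I → Subgroup (Torus r)) :
    Subring (I → Frac r) where
  carrier := {a | ∀ i, a i ∈ cohFrac (K i)}
  one_mem' := fun i => (cohFrac (K i)).one_mem
  zero_mem' := fun i => (cohFrac (K i)).zero_mem
  mul_mem' := fun ha hb i => (cohFrac (K i)).mul_mem (ha i) (hb i)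
  add_mem' := fun ha hb i => (cohFrac (K i)).add_mem (ha i) (hb i)
  neg_mem' := fun ha i => (cohFrac (K i)).neg_mem (ha i)

/-- The Euler class `e(V^K)` as a fraction. -/
noncomputable def eulerFrac {r : ℕ} (V : Multiset (Fin r → ℤ)) (K : Subgroup (Torus r)) : Frac r :=
  algebraMap (MvPolynomial (Fin r) ℚ) (Frac r) (euler V K)

theorem eulerFrac_zero {r : ℕ} (K : Subgroup (Torus r)) : eulerFrac 0 K = 1 := by
  simp [eulerFrac, euler_zero]

theorem eulerFrac_add {r : ℕ} (V W : Multiset (Fin r → ℤ)) (K : Subgroup (Torus r)) :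
    eulerFrac (V + W) K = eulerFrac V K * eulerFrac W K := by
  simp [eulerFrac, euler_add]

theorem eulerFrac_mem {r : ℕ} (V : Multiset (Fin r → ℤ)) (K : Subgroup (Torus r)) :
    eulerFrac V K ∈ cohFrac K :=
  ⟨euler V K, euler_mem V K, rfl⟩

theorem eulerFrac_factor {r : ℕ} (V : Multiset (Fin r → ℤ)) {K H : Subgroup (Torus r)}
    (h : K ≤ H) : ∃ c ∈ cohFrac K, eulerFrac V K = c * eulerFrac V H := by
  obtain ⟨c, hc, e⟩ := euler_factor V h
  exact ⟨_, ⟨c, hc, rfl⟩, by simp [eulerFrac, e]⟩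

theorem cohFrac_anti {r : ℕ} {K H : Subgroup (Torus r)} (h : K ≤ H) : cohFrac H ≤ cohFrac K := by
  rintro _ ⟨x, hx, rfl⟩
  exact ⟨x, cohomology_anti h hx, rfl⟩

/-- The Euler classes `i ↦ e(V^(K i))` of the representations `V` of `T` with `V^H = 0`.
If `L ≤ K i` for all `i` only `V^L` matters, which is an arbitrary representation of `T / L` without
`H`-fixed vectors. -/
noncomputable def eulerMonoid {r : ℕ} {I : Type} (K : I → Subgroup (Torus r))
    (H : Subgroup (Torus r)) : Submonoid (I → Frac r) where
  carrier := {e | ∃ V, NoFixed V H ∧ e = fun i => eulerFrac V (K i)}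
  one_mem' := ⟨0, fun _ h => absurd h (Multiset.notMem_zero _),
    funext fun i => (eulerFrac_zero (K i)).symm⟩
  mul_mem' := by
    rintro _ _ ⟨V, hV, rfl⟩ ⟨W, hW, rfl⟩
    exact ⟨V + W, hV.add hW, funext fun i => (eulerFrac_add V W (K i)).symm⟩

theorem eulerMonoid_le {r : ℕ} {I : Type} (K : I → Subgroup (Torus r)) (H : Subgroup (Torus r)) :
    ∀ s ∈ eulerMonoid K H, s ∈ polyFun K := by
  rintro _ ⟨V, _, rfl⟩ i
  exact eulerFrac_mem V (K i)

theorem loc_map {r : ℕ} {I I' : Type} {K : I → Subgroup (Torus r)} {K' : I' → Subgroup (Torus r)}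
    (f : I' → I) (hf : ∀ i, K' i ≤ K (f i)) {S : Submonoid (I → Frac r)}
    {S' : Submonoid (I' → Frac r)} (hS : ∀ s ∈ S, s ∈ polyFun K) (hS' : ∀ s ∈ S', s ∈ polyFun K')
    (h : ∀ s ∈ S, ∃ s' ∈ S', ∀ i, ∃ c ∈ cohFrac (K' i), s' i = c * s (f i)) :
    ∀ a ∈ loc (polyFun K) S hS, (fun i => a (f i)) ∈ loc (polyFun K') S' hS' := by
  rintro a ⟨s, hs, ha⟩
  obtain ⟨s', hs', hc⟩ := h s hs
  refine ⟨s', hs', fun i => ?_⟩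
  obtain ⟨c, hc, e⟩ := hc i
  have : (s' * fun i => a (f i)) i = c * (s * a) (f i) := by
    simp [e, mul_assoc]
  rw [this]
  exact (cohFrac (K' i)).mul_mem hc (cohFrac_anti (hf i) (ha (f i)))

theorem eulerMonoid_map {r : ℕ} {I I' : Type} {K : I → Subgroup (Torus r)}
    {K' : I' → Subgroup (Torus r)} (f : I' → I) (hf : ∀ i, K' i ≤ K (f i))
    {H H' : Subgroup (Torus r)} (hH : H ≤ H') :
    ∀ s ∈ eulerMonoid K H, ∃ s' ∈ eulerMonoid K' H', ∀ i, ∃ c ∈ cohFrac (K' i),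
      s' i = c * s (f i) := by
  rintro _ ⟨V, hV, rfl⟩
  exact ⟨_, ⟨V, hV.mono hH, rfl⟩, fun i => eulerFrac_factor V (hf i)⟩

/-- For a pair `K ⊇ L` of closed subgroups (with `K / L` a torus) the ring
`𝓔_{K/L}⁻¹ H^*(B(T/L); ℚ)`, where `𝓔_{K/L}` is the set of the Euler classes of the representations
`V` of `T / L` with `V^K = 0`. -/
noncomputable def ringA {r : ℕ} (p : NonemptyInterval (AllSub r)) : Subring (Unit → Frac r) :=
  loc (polyFun fun _ => p.fst.toSubgroup) (eulerMonoid (fun _ => p.fst.toSubgroup) p.snd.toSubgroup)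
    (eulerMonoid_le _ _)

/-- For a pair `K ⊇ L` of connected subgroups the ring `𝓔_{K/L}⁻¹ 𝓞_{𝓕/L}`, with
`𝓞_{𝓕/L} = ∏_{L' ∈ 𝓕/L} H^*(B(T/L'); ℚ)`. -/
noncomputable def ringC {r : ℕ} (p : NonemptyInterval (ConnSub r)) :
    Subring (FinOver p.fst.toSubgroup → Frac r) :=
  loc (polyFun Subtype.val) (eulerMonoid Subtype.val p.snd.toSubgroup) (eulerMonoid_le _ _)

theorem ringA_map {r : ℕ} {p q : NonemptyInterval (AllSub r)} (h : p ≤ q) :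
    ∀ a ∈ ringA p, (fun x => a x) ∈ ringA q :=
  have h1 : q.fst.toSubgroup ≤ p.fst.toSubgroup := h.1.1
  have h2 : p.snd.toSubgroup ≤ q.snd.toSubgroup := h.2.1
  loc_map (fun x : Unit => x) (fun _ => h1) _ _ (eulerMonoid_map (fun x : Unit => x) (fun _ => h1) h2)

/-- The map `𝓕 / L → 𝓕 / K`, `L' ↦ L' K`, for `L ≤ K`. -/
noncomputable def FinOver.sup {r : ℕ} {L K : Subgroup (Torus r)} (h : L ≤ K) (x : FinOver L) :
    FinOver K :=
  ⟨x.1 ⊔ K, finOver_sup h x.2⟩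

theorem ringC_map {r : ℕ} {p q : NonemptyInterval (ConnSub r)} (h : p ≤ q) :
    ∀ a ∈ ringC p, (fun x => a (FinOver.sup h.1 x)) ∈ ringC q :=
  have h2 : p.snd.toSubgroup ≤ q.snd.toSubgroup := h.2
  loc_map (FinOver.sup h.1) (fun _ => le_sup_left) _ _
    (eulerMonoid_map (FinOver.sup h.1) (fun _ => le_sup_left) h2)

/-- The diagram `R_a^p` on the pairs of closed subgroups. -/
noncomputable def Rap (r : ℕ) : RingDiagram (NonemptyInterval (AllSub r)) :=
  functionDiagram (fun _ => Unit) (fun _ x => x) (fun _ _ => rfl) (fun _ _ _ => rfl) ringA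
    (fun h => ringA_map h)

/-- The diagram `R_c^p` on the pairs of connected subgroups. For `L ≤ K` the inflation
`𝓞_{𝓕/K} → 𝓞_{𝓕/L}` maps the factor of `L' K` to that of `L'`. -/
noncomputable def Rcp (r : ℕ) : RingDiagram (NonemptyInterval (ConnSub r)) :=
  functionDiagram (fun p => FinOver p.fst.toSubgroup)
    (fun h x => FinOver.sup h.1 x)
    (fun _ x => Subtype.ext (sup_eq_left.2 x.2.1))
    (fun {i j _} h _ x => Subtype.ext (by
      have h1 : j.fst.toSubgroup ≤ i.fst.toSubgroup := h.1
      change x.1 ⊔ i.fst.toSubgroup = (x.1 ⊔ j.fst.toSubgroup) ⊔ i.fst.toSubgroup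
      rw [sup_assoc, sup_eq_right.2 h1]))
    ringC
    (fun h => ringC_map h)

/-- The diagram `R_a^f` on flags `K_0 ⊃ ⋯ ⊃ K_s` of closed subgroups (successive quotients being
tori): its value is that of `R_a^p` at `K_0 ⊇ K_s`. -/
noncomputable def Raf (r : ℕ) : RingDiagram (FinFlag (AllSub r)) :=
  (Rap r).comap FinFlag.toInterval

/-- The diagram `R_c^f` on flags `K_0 ⊃ ⋯ ⊃ K_s` of connected subgroups: its value is that of
`R_c^p` at `K_0 ⊇ K_s`. -/
noncomputable def Rcf (r : ℕ) : RingDiagram (FinFlag (ConnSub r)) :=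
  (Rcp r).comap FinFlag.toInterval

/-! ### The diagram of rings indexed by dimension vectors -/

open Classical in
/-- The dimension vector of a flag of connected subgroups. -/
noncomputable def dims {r : ℕ} (E : FinFlag (ConnSub r)) : Finset ℕ := E.carrier.image ConnSub.dim

/-- The flags in `{0, 1, …, r}`: the nonempty subsets, ordered by inclusion. -/
abbrev DimVec (r : ℕ) : Type := {d : Finset ℕ // d.Nonempty ∧ ∀ i ∈ d, i ≤ r}

open Classical in
/-- The terms of a flag `E` whose dimension belongs to `d`. -/
noncomputable def subflag {r : ℕ} (d : DimVec r) (E : FinFlag (ConnSub r)) (h : d.1 ⊆ dims E) :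
    FinFlag (ConnSub r) where
  carrier := E.carrier.filter fun K => K.dim ∈ d.1
  nonempty := by
    obtain ⟨i, hi⟩ := d.2.1
    obtain ⟨K, hK, rfl⟩ := Finset.mem_image.1 (h hi)
    exact ⟨K, Finset.mem_filter.2 ⟨hK, hi⟩⟩
  chain := E.chain.mono (fun _ hK => (Finset.mem_filter.1 hK).1)

theorem subflag_le {r : ℕ} (d : DimVec r) (E : FinFlag (ConnSub r)) (h : d.1 ⊆ dims E) :
    subflag d E h ≤ E := by
  classical exact Finset.filter_subset _ _

theorem dims_subflag {r : ℕ} (d : DimVec r) (E : FinFlag (ConnSub r)) (h : d.1 ⊆ dims E) :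
    dims (subflag d E h) = d.1 := by
  classical
  ext i
  simp only [dims, subflag, Finset.mem_image, Finset.mem_filter]
  constructor
  · rintro ⟨K, ⟨_, hK⟩, rfl⟩
    exact hK
  · intro hi
    obtain ⟨K, hK, rfl⟩ := Finset.mem_image.1 (h hi)
    exact ⟨K, ⟨hK, hi⟩, rfl⟩

theorem subflag_self {r : ℕ} (d : DimVec r) (E : FinFlag (ConnSub r)) (h : dims E = d.1) :
    subflag d E h.ge = E := by
  classical
  refine FinFlag.ext (Finset.filter_true_of_mem fun K hK => ?_)
  rw [← h]
  exact Finset.mem_image_of_mem _ hK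

theorem subflag_subflag {r : ℕ} {d d' : DimVec r} (hd : d ≤ d') (E : FinFlag (ConnSub r))
    (h : d'.1 ⊆ dims E) (h' : d.1 ⊆ dims (subflag d' E h)) :
    subflag d (subflag d' E h) h' = subflag d E (subset_trans hd h) := by
  classical
  refine FinFlag.ext ?_
  change (E.carrier.filter _).filter _ = E.carrier.filter _
  rw [Finset.filter_filter]
  exact Finset.filter_congr fun K _ => ⟨fun hK => hK.2, fun hK => ⟨hd hK, hK⟩⟩

/-- The factors of the iterated product of dimension vector `d_0 > ⋯ > d_s`: the flags
`H_0 ⊃ ⋯ ⊃ H_s` of connected subgroups with `dim H_i = d_i`, together with a member of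
`𝓕 / H_s`. -/
def DimIndex {r : ℕ} (d : DimVec r) : Type :=
  {x : FinFlag (ConnSub r) × Subgroup (Torus r) // dims x.1 = d.1 ∧
    x.1.bot.toSubgroup ≤ x.2 ∧ x.1.bot.toSubgroup.relIndex x.2 ≠ 0}

open Classical in
/-- A choice, for each initial segment `H_0 ⊃ ⋯ ⊃ H_i` of a flag, of a representation
`V (H_0 ⊃ ⋯ ⊃ H_i)` of `T` without `H_i`-fixed vectors defines a function on the factors of the
iterated product: the product over the initial segments of the Euler classes of the chosen
representations. -/
noncomputable def dimMonoid {r : ℕ} (d : DimVec r) : Submonoid (DimIndex d → Frac r) where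
  carrier := {e | ∃ V : Finset (ConnSub r) → ConnSub r → Multiset (Fin r → ℤ),
    (∀ S H, NoFixed (V S H) H.toSubgroup) ∧
    e = fun x => ∏ H ∈ x.1.1.carrier, eulerFrac (V (x.1.1.carrier.filter (H ≤ ·)) H) x.1.2}
  one_mem' := by
    refine ⟨fun _ _ => 0, fun _ _ _ h => absurd h (Multiset.notMem_zero _), funext fun x => ?_⟩
    simp [eulerFrac_zero]
  mul_mem' := by
    rintro _ _ ⟨V, hV, rfl⟩ ⟨W, hW, rfl⟩
    refine ⟨fun S H => V S H + W S H, fun S H => (hV S H).add (hW S H), funext fun x => ?_⟩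
    simp [eulerFrac_add, Finset.prod_mul_distrib]

theorem dimMonoid_le {r : ℕ} (d : DimVec r) :
    ∀ s ∈ dimMonoid d, s ∈ polyFun fun x : DimIndex d => x.1.2 := by
  rintro _ ⟨V, _, rfl⟩ x
  exact Subring.prod_mem _ fun H _ => eulerFrac_mem _ _

/-- The iterated localised product
`∏_{H_0} 𝓔_{H_0}⁻¹ ∏_{H_1 ⊂ H_0} 𝓔_{H_1}⁻¹ ⋯ ∏_{H_s ⊂ H_{s-1}} 𝓞_{𝓕/H_s}`, `dim H_i = d_i`,
where `𝓔_H` consists of the Euler classes of the representations `V` of `T` with `V^H = 0`.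
The Euler class inverted at the `i`-th stage may depend on `H_0, …, H_i`, but not on the further
terms of the flag. -/
noncomputable def ringD {r : ℕ} (d : DimVec r) : Subring (DimIndex d → Frac r) :=
  loc (polyFun fun x => x.1.2) (dimMonoid d) (dimMonoid_le d)

/-- Restriction of the indices of iterated products to a smaller dimension vector. -/
noncomputable def dimRes {r : ℕ} {d d' : DimVec r} (h : d ≤ d') (x : DimIndex d') : DimIndex d :=
  have h' : d.1 ⊆ dims x.1.1 := x.2.1.symm ▸ h
  ⟨(subflag d x.1.1 h', x.1.2 ⊔ (subflag d x.1.1 h').bot.toSubgroup), dims_subflag d x.1.1 h',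
    finOver_sup (x.1.1.bot_le (subflag_le d x.1.1 h' (FinFlag.bot_mem _))) x.2.2⟩

theorem dimRes_id {r : ℕ} (d : DimVec r) (x : DimIndex d) : dimRes (le_refl d) x = x := by
  obtain ⟨⟨E, L⟩, hE, hL, hL'⟩ := x
  refine Subtype.ext (Prod.ext (subflag_self d E hE) ?_)
  change L ⊔ (subflag d E hE.ge).bot.toSubgroup = L
  rw [subflag_self d E hE]
  exact sup_eq_left.2 hL

theorem dimRes_comp {r : ℕ} {d d' d'' : DimVec r} (h : d ≤ d') (h' : d' ≤ d'')
    (x : DimIndex d'') : dimRes (h.trans h') x = dimRes h (dimRes h' x) := by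
  obtain ⟨⟨E, L⟩, hE, hL, hL'⟩ := x
  have e1 : d'.1 ⊆ dims E := hE.symm ▸ h'
  have e2 : d.1 ⊆ dims (subflag d' E e1) := by rw [dims_subflag]; exact h
  have e3 : subflag d (subflag d' E e1) e2 = subflag d E (subset_trans h e1) :=
    subflag_subflag h E e1 e2
  refine Subtype.ext (Prod.ext e3.symm ?_)
  change L ⊔ (subflag d E _).bot.toSubgroup =
    (L ⊔ (subflag d' E e1).bot.toSubgroup) ⊔ (subflag d (subflag d' E e1) e2).bot.toSubgroup
  have e4 : (subflag d' E e1).bot.toSubgroup ≤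
      (subflag d (subflag d' E e1) e2).bot.toSubgroup :=
    (subflag d' E e1).bot_le (subflag_le _ _ _ (FinFlag.bot_mem _))
  rw [sup_assoc, sup_eq_right.2 e4, e3]

theorem dimMonoid_map {r : ℕ} {d d' : DimVec r} (h : d ≤ d') :
    ∀ s ∈ dimMonoid d, ∃ s' ∈ dimMonoid d', ∀ x : DimIndex d', ∃ c ∈ cohFrac x.1.2,
      s' x = c * s (dimRes h x) := by
  classical
  rintro _ ⟨V, hV, rfl⟩
  refine ⟨_, ⟨fun S H => if H.dim ∈ d.1 then V (S.filter fun K => K.dim ∈ d.1) H else 0, ?_, rfl⟩,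
    fun x => ?_⟩
  · intro S H
    dsimp only
    split_ifs
    · exact hV _ _
    · exact fun _ h => absurd h (Multiset.notMem_zero _)
  · obtain ⟨⟨E, L⟩, hE, hL, hL'⟩ := x
    have h' : d.1 ⊆ dims E := hE.symm ▸ h
    choose c hc e using fun W : Multiset (Fin r → ℤ) =>
      eulerFrac_factor W (le_sup_left : L ≤ L ⊔ (subflag d E h').bot.toSubgroup)
    refine ⟨∏ H ∈ (subflag d E h').carrier,
      c (V ((subflag d E h').carrier.filter (H ≤ ·)) H), Subring.prod_mem _ fun _ _ => hc _, ?_⟩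
    change (∏ H ∈ E.carrier, eulerFrac _ L) = _ * ∏ H ∈ (subflag d E h').carrier,
      eulerFrac (V ((subflag d E h').carrier.filter (H ≤ ·)) H)
        (L ⊔ (subflag d E h').bot.toSubgroup)
    rw [← Finset.prod_mul_distrib]
    change _ = ∏ H ∈ E.carrier.filter (fun K => K.dim ∈ d.1), _
    rw [Finset.prod_filter]
    refine Finset.prod_congr rfl fun H _ => ?_
    by_cases hH : H.dim ∈ d.1
    · rw [if_pos hH, ← e]
      dsimp only
      rw [if_pos hH, Finset.filter_comm]
      rfl
    · rw [if_neg hH]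
      dsimp only
      rw [if_neg hH]
      exact eulerFrac_zero _

/-- The diagram `R_d^f` on dimension vectors. -/
noncomputable def Rdf (r : ℕ) : RingDiagram (DimVec r) :=
  functionDiagram DimIndex dimRes dimRes_id dimRes_comp ringD
    (fun h => loc_map (dimRes h) (fun _ => le_sup_left) (dimMonoid_le _) (dimMonoid_le _)
      (dimMonoid_map h))

/-- A flag of connected subgroups with dimension vector `d`. -/
abbrev FlagOfDim {r : ℕ} (d : DimVec r) : Type := {E : FinFlag (ConnSub r) // dims E = d.1}

/-- The subflag of dimension vector `d` of a flag of dimension vector `d' ≥ d`. -/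
noncomputable def FlagOfDim.res {r : ℕ} {d d' : DimVec r} (h : d ≤ d') (E : FlagOfDim d') :
    FlagOfDim d :=
  ⟨subflag d E.1 (E.2.symm ▸ h), dims_subflag d E.1 (E.2.symm ▸ h)⟩

theorem FlagOfDim.res_le {r : ℕ} {d d' : DimVec r} (h : d ≤ d') (E : FlagOfDim d') :
    (E.res h).1 ≤ E.1 :=
  subflag_le d E.1 (E.2.symm ▸ h)

/-- The factors of the iterated product that belong to the flag `E`. -/
def FlagOfDim.incl {r : ℕ} {d : DimVec r} (E : FlagOfDim d) (x : FinOver E.1.bot.toSubgroup) :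
    DimIndex d :=
  ⟨(E.1, x.1), E.2, x.2⟩

theorem component_aux {r : ℕ} {d : DimVec r} (E : FlagOfDim d) :
    ∀ a ∈ ringD d, (fun x => a (E.incl x)) ∈ ringC E.1.toInterval := by
  classical
  refine loc_map (K' := fun x : FinOver E.1.bot.toSubgroup => x.1) E.incl (fun _ => le_rfl)
    (dimMonoid_le d) (eulerMonoid_le _ _) ?_
  rintro _ ⟨V, hV, rfl⟩
  refine ⟨_, ⟨∑ H ∈ E.1.carrier, V (E.1.carrier.filter (H ≤ ·)) H, ?_, rfl⟩,
    fun x => ⟨1, Subring.one_mem _, ?_⟩⟩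
  · intro n hn
    obtain ⟨H, hH, hn⟩ := Multiset.mem_sum.1 hn
    exact (hV _ _).mono (E.1.le_top hH) n hn
  · rw [one_mul]
    change eulerFrac _ x.1 = ∏ H ∈ E.1.carrier, eulerFrac (V (E.1.carrier.filter (H ≤ ·)) H) x.1
    generalize E.1.carrier = S
    have key : ∀ S' : Finset (ConnSub r),
        eulerFrac (∑ H ∈ S', V (S.filter (H ≤ ·)) H) x.1 =
          ∏ H ∈ S', eulerFrac (V (S.filter (H ≤ ·)) H) x.1 := by
      intro S'
      induction S' using Finset.induction with
      | empty => simp [eulerFrac_zero]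
      | insert a s ha ih => rw [Finset.sum_insert ha, Finset.prod_insert ha, eulerFrac_add, ih]
    convert key S

/-- The projection `R_d^f(d) → R_c^f(E)` onto the factor of the flag `E`. -/
noncomputable def component {r : ℕ} {d : DimVec r} (E : FlagOfDim d) :
    (Rdf r).ring d →+* (Rcf r).ring E.1 :=
  grMap (ringD d) (ringC E.1.toInterval) E.incl (component_aux E)

/-! ### Modules over diagrams of rings -/

/-- A graded module over a diagram of graded rings: a graded `R(j)`-module for each `j`, with
transition maps that are linear over those of `R`. -/
structure GrMod {J : Type} [Preorder J] (R : RingDiagram J) where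
  obj : J → Type
  [addCommGroup : ∀ j, AddCommGroup (obj j)]
  [module : ∀ j, Module (R.ring j) (obj j)]
  deg : ∀ j, ℤ → AddSubgroup (obj j)
  internal : ∀ j, DirectSum.IsInternal (deg j)
  smul_mem : ∀ (j : J) (m n : ℤ) (a : R.ring j) (x : obj j), a ∈ R.homog j m → x ∈ deg j n →
    a • x ∈ deg j (n + 2 * m)
  map : ∀ {i j : J} (h : i ≤ j), obj i →ₛₗ[R.map h] obj j
  map_deg : ∀ {i j : J} (h : i ≤ j) (n : ℤ) (x : obj i), x ∈ deg i n → map h x ∈ deg j n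
  map_id : ∀ (j : J) (x : obj j), map (le_refl j) x = x
  map_comp : ∀ {i j k : J} (h : i ≤ j) (h' : j ≤ k) (x : obj i),
    map (h.trans h') x = map h' (map h x)

attribute [instance] GrMod.addCommGroup GrMod.module

/-- Degree preserving maps of graded modules. -/
@[ext]
structure GrMod.Hom {J : Type} [Preorder J] {R : RingDiagram J} (M N : GrMod R) where
  app : ∀ j, M.obj j →ₗ[R.ring j] N.obj j
  app_deg : ∀ (j : J) (n : ℤ) (x : M.obj j), x ∈ M.deg j n → app j x ∈ N.deg j n
  naturality : ∀ {i j : J} (h : i ≤ j) (x : M.obj i), app j (M.map h x) = N.map h (app i x)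

instance {J : Type} [Preorder J] (R : RingDiagram J) : Category (GrMod R) where
  Hom M N := GrMod.Hom M N
  id M := ⟨fun _ => LinearMap.id, fun _ _ _ h => h, fun _ _ => rfl⟩
  comp f g := ⟨fun j => (g.app j).comp (f.app j), fun j n x h => g.app_deg j n _ (f.app_deg j n x h),
    fun h x => by simp [f.naturality, g.naturality]⟩

/-- A differential graded module: a graded module with a differential of (cohomological) degree one
on each value, linear over the rings (which are concentrated in even degrees and carry the zero
differential), and compatible with the transition maps. -/
structure DGMod {J : Type} [Preorder J] (R : RingDiagram J) extends GrMod R where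
  d : ∀ j, obj j →ₗ[R.ring j] obj j
  d_deg : ∀ (j : J) (n : ℤ) (x : obj j), x ∈ deg j n → d j x ∈ deg j (n + 1)
  d_d : ∀ (j : J) (x : obj j), d j (d j x) = 0
  d_map : ∀ {i j : J} (h : i ≤ j) (x : obj i), d j (map h x) = map h (d i x)

/-- Maps of graded modules of degree zero that commute with the differentials. -/
@[ext]
structure DGMod.Hom {J : Type} [Preorder J] {R : RingDiagram J} (M N : DGMod R) extends
    GrMod.Hom M.toGrMod N.toGrMod where
  app_d : ∀ (j : J) (x : M.obj j), app j (M.d j x) = N.d j (app j x)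

instance {J : Type} [Preorder J] (R : RingDiagram J) : Category (DGMod R) where
  Hom M N := DGMod.Hom M N
  id M := ⟨⟨fun _ => LinearMap.id, fun _ _ _ h => h, fun _ _ => rfl⟩, fun _ _ => rfl⟩
  comp f g := ⟨⟨fun j => (g.app j).comp (f.app j),
    fun j n x h => g.app_deg j n _ (f.app_deg j n x h),
    fun h x => by simp [f.naturality, g.naturality]⟩,
    fun j x => by simp [f.app_d, g.app_d]⟩

/-! ### Quasi-coherent and extended modules -/

/-- A map `f : M → N`, linear over `φ : R → S`, is an extension of scalars: the induced map
`S ⊗[R] M → N` is an isomorphism. -/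
def IsExtension {R S M N : Type} [CommRing R] [CommRing S] [AddCommGroup M] [AddCommGroup N]
    [Module R M] [Module S N] (φ : R →+* S) (f : M →ₛₗ[φ] N) : Prop :=
  letI : Algebra R S := φ.toAlgebra
  letI : Module R N := Module.compHom N φ
  haveI : IsScalarTower R S N := ⟨fun a s x => mul_smul (φ a) s x⟩
  IsBaseChange S ({ toFun := f, map_add' := f.map_add, map_smul' := f.map_smulₛₗ } : M →ₗ[R] N)

theorem pure_fst_le {P : Type} [Preorder P] (p : NonemptyInterval P) :
    NonemptyInterval.pure p.fst ≤ p :=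
  ⟨le_rfl, p.fst_le_snd⟩

theorem pure_snd_le {P : Type} [Preorder P] (p : NonemptyInterval P) :
    NonemptyInterval.pure p.snd ≤ p :=
  ⟨p.fst_le_snd, le_rfl⟩

/-- Quasi-coherent extended modules over a diagram of rings on pairs. As `R(K ⊇ L)` is the
localisation `𝓔_{K/L}⁻¹ R(L ⊇ L)`, the first condition says `M(K ⊇ L) = 𝓔_{K/L}⁻¹ M(L ⊇ L)`
(quasi-coherence); the second says `M(K ⊇ L) = R(K ⊇ L) ⊗ M(K ⊇ K)` over `R(K ⊇ K)`. -/
def IsQcePairs {P : Type} [Preorder P] {R : RingDiagram (NonemptyInterval P)} (M : GrMod R) :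
    Prop :=
  ∀ p, IsExtension (R.map (pure_fst_le p)) (M.map (pure_fst_le p)) ∧
    IsExtension (R.map (pure_snd_le p)) (M.map (pure_snd_le p))

/-- Quasi-coherent extended modules over a diagram of rings on flags:
`M(K_0 ⊃ ⋯ ⊃ K_s) = 𝓔_{K_0/K_s}⁻¹ M(K_s)` and
`M(K_0 ⊃ ⋯ ⊃ K_s) = R(K_0 ⊃ ⋯ ⊃ K_s) ⊗ M(K_0)` over `R(K_0)`. -/
def IsQceFlags {P : Type} [PartialOrder P] {R : RingDiagram (FinFlag P)} (M : GrMod R) : Prop :=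
  ∀ E : FinFlag P,
    IsExtension (R.map (FinFlag.single_le E.bot_mem)) (M.map (FinFlag.single_le E.bot_mem)) ∧
    IsExtension (R.map (FinFlag.single_le E.top_mem)) (M.map (FinFlag.single_le E.top_mem))

/-! ### `𝓕`-continuity -/

/-- The Euler class `e(V^L)` as an element of `R_a^p(K ⊇ L)`. -/
noncomputable def eulerA {r : ℕ} (p : NonemptyInterval (AllSub r)) (V : Multiset (Fin r → ℤ)) :
    (Rap r).ring p :=
  ⟨fun _ => eulerFrac V p.fst.toSubgroup, by
    classical
    obtain ⟨k, hk⟩ := chern_prod_isHomogeneous (V.filter (· ∈ ann p.fst.toSubgroup))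
    refine Subring.subset_closure ⟨⟨1, Submonoid.one_mem _, ?_⟩, (k : ℤ), fun _ => Or.inr
      ⟨euler V p.fst.toSubgroup, 1, k, 0, ?_, MvPolynomial.isHomogeneous_one _ _, one_ne_zero, ?_,
        by simp⟩⟩
    · rw [one_mul]
      exact fun _ => eulerFrac_mem V _
    · rw [euler]
      convert hk
    · simp [eulerFrac]⟩

/-- The Euler class `e(V^{K_s})` as an element of `R_a^f(K_0 ⊃ ⋯ ⊃ K_s)`. -/
noncomputable def eulerAFlag {r : ℕ} (E : FinFlag (AllSub r)) (V : Multiset (Fin r → ℤ)) :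
    (Raf r).ring E :=
  eulerA (FinFlag.toInterval E) V

/-- `𝓕`-continuity of a module over `R_a^p`: for every closed subgroup `K` and every connected
subgroup `L` of `K` the image of the map `M(K) → ∏_{L'} M(K ⊇ L') = ∏_{L'} 𝓔_{K/L'}⁻¹ M(L')`,
where `L'` runs through the subgroups with identity component `L` that are cotoral in `K`, lies in
the image of `𝓔_K⁻¹ ∏_{L'} M(L')`. That is, the Euler class in the denominators can be chosen
uniformly in `L'`. -/
def IsFContinuousPairs {r : ℕ} (M : GrMod (Rap r)) : Prop :=
  ∀ (K : AllSub r) (x : M.obj (NonemptyInterval.pure K)) (L : ConnSub r),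
    ∃ V : Multiset (Fin r → ℤ), NoFixed V K.toSubgroup ∧
      ∀ (L' : AllSub r) (h : L' ≤ K), L.toSubgroup ≤ L'.toSubgroup →
        L.toSubgroup.relIndex L'.toSubgroup ≠ 0 →
        ∃ y : M.obj (NonemptyInterval.pure L'),
          M.map (pure_fst_le ⟨(L', K), h⟩) y =
            eulerA ⟨(L', K), h⟩ V • M.map (pure_snd_le ⟨(L', K), h⟩) x

theorem left_mem_pair {P : Type} [PartialOrder P] {x y : P} (h : x ≤ y) :
    x ∈ (FinFlag.pair h).carrier := by
  classical simp [FinFlag.pair]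

theorem right_mem_pair {P : Type} [PartialOrder P] {x y : P} (h : x ≤ y) :
    y ∈ (FinFlag.pair h).carrier := by
  classical simp [FinFlag.pair]

/-- `𝓕`-continuity of a module over `R_a^f`: the same condition, with `M(K ⊃ L')` in place of
`M(K ⊇ L')`. -/
def IsFContinuousFlags {r : ℕ} (M : GrMod (Raf r)) : Prop :=
  ∀ (K : AllSub r) (x : M.obj (FinFlag.single K)) (L : ConnSub r),
    ∃ V : Multiset (Fin r → ℤ), NoFixed V K.toSubgroup ∧
      ∀ (L' : AllSub r) (h : L' ≤ K), L.toSubgroup ≤ L'.toSubgroup →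
        L.toSubgroup.relIndex L'.toSubgroup ≠ 0 →
        ∃ y : M.obj (FinFlag.single L'),
          M.map (FinFlag.single_le (left_mem_pair h)) y =
            eulerAFlag (FinFlag.pair h) V •
              M.map (FinFlag.single_le (right_mem_pair h)) x

/-! ### Product-quasi-coherent extended modules -/

theorem single_le_of_top_eq {r : ℕ} {d : DimVec r} {E : FlagOfDim d} {H : ConnSub r}
    (h : E.1.top = H) : FinFlag.single H ≤ E.1 :=
  FinFlag.single_le (h ▸ E.1.top_mem)

/-- A family of elements of the values of `N` at the flags of dimension vector `d` is extended if
for each `H_0` its part on the flags starting with `H_0` is a finite sum of products `a • m` with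
`a` in the iterated product `R_d^f(d)` and `m ∈ N(H_0)`. -/
def IsExtendedFamily {r : ℕ} (N : GrMod (Rcf r)) {d : DimVec r}
    (x : ∀ E : FlagOfDim d, N.obj E.1) : Prop :=
  ∀ H : ConnSub r, ∃ (k : ℕ) (a : Fin k → (Rdf r).ring d) (m : Fin k → N.obj (FinFlag.single H)),
    ∀ (E : FlagOfDim d) (h : E.1.top = H),
      x E = ∑ i, component E (a i) • N.map (single_le_of_top_eq h) (m i)

/-- The image of a family on the flags of dimension vector `d` at `d' ≥ d`. -/
noncomputable def pushFamily {r : ℕ} (N : GrMod (Rcf r)) {d d' : DimVec r} (h : d ≤ d')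
    (x : ∀ E : FlagOfDim d, N.obj E.1) (E : FlagOfDim d') : N.obj E.1 :=
  N.map (E.res_le h) (x (E.res h))

/-- `M` is the `p`-product of `N`: the value of `N` at a flag `E` of dimension vector `d` is the
summand `e_E M(d) = R_c^f(E) ⊗_{R_d^f(d)} M(d)` of `M(d)`, and (in each degree) `M(d)` is the
submodule of `∏_E N(E)` of the families whose images at all `d' ≥ d` are extended. -/
structure IsPProduct {r : ℕ} (M : GrMod (Rdf r)) (N : GrMod (Rcf r))
    (π : ∀ (d : DimVec r) (E : FlagOfDim d), M.obj d →ₛₗ[component E] N.obj E.1) : Prop where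
  map_deg : ∀ (d : DimVec r) (E : FlagOfDim d) (n : ℤ) (x : M.obj d), x ∈ M.deg d n →
    π d E x ∈ N.deg E.1 n
  naturality : ∀ {d d' : DimVec r} (h : d ≤ d') (E : FlagOfDim d') (x : M.obj d),
    π d' E (M.map h x) = N.map (E.res_le h) (π d (E.res h) x)
  isExtension : ∀ (d : DimVec r) (E : FlagOfDim d), IsExtension (component E) (π d E)
  injective : ∀ (d : DimVec r) (n : ℤ) (x : M.obj d), x ∈ M.deg d n → (∀ E, π d E x = 0) → x = 0
  range : ∀ (d : DimVec r) (n : ℤ) (x : ∀ E : FlagOfDim d, N.obj E.1), (∀ E, x E ∈ N.deg E.1 n) →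
    ((∃ y ∈ M.deg d n, ∀ E, π d E y = x E) ↔
      ∀ (d' : DimVec r) (h : d ≤ d'), IsExtendedFamily N (pushFamily N h x))

/-- Product-quasi-coherent extended modules over `R_d^f`: the `p`-products of the quasi-coherent
extended modules over `R_c^f`. -/
def IsPqce {r : ℕ} (M : GrMod (Rdf r)) : Prop :=
  ∃ N : GrMod (Rcf r), IsQceFlags N ∧ ∃ π, IsPProduct M N π

/-! ### The algebraic models -/

/-- `𝓐_a^p(T)`: the `𝓕`-continuous qce modules over `R_a^p`. -/
abbrev Aap (r : ℕ) : Type 1 :=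
  ObjectProperty.FullSubcategory fun M : GrMod (Rap r) => IsQcePairs M ∧ IsFContinuousPairs M

/-- `𝓐_a^f(T)`: the `𝓕`-continuous qce modules over `R_a^f`. -/
abbrev Aaf (r : ℕ) : Type 1 :=
  ObjectProperty.FullSubcategory fun M : GrMod (Raf r) => IsQceFlags M ∧ IsFContinuousFlags M

/-- `𝓐_c^p(T)`: the qce modules over `R_c^p`. -/
abbrev Acp (r : ℕ) : Type 1 :=
  ObjectProperty.FullSubcategory fun M : GrMod (Rcp r) => IsQcePairs M

/-- `𝓐_c^f(T)`: the qce modules over `R_c^f`. -/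
abbrev Acf (r : ℕ) : Type 1 :=
  ObjectProperty.FullSubcategory fun M : GrMod (Rcf r) => IsQceFlags M

/-- `𝓐_d^f(T)`: the pqce modules over `R_d^f`. -/
abbrev Adf (r : ℕ) : Type 1 :=
  ObjectProperty.FullSubcategory fun M : GrMod (Rdf r) => IsPqce M

/-- `d𝓐_a^p(T)`: the `𝓕`-continuous qce differential modules over `R_a^p`. -/
abbrev dAap (r : ℕ) : Type 1 :=
  ObjectProperty.FullSubcategory fun M : DGMod (Rap r) =>
    IsQcePairs M.toGrMod ∧ IsFContinuousPairs M.toGrMod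

/-- `d𝓐_a^f(T)`: the `𝓕`-continuous qce differential modules over `R_a^f`. -/
abbrev dAaf (r : ℕ) : Type 1 :=
  ObjectProperty.FullSubcategory fun M : DGMod (Raf r) =>
    IsQceFlags M.toGrMod ∧ IsFContinuousFlags M.toGrMod

/-- `d𝓐_c^p(T)`: the qce differential modules over `R_c^p`. -/
abbrev dAcp (r : ℕ) : Type 1 :=
  ObjectProperty.FullSubcategory fun M : DGMod (Rcp r) => IsQcePairs M.toGrMod

/-- `d𝓐_c^f(T)`: the qce differential modules over `R_c^f`. -/
abbrev dAcf (r : ℕ) : Type 1 :=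
  ObjectProperty.FullSubcategory fun M : DGMod (Rcf r) => IsQceFlags M.toGrMod

/-- `d𝓐_d^f(T)`: the pqce differential modules over `R_d^f`. -/
abbrev dAdf (r : ℕ) : Type 1 :=
  ObjectProperty.FullSubcategory fun M : DGMod (Rdf r) => IsPqce M.toGrMod

end TorusModel

/-!
All ten models are classes of modules over diagrams of rings, and a graded module is the same thing
as a differential module with zero differential. So it suffices to treat, for each model, the class
`dgProp Q Z` of the differential modules whose underlying graded module satisfies `Q`, and whose
differential vanishes if the proposition `Z` holds; `Z := True` and `Z := False` give the two
versions of the model (`isLocallyPresentable_both`).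

The criterion `isLocallyPresentable_of_hasSmallSubs` says that a class of differential modules is
locally presentable if it is closed under colimits, and if for some infinite cardinal `c` bounding
the diagram every module in the class is the union of submodules of cardinality at most `c` that
belong to the class. Indeed colimits are formed on the values, so modules of cardinality at most `c`
are `c⁺`-presentable, and those in the class form, up to isomorphism, a set, which is a strong
generator. Small submodules in the class arise as subsets closed under suitable operations with
finitely many arguments (`HasSmallSubs`), which makes the condition stable under conjunctions of at
most `c` properties.

Quasi-coherence and extendedness mean that certain transition maps are extensions of scalars. This
is preserved by colimits because of its universal property, and it passes to all submodules that
contain, with each element of the target, the elements of the source needed to express it, and,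
with each relation, finitely many elements that witness the vanishing of a tensor
(`hasSmallSubs_isExtension`). `𝓕`-continuity is preserved by colimits because two Euler classes have
a common multiple, and it passes to submodules that contain chosen preimages.

The modules over `R_d^f` are not defined by conditions of this kind; in fact pqce modules are not
obviously closed under colimits. Instead, the `p`-product is an equivalence from qce modules over
`R_c^f` to pqce modules over `R_d^f` (`pProductFunctor`). The ring `R_c^f(E)` is a direct factor of
`R_d^f(d)`, and the elements of `N(E)`, extended by zero, belong to the `p`-product
(`push_singleFamily_mem`); hence every `N` has a `p`-product, and morphisms and differentials
descend from `p`-products to the values at flags (`IsPProduct.exists_descent`). This uses that a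
flag has at most one subflag of a given dimension vector, that is, that nested connected subgroups
of the same dimension are equal (`ConnSub.eq_of_le_of_dim_eq`), which follows from the duality of
closed subgroups of the torus and groups of characters.
-/

namespace TorusModel

open Limits

/-! ### Homogeneous components -/

section Internal

variable {A B : Type} [AddCommGroup A] [AddCommGroup B]

/-- A sum decomposition is direct if the homogeneous components can be read off by additive maps
(possibly after an injective map `i` into a larger group). -/
theorem isInternal_of_components (deg : ℤ → AddSubgroup A) (i : A →+ B)
    (hi : Function.Injective i) (p : ℤ → A →+ B)
    (hp : ∀ n, ∀ x ∈ deg n, p n x = i x) (hp' : ∀ m n, m ≠ n → ∀ x ∈ deg n, p m x = 0)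
    (htop : ∀ x, x ∈ ⨆ n, deg n) : DirectSum.IsInternal deg := by
  classical
  constructor
  · rw [injective_iff_map_eq_zero]
    intro v hv
    have key : ∀ (m : ℤ) (v : DirectSum ℤ fun n => deg n),
        p m (DirectSum.coeAddMonoidHom deg v) = i (v m) := by
      intro m v
      induction v using DirectSum.induction_on with
      | zero => simp
      | of n x =>
        rw [DirectSum.coeAddMonoidHom_of]
        by_cases h : m = n
        · subst h
          rw [hp _ _ x.2, DirectSum.of_eq_same]
        · rw [hp' _ _ h _ x.2, DirectSum.of_eq_of_ne _ _ _ h]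
          simp
      | add x y hx hy => simp [hx, hy]
    refine DFinsupp.ext fun m => Subtype.ext (hi ?_)
    rw [← key m v, hv]
    simp
  · intro x
    refine AddSubgroup.iSup_induction (C := fun x => ∃ v, DirectSum.coeAddMonoidHom deg v = x)
      deg (htop x) ?_ ⟨0, map_zero _⟩ ?_
    · intro n x hx
      exact ⟨DirectSum.of (fun n => deg n) n ⟨x, hx⟩, DirectSum.coeAddMonoidHom_of _ _ _⟩
    · rintro _ _ ⟨v, rfl⟩ ⟨w, rfl⟩
      exact ⟨v + w, map_add _ _ _⟩

variable {deg : ℤ → AddSubgroup A} (h : DirectSum.IsInternal deg)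

/-- The component of degree `n`. -/
noncomputable def component' (n : ℤ) : A →+ A :=
  (deg n).subtype.comp ((DFinsupp.evalAddMonoidHom n).comp
    (AddEquiv.ofBijective (DirectSum.coeAddMonoidHom deg) h).symm.toAddMonoidHom)

theorem component'_mem (n : ℤ) (x : A) : component' h n x ∈ deg n := SetLike.coe_mem _

theorem component'_coe (v : DirectSum ℤ fun n => deg n) (n : ℤ) :
    component' h n (DirectSum.coeAddMonoidHom deg v) = v n := by
  have : (AddEquiv.ofBijective (DirectSum.coeAddMonoidHom deg) h).symm
      (DirectSum.coeAddMonoidHom deg v) = v :=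
    (AddEquiv.ofBijective (DirectSum.coeAddMonoidHom deg) h).symm_apply_apply v
  simp only [component', AddMonoidHom.comp_apply, AddEquiv.coe_toAddMonoidHom, this]
  rfl

theorem component'_of_mem {n : ℤ} {x : A} (hx : x ∈ deg n) : component' h n x = x := by
  classical
  have := component'_coe h (DirectSum.of (fun n => deg n) n ⟨x, hx⟩) n
  simpa using this

theorem component'_of_mem_ne {m n : ℤ} (hmn : m ≠ n) {x : A} (hx : x ∈ deg n) :
    component' h m x = 0 := by
  classical
  have := component'_coe h (DirectSum.of (fun n => deg n) n ⟨x, hx⟩) m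
  rw [DirectSum.coeAddMonoidHom_of, DirectSum.of_eq_of_ne _ _ _ hmn] at this
  simpa using this

include h in
theorem mem_iSup_of_isInternal (x : A) : x ∈ ⨆ n, deg n := by
  classical
  obtain ⟨v, rfl⟩ := h.2 x
  induction v using DirectSum.induction_on with
  | zero => simp
  | of n x =>
    rw [DirectSum.coeAddMonoidHom_of]
    exact AddSubgroup.mem_iSup_of_mem n x.2
  | add x y hx hy => simpa using add_mem hx hy

include h in
/-- Additive induction on homogeneous elements. -/
theorem homogeneous_induction {C : A → Prop} (x : A) (h0 : C 0)
    (hC : ∀ n, ∀ x ∈ deg n, C x) (hadd : ∀ x y, C x → C y → C (x + y)) : C x :=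
  AddSubgroup.iSup_induction (C := C) deg (mem_iSup_of_isInternal h x) hC h0 hadd

theorem eq_zero_of_component' {x : A} (hx : ∀ n, component' h n x = 0) : x = 0 := by
  obtain ⟨v, rfl⟩ := h.2 x
  have : v = 0 := DFinsupp.ext fun n => Subtype.ext (by rw [← component'_coe h, hx]; rfl)
  rw [this, map_zero]

variable {deg' : ℤ → AddSubgroup B} (h' : DirectSum.IsInternal deg')

/-- Additive maps that shift the degree by `k` commute with the homogeneous components. -/
theorem map_component' (f : A →+ B) (k : ℤ) (hf : ∀ n, ∀ x ∈ deg n, f x ∈ deg' (n + k)) (n : ℤ)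
    (x : A) : component' h' (n + k) (f x) = f (component' h n x) := by
  refine homogeneous_induction (C := fun x => component' h' (n + k) (f x) = f (component' h n x))
    h x (by simp) ?_ ?_
  · intro m x hx
    by_cases hmn : n = m
    · subst hmn
      rw [component'_of_mem h hx, component'_of_mem h' (hf _ _ hx)]
    · rw [component'_of_mem_ne h hmn hx, map_zero,
        component'_of_mem_ne h' (by simpa using hmn) (hf _ _ hx)]
  · intro x y hx hy
    simp [hx, hy]

theorem mem_of_component' {n : ℤ} {x : A} (hx : ∀ m, m ≠ n → component' h m x = 0) :
    x ∈ deg n := by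
  have : x - component' h n x = 0 := by
    refine eq_zero_of_component' h fun m => ?_
    rw [map_sub]
    by_cases hm : m = n
    · subst hm
      rw [component'_of_mem h (component'_mem h m x), sub_self]
    · rw [hx m hm, component'_of_mem_ne h hm (component'_mem h n x), sub_zero]
  rw [sub_eq_zero.1 this]
  exact component'_mem h n x

end Internal

variable {J : Type} [Preorder J] {R : RingDiagram J}

/-- The homogeneous component of degree `n` of an element of a graded module. -/
noncomputable def GrMod.proj (M : GrMod R) (j : J) (n : ℤ) : M.obj j →+ M.obj j :=
  component' (M.internal j) n

theorem GrMod.Hom.proj {M N : GrMod R} (f : GrMod.Hom M N) (j : J) (n : ℤ) (x : M.obj j) :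
    f.app j (M.proj j n x) = N.proj j n (f.app j x) := by
  have := map_component' (M.internal j) (N.internal j) (f.app j).toAddMonoidHom 0
    (by simpa using f.app_deg j) n x
  rw [add_zero] at this
  exact this.symm

@[simp]
theorem DGMod.comp_app {M N K : DGMod R} (f : M ⟶ N) (g : N ⟶ K) (j : J) (x : M.obj j) :
    (f ≫ g).app j x = g.app j (f.app j x) := rfl

theorem DGMod.hom_ext {M N : DGMod R} {f g : M ⟶ N} (h : ∀ j x, f.app j x = g.app j x) :
    f = g :=
  DGMod.Hom.ext (funext fun j => LinearMap.ext (h j))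

/-- A morphism that is bijective on all values is an isomorphism. -/
theorem DGMod.isIso_of_bijective {M N : DGMod R} (f : M ⟶ N)
    (hf : ∀ j, Function.Bijective (f.app j)) : IsIso f := by
  let e : ∀ j, M.obj j ≃ₗ[R.ring j] N.obj j := fun j => LinearEquiv.ofBijective (f.app j) (hf j)
  have he : ∀ j y, f.app j ((e j).symm y) = y := fun j y => (e j).apply_symm_apply y
  have he' : ∀ j x, (e j).symm (f.app j x) = x := fun j x => (e j).symm_apply_apply x
  let g : N ⟶ M :=
    { app := fun j => (e j).symm
      app_deg := fun j n y hy => by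
        refine mem_of_component' (M.internal j) fun m hm => (hf j).1 ?_
        rw [map_zero]
        refine (f.proj j m _).trans ?_
        erw [he]
        exact component'_of_mem_ne (N.internal j) hm hy
      naturality := fun {i j} h y => (hf j).1 (by
        erw [he, f.naturality, he])
      app_d := fun j y => (hf j).1 (by
        erw [he, f.app_d, he]) }
  exact ⟨g, DGMod.hom_ext fun j x => he' j x, DGMod.hom_ext fun j y => he j y⟩

/-! ### Colimits of differential modules -/

variable (R) in
/-- The value at `j`, as a module. -/
def evMod (j : J) : DGMod R ⥤ ModuleCat (R.ring j) where
  obj M := ModuleCat.of _ (M.obj j)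
  map f := ModuleCat.ofHom (f.app j)

variable (R) in
/-- The value at `j`, as an abelian group. -/
def evAb (j : J) : DGMod R ⥤ AddCommGrpCat.{0} :=
  evMod R j ⋙ forget₂ (ModuleCat (R.ring j)) AddCommGrpCat

section AddColimit

variable {I : Type} [SmallCategory I] {K : I ⥤ AddCommGrpCat.{0}} {c : Cocone K}
  (hc : IsColimit c)

include hc

theorem addColimit_exists_desc {Y : Type} [AddCommGroup Y] (g : ∀ i, K.obj i →+ Y)
    (hg : ∀ {i i' : I} (φ : i ⟶ i') (x : K.obj i), g i' (K.map φ x) = g i x) :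
    ∃ G : c.pt →+ Y, ∀ i x, G (c.ι.app i x) = g i x := by
  let s : Cocone K :=
    { pt := AddCommGrpCat.of Y
      ι := { app := fun i => AddCommGrpCat.ofHom (g i)
             naturality := fun i i' φ => by
              ext x
              exact hg φ x } }
  exact ⟨(hc.desc s).hom, fun i x => congrArg (fun f => f.hom x) (hc.fac s i)⟩

theorem addColimit_hom_ext {Y : Type} [AddCommGroup Y] {G G' : c.pt →+ Y}
    (h : ∀ i x, G (c.ι.app i x) = G' (c.ι.app i x)) : G = G' := by
  have : AddCommGrpCat.ofHom G = AddCommGrpCat.ofHom G' :=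
    hc.hom_ext fun i => by
      ext x
      exact h i x
  exact congrArg AddCommGrpCat.Hom.hom this

theorem addColimit_induction {C : c.pt → Prop} (x : c.pt) (h0 : C 0)
    (hι : ∀ i x, C (c.ι.app i x)) (hadd : ∀ x y, C x → C y → C (x + y))
    (hneg : ∀ x, C x → C (-x)) : C x := by
  let S : AddSubgroup c.pt :=
    { carrier := {x | C x}
      zero_mem' := h0
      add_mem' := hadd _ _
      neg_mem' := hneg _ }
  have : QuotientAddGroup.mk' S = 0 := addColimit_hom_ext hc fun i x =>
    (QuotientAddGroup.eq_zero_iff _).2 (hι i x)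
  exact (QuotientAddGroup.eq_zero_iff x).1 (DFunLike.congr_fun this x)

end AddColimit

variable {I : Type} [SmallCategory I] {F : I ⥤ DGMod R}

/-- The legs of a cocone, with the point of the cocone as their target. -/
def leg (c : Cocone F) (i : I) : F.obj i ⟶ c.pt := c.ι.app i

theorem leg_w (c : Cocone F) {i i' : I} (φ : i ⟶ i') (j : J) (x : (F.obj i).obj j) :
    (leg c i').app j ((F.map φ).app j x) = (leg c i).app j x :=
  congrArg (fun f : F.obj i ⟶ c.pt => f.app j x) (c.w φ)

/-- A cocone of differential modules whose values are colimits of abelian groups. -/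
def IsPointwiseColimit (c : Cocone F) : Prop :=
  ∀ j, Nonempty (IsColimit ((evAb R j).mapCocone c))

namespace IsPointwiseColimit

variable {c : Cocone F} (hc : IsPointwiseColimit c)

include hc

theorem exists_desc (j : J) {Y : Type} [AddCommGroup Y] (g : ∀ i, (F.obj i).obj j →+ Y)
    (hg : ∀ {i i' : I} (φ : i ⟶ i') (x : (F.obj i).obj j), g i' ((F.map φ).app j x) = g i x) :
    ∃ G : c.pt.obj j →+ Y, ∀ i x, G ((leg c i).app j x) = g i x :=
  addColimit_exists_desc (hc j).some g hg

theorem hom_ext (j : J) {Y : Type} [AddCommGroup Y] {G G' : c.pt.obj j →+ Y}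
    (h : ∀ i x, G ((leg c i).app j x) = G' ((leg c i).app j x)) : G = G' :=
  addColimit_hom_ext (hc j).some h

theorem induction (j : J) {C : c.pt.obj j → Prop} (x : c.pt.obj j) (h0 : C 0)
    (hι : ∀ i x, C ((leg c i).app j x)) (hadd : ∀ x y, C x → C y → C (x + y))
    (hneg : ∀ x, C x → C (-x)) : C x :=
  addColimit_induction (hc j).some x h0 hι hadd hneg

/-- A cocone that is a colimit on the values is a colimit. -/
theorem isColimit : Nonempty (IsColimit c) := by
  have hG : ∀ (s : Cocone F) (j : J), ∃ G : c.pt.obj j →+ s.pt.obj j,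
      ∀ i x, G ((leg c i).app j x) = (leg s i).app j x := fun s j =>
    hc.exists_desc j (fun i => ((leg s i).app j).toAddMonoidHom) (fun φ x => leg_w s φ j x)
  choose G hG using hG
  let D : ∀ s : Cocone F, c.pt ⟶ s.pt := fun s =>
    { app := fun j =>
        { toFun := G s j
          map_add' := (G s j).map_add
          map_smul' := fun a x => by
            refine hc.induction j (C := fun x => G s j (a • x) = a • G s j x) x (by simp) ?_ ?_ ?_
            · intro i x
              rw [← map_smul, hG, hG]
              exact ((leg s i).app j).map_smul a x
            · intro x y hx hy
              simp [hx, hy]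
            · intro x hx
              simp [hx] }
      app_deg := fun j n x hx => by
        -- the homogeneous elements are sums of images of homogeneous elements
        have key : ∀ y : c.pt.obj j, G s j (c.pt.proj j n y) ∈ s.pt.deg j n := by
          intro y
          refine hc.induction j (C := fun y => G s j (c.pt.proj j n y) ∈ s.pt.deg j n) y ?_ ?_ ?_ ?_
          · simp
          · intro i x
            rw [← (leg c i).proj]
            rw [hG]
            exact (leg s i).app_deg j n _ (component'_mem _ _ _)
          · intro x y hx hy
            simpa using add_mem hx hy
          · intro x hx
            simpa using hx
        have := key x
        rwa [GrMod.proj, component'_of_mem _ hx] at this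
      naturality := fun {i j} h x => by
        refine hc.induction i (C := fun x => G s j (c.pt.map h x) = s.pt.map h (G s i x)) x
          (by simp) ?_ ?_ ?_
        · intro k x
          rw [← (leg c k).naturality]
          rw [hG, hG]
          exact (leg s k).naturality h x
        · intro x y hx hy
          simp [hx, hy]
        · intro x hx
          simp [hx]
      app_d := fun j x => by
        refine hc.induction j (C := fun x => G s j (c.pt.d j x) = s.pt.d j (G s j x)) x
          (by simp) ?_ ?_ ?_
        · intro k x
          rw [← (leg c k).app_d]
          rw [hG, hG]
          exact (leg s k).app_d j x
        · intro x y hx hy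
          simp [hx, hy]
        · intro x hx
          simp [hx] }
  refine ⟨⟨D, fun s i => DGMod.hom_ext fun j x => hG s j i x, fun s m hm => ?_⟩⟩
  refine DGMod.hom_ext fun j x => ?_
  have : (m.app j).toAddMonoidHom = G s j := hc.hom_ext j fun i x => by
    rw [hG]
    exact congrArg (fun f : F.obj i ⟶ s.pt => f.app j x) (hm i)
  exact DFunLike.congr_fun this x

theorem exists_rep [IsFiltered I] (j : J) (x : c.pt.obj j) :
    ∃ i y, (leg c i).app j y = x := by
  obtain ⟨hj⟩ := hc j
  exact Types.jointly_surjective_of_isColimit (isColimitOfPreserves (forget AddCommGrpCat) hj) x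

theorem exists_eq [IsFiltered I] (j : J) {i : I} (x y : (F.obj i).obj j)
    (h : (leg c i).app j x = (leg c i).app j y) :
    ∃ (i' : I) (φ : i ⟶ i'), (F.map φ).app j x = (F.map φ).app j y := by
  obtain ⟨hj⟩ := hc j
  exact (Types.FilteredColimit.isColimit_eq_iff'
    (isColimitOfPreserves (forget AddCommGrpCat) hj) x y).1 h

end IsPointwiseColimit

end TorusModel

namespace TorusModel

open Limits

/-! ### Construction of colimits -/

section Construction

variable {J : Type} [Preorder J] {R : RingDiagram J} {I : Type} [SmallCategory I]
  (F : I ⥤ DGMod R)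

/-- The colimit of the values at `j`. -/
noncomputable abbrev colimObj (j : J) : ModuleCat (R.ring j) := colimit (F ⋙ evMod R j)

/-- The structure maps of the colimit of the values at `j`. -/
noncomputable def colimLeg (j : J) (i : I) : (F.obj i).obj j →ₗ[R.ring j] colimObj F j :=
  (colimit.ι (F ⋙ evMod R j) i).hom

/-- The colimit of the values at `j` as a colimit of abelian groups. -/
noncomputable def colimIsColimit (j : J) :
    IsColimit ((forget₂ (ModuleCat (R.ring j)) AddCommGrpCat).mapCocone
      (colimit.cocone (F ⋙ evMod R j))) :=
  isColimitOfPreserves _ (colimit.isColimit _)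

theorem colimLeg_w (j : J) {i i' : I} (φ : i ⟶ i') (x : (F.obj i).obj j) :
    colimLeg F j i' ((F.map φ).app j x) = colimLeg F j i x :=
  congrArg (fun f => f.hom x) (colimit.w (F ⋙ evMod R j) φ)

variable {F} in
theorem colim_induction (j : J) {C : colimObj F j → Prop} (x : colimObj F j) (h0 : C 0)
    (hι : ∀ i x, C (colimLeg F j i x)) (hadd : ∀ x y, C x → C y → C (x + y))
    (hneg : ∀ x, C x → C (-x)) : C x :=
  addColimit_induction (colimIsColimit F j) x h0 hι hadd hneg

theorem colim_exists_desc (j : J) {Y : Type} [AddCommGroup Y] (g : ∀ i, (F.obj i).obj j →+ Y)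
    (hg : ∀ {i i' : I} (φ : i ⟶ i') (x : (F.obj i).obj j), g i' ((F.map φ).app j x) = g i x) :
    ∃ G : colimObj F j →+ Y, ∀ i x, G (colimLeg F j i x) = g i x :=
  addColimit_exists_desc (colimIsColimit F j) g hg

theorem colim_exists_map {i j : J} (h : i ≤ j) :
    ∃ G : colimObj F i →ₛₗ[R.map h] colimObj F j,
      ∀ k x, G (colimLeg F i k x) = colimLeg F j k ((F.obj k).map h x) := by
  obtain ⟨G, hG⟩ := colim_exists_desc F i (Y := colimObj F j)
    (fun k => (colimLeg F j k).toAddMonoidHom.comp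
      ((F.obj k).map h : (F.obj k).obj i →+ (F.obj k).obj j))
    (fun {k k'} φ x => by
      change colimLeg F j k' ((F.obj k').map h _) = colimLeg F j k ((F.obj k).map h _)
      rw [← (F.map φ).naturality, colimLeg_w])
  refine ⟨{ G with map_smul' := fun a x => ?_ }, hG⟩
  refine colim_induction i (C := fun x => G (a • x) = R.map h a • G x) x (by simp) ?_ ?_ ?_
  · intro k x
    rw [← map_smul, hG, hG]
    change colimLeg F j k ((F.obj k).map h _) = _ • colimLeg F j k ((F.obj k).map h _)
    rw [LinearMap.map_smulₛₗ, map_smul]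
  · intro x y hx hy
    simp [hx, hy]
  · intro x hx
    simp [hx]

theorem colim_exists_d (j : J) :
    ∃ G : colimObj F j →ₗ[R.ring j] colimObj F j,
      ∀ k x, G (colimLeg F j k x) = colimLeg F j k ((F.obj k).d j x) := by
  obtain ⟨G, hG⟩ := colim_exists_desc F j (Y := colimObj F j)
    (fun k => (colimLeg F j k ∘ₗ (F.obj k).d j).toAddMonoidHom)
    (fun {k k'} φ x => by
      change colimLeg F j k' ((F.obj k').d j _) = colimLeg F j k ((F.obj k).d j _)
      rw [← (F.map φ).app_d, colimLeg_w])
  refine ⟨{ G with map_smul' := fun a x => ?_ }, hG⟩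
  refine colim_induction j (C := fun x => G (a • x) = a • G x) x (by simp) ?_ ?_ ?_
  · intro k x
    rw [← map_smul, hG, hG]
    change colimLeg F j k ((F.obj k).d j _) = _ • colimLeg F j k ((F.obj k).d j _)
    rw [map_smul, map_smul]
  · intro x y hx hy
    simp [hx, hy]
  · intro x hx
    simp [hx]

theorem colim_exists_proj (j : J) (n : ℤ) :
    ∃ G : colimObj F j →+ colimObj F j,
      ∀ k x, G (colimLeg F j k x) = colimLeg F j k ((F.obj k).proj j n x) :=
  colim_exists_desc F j (fun k => (colimLeg F j k).toAddMonoidHom.comp ((F.obj k).proj j n))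
    (fun {k k'} φ x => by
      change colimLeg F j k' ((F.obj k').proj j n _) = colimLeg F j k ((F.obj k).proj j n _)
      rw [← (F.map φ).proj, colimLeg_w])

/-- The elements of degree `n` of the colimit: the sums of images of elements of degree `n`. -/
noncomputable def colimDeg (j : J) (n : ℤ) : AddSubgroup (colimObj F j) :=
  AddSubgroup.closure {y | ∃ i, ∃ x ∈ (F.obj i).deg j n, colimLeg F j i x = y}

variable {F}

theorem colimLeg_mem {j : J} {n : ℤ} {i : I} {x : (F.obj i).obj j} (hx : x ∈ (F.obj i).deg j n) :
    colimLeg F j i x ∈ colimDeg F j n :=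
  AddSubgroup.subset_closure ⟨i, x, hx, rfl⟩

theorem colimDeg_map_mem {j j' : J} {n n' : ℤ} (G : colimObj F j →+ colimObj F j')
    (hG : ∀ i, ∀ x ∈ (F.obj i).deg j n, G (colimLeg F j i x) ∈ colimDeg F j' n')
    {y : colimObj F j} (hy : y ∈ colimDeg F j n) : G y ∈ colimDeg F j' n' := by
  have : colimDeg F j n ≤ (colimDeg F j' n').comap G := by
    refine (AddSubgroup.closure_le _).2 ?_
    rintro _ ⟨i, x, hx, rfl⟩
    exact hG i x hx
  exact this hy

theorem colimDeg_isInternal (j : J) : DirectSum.IsInternal (colimDeg F j) := by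
  choose p hp using colim_exists_proj F j
  have key : ∀ (m n : ℤ) (i : I), ∀ x ∈ (F.obj i).deg j n,
      p m (colimLeg F j i x) = if m = n then colimLeg F j i x else 0 := by
    intro m n i x hx
    rw [hp]
    split_ifs with h
    · subst h
      rw [GrMod.proj, component'_of_mem _ hx]
    · rw [GrMod.proj, component'_of_mem_ne _ h hx, map_zero]
  refine isInternal_of_components (colimDeg F j) (AddMonoidHom.id _) Function.injective_id p
    ?_ ?_ ?_
  · intro n y hy
    refine AddSubgroup.closure_induction (p := fun y _ => p n y = y) ?_ (by simp) ?_ ?_ hy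
    · rintro _ ⟨i, x, hx, rfl⟩
      rw [key _ _ _ _ hx, if_pos rfl]
    · intro x y _ _ hx hy
      rw [map_add, hx, hy]
    · intro x _ hx
      rw [map_neg, hx]
  · intro m n h y hy
    refine AddSubgroup.closure_induction (p := fun y _ => p m y = 0) ?_ (by simp) ?_ ?_ hy
    · rintro _ ⟨i, x, hx, rfl⟩
      rw [key _ _ _ _ hx, if_neg h]
    · intro x y _ _ hx hy
      rw [map_add, hx, hy, add_zero]
    · intro x _ hx
      rw [map_neg, hx, neg_zero]
  · intro y
    refine colim_induction j (C := fun y => y ∈ ⨆ n, colimDeg F j n) y (zero_mem _) ?_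
      (fun _ _ => add_mem) (fun _ => neg_mem)
    intro i x
    refine homogeneous_induction (C := fun x => colimLeg F j i x ∈ ⨆ n, colimDeg F j n)
      ((F.obj i).internal j) x (by simp) ?_ ?_
    · intro n x hx
      exact AddSubgroup.mem_iSup_of_mem n (colimLeg_mem hx)
    · intro x y hx hy
      simpa using add_mem hx hy

variable (F)

/-- The colimits of the values carry a grading, transition maps and a differential that make them a
differential module. -/
theorem exists_pointwiseColimit : ∃ c : Cocone F, IsPointwiseColimit c := by
  choose m hm using @colim_exists_map J _ R I _ F
  choose d hd using colim_exists_d F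
  let X : DGMod R :=
    { obj := fun j => colimObj F j
      deg := colimDeg F
      internal := colimDeg_isInternal
      smul_mem := fun j k n a x ha hx =>
        colimDeg_map_mem (DistribSMul.toAddMonoidHom _ a) (fun i y hy => by
          have := colimLeg_mem ((F.obj i).smul_mem j k n a y ha hy)
          rwa [map_smul] at this) hx
      map := fun h => m h
      map_deg := fun {i j} h n x hx =>
        colimDeg_map_mem (m h : colimObj F i →+ colimObj F j) (fun k y hy => by
          change m h _ ∈ _
          rw [hm]
          exact colimLeg_mem ((F.obj k).map_deg h n y hy)) hx
      map_id := fun j x => by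
        refine colim_induction j (C := fun x => m (le_refl j) x = x) x (by simp) ?_ ?_ ?_
        · intro k x
          rw [hm, (F.obj k).map_id]
        · intro x y hx hy
          rw [map_add, hx, hy]
        · intro x hx
          rw [map_neg, hx]
      map_comp := fun {i j k} h h' x => by
        refine colim_induction i (C := fun x => m (h.trans h') x = m h' (m h x)) x
          (by simp) ?_ ?_ ?_
        · intro k x
          rw [hm, hm, hm, (F.obj k).map_comp]
        · intro x y hx hy
          rw [map_add, hx, hy, map_add, map_add]
        · intro x hx
          rw [map_neg, hx, map_neg, map_neg]
      d := d
      d_deg := fun j n x hx =>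
        colimDeg_map_mem (d j).toAddMonoidHom (fun k y hy => by
          change d j _ ∈ _
          rw [hd]
          exact colimLeg_mem ((F.obj k).d_deg j n y hy)) hx
      d_d := fun j x => by
        refine colim_induction j (C := fun x => d j (d j x) = 0) x (by simp) ?_ ?_ ?_
        · intro k x
          rw [hd, hd, (F.obj k).d_d, map_zero]
        · intro x y hx hy
          rw [map_add, map_add, hx, hy, add_zero]
        · intro x hx
          rw [map_neg, map_neg, hx, neg_zero]
      d_map := fun {i j} h x => by
        refine colim_induction i (C := fun x => d j (m h x) = m h (d i x)) x (by simp) ?_ ?_ ?_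
        · intro k x
          rw [hm, hd, hd, hm, (F.obj k).d_map]
        · intro x y hx hy
          rw [map_add, map_add, hx, hy, map_add, map_add]
        · intro x hx
          rw [map_neg, map_neg, hx, map_neg, map_neg] }
  let l : ∀ i, F.obj i ⟶ X := fun i =>
    { app := fun j => colimLeg F j i
      app_deg := fun j n x hx => colimLeg_mem hx
      naturality := fun h x => (hm h i x).symm
      app_d := fun j x => (hd j i x).symm }
  refine ⟨{ pt := X, ι := { app := l, naturality := fun i i' φ => ?_ } }, fun j => ?_⟩
  · exact DGMod.hom_ext fun j x => colimLeg_w F j φ x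
  · exact ⟨colimIsColimit F j⟩

instance hasColimit_DGMod : HasColimit F := by
  obtain ⟨c, hc⟩ := exists_pointwiseColimit F
  exact ⟨⟨c, hc.isColimit.some⟩⟩

variable {F} in
/-- All colimits of differential modules are formed on the values. -/
theorem isPointwiseColimit_of_isColimit {c : Cocone F} (hc : IsColimit c) :
    IsPointwiseColimit c := by
  obtain ⟨c', hc'⟩ := exists_pointwiseColimit F
  obtain ⟨h⟩ := hc'.isColimit
  intro j
  exact ⟨(hc' j).some.ofIsoColimit
    ((Cocone.functoriality F (evAb R j)).mapIso (h.uniqueUpToIso hc))⟩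

end Construction

instance {J : Type} [Preorder J] (R : RingDiagram J) : HasColimitsOfSize.{0, 0} (DGMod R) where
  has_colimits_of_shape _ _ := { has_colimit := fun F => hasColimit_DGMod F }

end TorusModel

namespace TorusModel

open Limits Cardinal

/-! ### Small subsets closed under operations -/

/-- A subset of cardinality at most `c` is contained in one that is closed under operations that
assign at most `c` elements to each finite subset. -/
theorem exists_closed_set {X : Type} {c : Cardinal.{0}} (hc : ℵ₀ ≤ c) (cl : Finset X → Set X)
    (hcl : ∀ F, #(cl F) ≤ c) (A : Set X) (hA : #A ≤ c) :
    ∃ B : Set X, A ⊆ B ∧ #B ≤ c ∧ ∀ F : Finset X, (F : Set X) ⊆ B → cl F ⊆ B := by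
  classical
  let step : Set X → Set X := fun S => S ∪ ⋃ F : Finset S, cl (F.map (Function.Embedding.subtype _))
  have hstep : ∀ S : Set X, #S ≤ c → #(step S) ≤ c := by
    intro S hS
    refine (mk_union_le _ _).trans (add_le_of_le hc hS ?_)
    refine (mk_iUnion_le _).trans ?_
    have h1 : #(Finset S) ≤ c := by
      rcases finite_or_infinite S with h | h
      · exact (lt_aleph0_of_finite _).le.trans hc
      · rw [mk_finset_of_infinite]
        exact hS
    exact mul_le_of_le hc h1 (ciSup_le' fun F => hcl _)
  -- as the arguments are finite sets, it suffices to iterate countably often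
  let B : ℕ → Set X := fun n => step^[n] A
  have hB : ∀ n, B (n + 1) = step (B n) := fun n => Function.iterate_succ_apply' _ _ _
  have hmono : Monotone B := monotone_nat_of_le_succ fun n => by
    rw [hB]
    exact Set.subset_union_left
  refine ⟨⋃ n, B n, Set.subset_iUnion B 0, ?_, fun F hF => ?_⟩
  · refine (mk_iUnion_le _).trans (mul_le_of_le hc (by simpa using hc) (ciSup_le' fun n => ?_))
    induction n with
    | zero => exact hA
    | succ n ih =>
      rw [hB]
      exact hstep _ ih
  · obtain ⟨n, hn⟩ : ∃ n, (F : Set X) ⊆ B n := by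
      choose! N hN using fun x (hx : x ∈ F) => Set.mem_iUnion.1 (hF hx)
      exact ⟨F.sup N, fun x hx => hmono (Finset.le_sup hx) (hN x hx)⟩
    refine Set.Subset.trans ?_ (Set.subset_iUnion B (n + 1))
    rw [hB]
    refine Set.Subset.trans ?_ Set.subset_union_right
    have : F = (F.subtype (· ∈ B n)).map (Function.Embedding.subtype _) := by
      rw [Finset.subtype_map_of_mem]
      exact fun x hx => hn hx
    rw [this]
    exact Set.subset_iUnion (fun F : Finset (B n) => cl (F.map (Function.Embedding.subtype _))) _

variable {J : Type} [Preorder J] {R : RingDiagram J}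

/-! ### Differential submodules -/

/-- The disjoint union of the values of a module. -/
abbrev GrMod.El (M : GrMod R) : Type := Σ j, M.obj j

/-- A graded submodule closed under the transition maps and the differential. -/
structure SubDG (M : DGMod R) where
  sub : ∀ j, Submodule (R.ring j) (M.obj j)
  proj_mem : ∀ (j : J) (n : ℤ), ∀ x ∈ sub j, M.proj j n x ∈ sub j
  map_mem : ∀ {i j : J} (h : i ≤ j), ∀ x ∈ sub i, M.map h x ∈ sub j
  d_mem : ∀ j, ∀ x ∈ sub j, M.d j x ∈ sub j

namespace SubDG

variable {M : DGMod R} (S : SubDG M)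

/-- The set of all elements of the values of a submodule. -/
def carrier : Set M.El := {x | x.2 ∈ S.sub x.1}

theorem isInternal (j : J) :
    DirectSum.IsInternal fun n => (M.deg j n).comap (S.sub j).subtype.toAddMonoidHom := by
  have hint := M.internal j
  let p : ℤ → S.sub j →+ S.sub j := fun n =>
    { toFun := fun x => ⟨M.proj j n x.1, S.proj_mem j n _ x.2⟩
      map_zero' := Subtype.ext (map_zero _)
      map_add' := fun _ _ => Subtype.ext (map_add _ _ _) }
  refine isInternal_of_components _ (AddMonoidHom.id _) Function.injective_id p ?_ ?_ ?_
  · intro n x hx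
    exact Subtype.ext (component'_of_mem hint hx)
  · intro m n h x hx
    exact Subtype.ext (component'_of_mem_ne hint h hx)
  · intro x
    classical
    -- an element is the sum of its components, which belong to the submodule
    obtain ⟨v, hv⟩ := hint.2 x.1
    have hx : x = ∑ n ∈ v.support, p n x := by
      refine Subtype.ext ?_
      rw [AddSubmonoidClass.coe_finsetSum]
      have : ∀ n, ((p n x : S.sub j) : M.obj j) = v n := fun n => by
        change component' hint n x.1 = _
        rw [← hv, component'_coe]
      simp only [this]
      rw [← hv, DirectSum.coeAddMonoidHom_eq_dfinsuppSum, DFinsupp.sum]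
    rw [hx]
    refine sum_mem fun n _ => AddSubgroup.mem_iSup_of_mem n ?_
    exact component'_mem hint n x.1

/-- A differential submodule as a differential module. -/
def toDGMod : DGMod R where
  obj j := S.sub j
  deg j n := (M.deg j n).comap (S.sub j).subtype.toAddMonoidHom
  internal := S.isInternal
  smul_mem j m n a x ha hx := M.smul_mem j m n a x.1 ha hx
  map h :=
    { toFun := fun x => ⟨M.map h x.1, S.map_mem h _ x.2⟩
      map_add' := fun _ _ => Subtype.ext (map_add _ _ _)
      map_smul' := fun _ _ => Subtype.ext (LinearMap.map_smulₛₗ _ _ _) }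
  map_deg h n x hx := M.map_deg h n x.1 hx
  map_id j x := Subtype.ext (M.map_id j x.1)
  map_comp h h' x := Subtype.ext (M.map_comp h h' x.1)
  d j :=
    { toFun := fun x => ⟨M.d j x.1, S.d_mem j _ x.2⟩
      map_add' := fun _ _ => Subtype.ext (map_add _ _ _)
      map_smul' := fun _ _ => Subtype.ext (map_smul _ _ _) }
  d_deg j n x hx := M.d_deg j n x.1 hx
  d_d j x := Subtype.ext (M.d_d j x.1)
  d_map h x := Subtype.ext (M.d_map h x.1)

/-- The inclusion of a differential submodule. -/
def incl : S.toDGMod ⟶ M where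
  app j := (S.sub j).subtype
  app_deg _ _ _ hx := hx
  naturality _ _ := rfl
  app_d _ _ := rfl

/-- A morphism with values in a submodule factors through it. -/
def lift {N : DGMod R} (f : N ⟶ M) (hf : ∀ j x, f.app j x ∈ S.sub j) : N ⟶ S.toDGMod where
  app j := (f.app j).codRestrict (S.sub j) (hf j)
  app_deg j n x hx := f.app_deg j n x hx
  naturality h x := Subtype.ext (f.naturality h x)
  app_d j x := Subtype.ext (f.app_d j x)

end SubDG

/-- `P` passes from a module to the submodules that are closed under suitable operations assigning
at most `c` elements to each finite set of elements. -/
def HasSmallSubs (c : Cardinal.{0}) (P : ObjectProperty (DGMod R)) : Prop :=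
  ∀ M, P M → ∃ cl : Finset M.El → Set M.El, (∀ F, #(cl F) ≤ c) ∧
    ∀ S : SubDG M, (∀ F : Finset M.El, (F : Set M.El) ⊆ S.carrier → cl F ⊆ S.carrier) →
      P S.toDGMod

/-- `c` bounds the cardinalities of the index set and of the rings of a diagram. -/
structure Bounds (c : Cardinal.{0}) (R : RingDiagram J) : Prop where
  aleph0_le : ℵ₀ ≤ c
  index : #J ≤ c
  ring : ∀ j, #(R.ring j) ≤ c

/-- A subset of cardinality at most `c` of a module with property `P` is contained in a submodule
with property `P` of cardinality at most `c`: close the subset under the operations that witness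
`HasSmallSubs` and under all operations of a differential module. -/
theorem HasSmallSubs.exists_sub {c : Cardinal.{0}} (hc : Bounds c R)
    {P : ObjectProperty (DGMod R)} (hP : HasSmallSubs c P) {M : DGMod R} (hM : P M)
    (A : Set M.El) (hA : #A ≤ c) :
    ∃ S : SubDG M, P S.toDGMod ∧ #S.carrier ≤ c ∧ A ⊆ S.carrier := by
  classical
  obtain ⟨cl, hcl, hS⟩ := hP M hM
  -- the operations of a differential module, with one or two arguments
  let op : Finset M.El → Set M.El := fun F =>
    cl F ∪ Set.range (fun j : J => (⟨j, 0⟩ : M.El)) ∪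
    Set.range (fun z : Σ x : F, R.ring x.1.1 => (⟨z.1.1.1, z.2 • z.1.1.2⟩ : M.El)) ∪
    Set.range (fun z : F × ℤ => (⟨z.1.1.1, M.proj _ z.2 z.1.1.2⟩ : M.El)) ∪
    Set.range (fun z : Σ x : F, {j : J // x.1.1 ≤ j} => (⟨z.2.1, M.map z.2.2 z.1.1.2⟩ : M.El)) ∪
    Set.range (fun z : F => (⟨z.1.1, M.d _ z.1.2⟩ : M.El)) ∪
    Set.range (fun z : {z : F × F // z.2.1.1 = z.1.1.1} =>
      (⟨z.1.1.1.1, z.1.1.1.2 + z.2 ▸ z.1.2.1.2⟩ : M.El))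
  have h0 := hc.aleph0_le
  have hfin : ∀ (T : Type) [Finite T], #T ≤ c := fun T _ => (lt_aleph0_of_finite T).le.trans h0
  have hop : ∀ F, #(op F) ≤ c := by
    intro F
    have hu : ∀ {S T : Set M.El}, #S ≤ c → #T ≤ c → #(S ∪ T : Set M.El) ≤ c := fun hS hT =>
      (mk_union_le _ _).trans (add_le_of_le h0 hS hT)
    have hsig : ∀ T : F → Type, (∀ x, #(T x) ≤ c) → #(Σ x, T x) ≤ c := fun T hT => by
      rw [mk_sigma]
      exact (sum_le_mk_mul_iSup _).trans (mul_le_of_le h0 (hfin _) (ciSup_le' hT))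
    refine hu (hu (hu (hu (hu (hu (hcl F) ?_) ?_) ?_) ?_) ?_) ?_
    · exact mk_range_le.trans hc.index
    · exact mk_range_le.trans (hsig _ fun x => hc.ring _)
    · refine mk_range_le.trans ?_
      rw [mk_prod, lift_id, lift_id]
      exact mul_le_of_le h0 (hfin _) (by simpa using h0)
    · exact mk_range_le.trans (hsig _ fun x => (mk_subtype_le _).trans hc.index)
    · exact mk_range_le.trans (hfin _)
    · exact mk_range_le.trans (hfin _)
  obtain ⟨B, hAB, hB, hclosed⟩ := exists_closed_set h0 op hop A hA
  have hop1 : ∀ {x y : M.El}, x ∈ B → y ∈ op {x} → y ∈ B := fun {x y} hx hy =>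
    hclosed {x} (by simpa using hx) hy
  let S : SubDG M :=
    { sub := fun j =>
        { carrier := {x | (⟨j, x⟩ : M.El) ∈ B}
          zero_mem' := hclosed ∅ (by simp) (by
            simp only [op, Set.mem_union]
            exact Or.inl (Or.inl (Or.inl (Or.inl (Or.inl (Or.inr ⟨j, rfl⟩))))))
          add_mem' := fun {x y} hx hy => hclosed {⟨j, x⟩, ⟨j, y⟩}
            (by
              intro z hz
              rcases Finset.mem_insert.1 (Finset.mem_coe.1 hz) with rfl | hz
              · exact hx
              · rw [Finset.mem_singleton.1 hz]
                exact hy)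
            (by
              simp only [op, Set.mem_union]
              exact Or.inr ⟨⟨(⟨⟨j, x⟩, by simp⟩, ⟨⟨j, y⟩, by simp⟩), rfl⟩, rfl⟩)
          smul_mem' := fun a x hx => hop1 hx (by
            simp only [op, Set.mem_union]
            exact Or.inl (Or.inl (Or.inl (Or.inl (Or.inr ⟨⟨⟨⟨j, x⟩, by simp⟩, a⟩, rfl⟩))))) }
      proj_mem := fun j n x hx => hop1 hx (by
        simp only [op, Set.mem_union]
        exact Or.inl (Or.inl (Or.inl (Or.inr ⟨⟨⟨⟨j, x⟩, by simp⟩, n⟩, rfl⟩))))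
      map_mem := fun {i j} h x hx => hop1 hx (by
        simp only [op, Set.mem_union]
        exact Or.inl (Or.inl (Or.inr ⟨⟨⟨⟨i, x⟩, by simp⟩, ⟨j, h⟩⟩, rfl⟩)))
      d_mem := fun j x hx => hop1 hx (by
        simp only [op, Set.mem_union]
        exact Or.inl (Or.inr ⟨⟨⟨j, x⟩, by simp⟩, rfl⟩)) }
  have hSB : S.carrier = B := rfl
  refine ⟨S, hS S fun F hF => ?_, hB, hAB⟩
  refine Set.Subset.trans ?_ (hclosed F hF)
  intro x hx
  simp only [op, Set.mem_union]
  exact Or.inl (Or.inl (Or.inl (Or.inl (Or.inl (Or.inl hx)))))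

theorem HasSmallSubs.and {c : Cardinal.{0}} (hc : ℵ₀ ≤ c) {P Q : ObjectProperty (DGMod R)}
    (hP : HasSmallSubs c P) (hQ : HasSmallSubs c Q) : HasSmallSubs c fun M => P M ∧ Q M := by
  rintro M ⟨hM, hM'⟩
  obtain ⟨cl, h, hS⟩ := hP M hM
  obtain ⟨cl', h', hS'⟩ := hQ M hM'
  exact ⟨fun F => cl F ∪ cl' F, fun F => (mk_union_le _ _).trans (add_le_of_le hc (h F) (h' F)),
    fun S hcl => ⟨hS S fun F hF => Set.subset_union_left.trans (hcl F hF),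
      hS' S fun F hF => Set.subset_union_right.trans (hcl F hF)⟩⟩

theorem HasSmallSubs.forall {c : Cardinal.{0}} (hc : ℵ₀ ≤ c) {A : Type} (hA : #A ≤ c)
    {P : A → ObjectProperty (DGMod R)} (hP : ∀ a, HasSmallSubs c (P a)) :
    HasSmallSubs c fun M => ∀ a, P a M := by
  intro M hM
  choose cl h hS using fun a => hP a M (hM a)
  exact ⟨fun F => ⋃ a, cl a F, fun F => (mk_iUnion_le _).trans
      (mul_le_of_le hc hA (ciSup_le' fun a => h a F)),
    fun S hcl a => hS a S fun F hF => (Set.subset_iUnion (fun a => cl a F) a).trans (hcl F hF)⟩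

/-- `P` is closed under colimits. The condition refers to colimits that are formed on the values;
all colimits are of this kind. -/
def ClosedUnderColimits (P : ObjectProperty (DGMod R)) : Prop :=
  ∀ (I : Type) [SmallCategory I] (F : I ⥤ DGMod R) (c : Cocone F), IsPointwiseColimit c →
    (∀ i, P (F.obj i)) → P c.pt

theorem ClosedUnderColimits.and {P Q : ObjectProperty (DGMod R)} (hP : ClosedUnderColimits P)
    (hQ : ClosedUnderColimits Q) : ClosedUnderColimits fun M => P M ∧ Q M :=
  fun I _ F c hc h => ⟨hP I F c hc fun i => (h i).1, hQ I F c hc fun i => (h i).2⟩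

theorem ClosedUnderColimits.forall {A : Type} {P : A → ObjectProperty (DGMod R)}
    (hP : ∀ a, ClosedUnderColimits (P a)) : ClosedUnderColimits fun M => ∀ a, P a M :=
  fun I _ F c hc h a => hP a I F c hc fun i => h i a

end TorusModel

namespace TorusModel

open Limits Cardinal Opposite Order

variable {J : Type} [Preorder J] {R : RingDiagram J}

/-! ### Small modules are presentable -/

section Presentable

variable {c : Cardinal.{0}} {I : Type} [SmallCategory I]
  [Fact (succ c).IsRegular] [IsCardinalFiltered I (succ c)] {F : I ⥤ DGMod R} {t : Cocone F}
  (ht : IsPointwiseColimit t)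

include ht

/-- At most `c` equalities that hold in a `c⁺`-filtered colimit hold at some common stage. -/
theorem exists_common_stage {W : Type} (hW : #W ≤ c) {i : I} (u : W → J)
    (x y : ∀ w, (F.obj i).obj (u w)) (h : ∀ w, (leg t i).app _ (x w) = (leg t i).app _ (y w)) :
    ∃ (k : I) (φ : i ⟶ k), ∀ w, (F.map φ).app _ (x w) = (F.map φ).app _ (y w) := by
  have := isFiltered_of_isCardinalFiltered I (succ c)
  choose k φ hφ using fun w => ht.exists_eq (u w) (x w) (y w) (h w)
  obtain ⟨m, a, b, hab⟩ := IsCardinalFiltered.wideSpan (κ := succ c) φ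
    ((hasCardinalLT_iff_cardinal_mk_lt _ _).2 (lt_succ_of_le hW))
  refine ⟨m, b, fun w => ?_⟩
  rw [← hab w, Functor.map_comp, DGMod.comp_app, DGMod.comp_app, hφ]

/-- A morphism from a module of cardinality at most `c` to a `c⁺`-filtered colimit factors through
one of the stages: lift the elements to a common stage; the lifts generate a submodule of
cardinality at most `c`, and two of its elements with the same image in the colimit become equal at
a later stage that does not depend on them. -/
theorem exists_factorization (hc : Bounds c R) {N : DGMod R} (hN : #N.El ≤ c) (f : N ⟶ t.pt) :
    ∃ (i : I) (g : N ⟶ F.obj i), g ≫ leg t i = f := by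
  have := isFiltered_of_isCardinalFiltered I (succ c)
  have hlt : ∀ {W : Type}, #W ≤ c → HasCardinalLT W (succ c) := fun hW =>
    (hasCardinalLT_iff_cardinal_mk_lt _ _).2 (lt_succ_of_le hW)
  choose k y hy using fun x : N.El => ht.exists_rep x.1 (f.app x.1 x.2)
  let i := IsCardinalFiltered.max k (hlt hN)
  let g : ∀ j, N.obj j → (F.obj i).obj j := fun j x =>
    (F.map (IsCardinalFiltered.toMax k (hlt hN) ⟨j, x⟩)).app j (y ⟨j, x⟩)
  have hg : ∀ j x, (leg t i).app j (g j x) = f.app j x := fun j x => by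
    rw [leg_w, hy]
  have hsmall : HasSmallSubs c (⊤ : ObjectProperty (DGMod R)) := fun M _ =>
    ⟨fun _ => ∅, fun _ => by simp, fun _ _ => trivial⟩
  obtain ⟨S, -, hS, hA⟩ := hsmall.exists_sub hc (M := F.obj i) trivial
    (Set.range fun x : N.El => ⟨x.1, g x.1 x.2⟩) (mk_range_le.trans hN)
  have hgS : ∀ j x, g j x ∈ S.sub j := fun j x => hA ⟨⟨j, x⟩, rfl⟩
  -- the pairs of elements of `S` that have the same image in the colimit
  let W : Type := {w : S.carrier × S.carrier // ∃ h : w.2.1.1 = w.1.1.1,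
    (leg t i).app _ w.1.1.2 = (leg t i).app _ (h ▸ w.2.1.2)}
  have hW : #W ≤ c := by
    refine (mk_subtype_le _).trans ?_
    rw [mk_prod, lift_id]
    exact mul_le_of_le hc.aleph0_le hS hS
  obtain ⟨m, φ, hφ⟩ := exists_common_stage ht hW (fun w => w.1.1.1.1) (fun w => w.1.1.1.2)
    (fun w => w.2.choose ▸ w.1.2.1.2) (fun w => w.2.choose_spec)
  have key : ∀ (j : J) (u v : (F.obj i).obj j), u ∈ S.sub j → v ∈ S.sub j →
      (leg t i).app j u = (leg t i).app j v → (F.map φ).app j u = (F.map φ).app j v :=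
    fun j u v hu hv h => hφ ⟨(⟨⟨j, u⟩, hu⟩, ⟨⟨j, v⟩, hv⟩), rfl, h⟩
  refine ⟨m,
    { app := fun j =>
        { toFun := fun x => (F.map φ).app j (g j x)
          map_add' := fun x y => by
            rw [← map_add]
            exact key _ _ _ (hgS _ _) (add_mem (hgS _ _) (hgS _ _)) (by simp [hg])
          map_smul' := fun a x => by
            rw [RingHom.id_apply, ← map_smul]
            exact key _ _ _ (hgS _ _) (Submodule.smul_mem _ _ (hgS _ _)) (by simp [hg]) }
      app_deg := fun j n x hx => by
        have h1 : (F.map φ).app j (g j x) = (F.map φ).app j ((F.obj i).proj j n (g j x)) := by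
          refine key _ _ _ (hgS _ _) (S.proj_mem _ _ _ (hgS _ _)) ?_
          rw [(leg t i).proj, hg, GrMod.proj, component'_of_mem _ (f.app_deg j n x hx)]
        change (F.map φ).app j (g j x) ∈ _
        rw [h1]
        exact (F.map φ).app_deg j n _ (component'_mem _ _ _)
      naturality := fun {j j'} h x => by
        change (F.map φ).app j' (g j' _) = (F.obj m).map h ((F.map φ).app j (g j x))
        rw [← (F.map φ).naturality]
        refine key _ _ _ (hgS _ _) (S.map_mem _ _ (hgS _ _)) ?_
        rw [(leg t i).naturality, hg, hg, f.naturality]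
      app_d := fun j x => by
        change (F.map φ).app j (g j _) = (F.obj m).d j ((F.map φ).app j (g j x))
        rw [← (F.map φ).app_d]
        refine key _ _ _ (hgS _ _) (S.d_mem _ _ (hgS _ _)) ?_
        rw [(leg t i).app_d, hg, hg, f.app_d] }, DGMod.hom_ext fun j x => ?_⟩
  change (leg t m).app j ((F.map φ).app j (g j x)) = _
  rw [leg_w, hg]

end Presentable

/-- Modules of cardinality at most `c` are `c⁺`-presentable. -/
theorem isCardinalPresentable_of_card_le {c : Cardinal.{0}} [Fact (succ c).IsRegular]
    (hc : Bounds c R) {N : DGMod R} (hN : #N.El ≤ c) : IsCardinalPresentable N (succ c) where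
  preservesColimitOfShape I _ _ :=
    { preservesColimit := fun {F} =>
        { preserves := fun {t} ht => by
            have := isFiltered_of_isCardinalFiltered I (succ c)
            have ht' := isPointwiseColimit_of_isColimit ht
            refine ⟨Types.FilteredColimit.isColimitOf' _ _ (fun f => ?_) (fun i f g h => ?_)⟩
            · obtain ⟨i, g, hg⟩ := exists_factorization ht' hc hN f
              exact ⟨i, g, hg.symm⟩
            · have h' : f ≫ leg t i = g ≫ leg t i := h
              obtain ⟨k, φ, hφ⟩ := exists_common_stage ht' hN (fun x => x.1)
                (fun x : N.El => (f : N ⟶ F.obj i).app x.1 x.2)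
                (fun x => (g : N ⟶ F.obj i).app x.1 x.2)
                (fun x => congrArg (fun e : N ⟶ t.pt => e.app x.1 x.2) h')
              exact ⟨k, φ, DGMod.hom_ext fun j x => hφ ⟨j, x⟩⟩ } }

/-! ### A set of representatives of the small modules -/

/-- The structures of a differential module with prescribed underlying sets. -/
structure DGStructure (R : RingDiagram J) (obj : J → Type) : Type where
  [addCommGroup : ∀ j, AddCommGroup (obj j)]
  [module : ∀ j, Module (R.ring j) (obj j)]
  deg : ∀ j, ℤ → AddSubgroup (obj j)
  internal : ∀ j, DirectSum.IsInternal (deg j)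
  smul_mem : ∀ (j : J) (m n : ℤ) (a : R.ring j) (x : obj j), a ∈ R.homog j m → x ∈ deg j n →
    a • x ∈ deg j (n + 2 * m)
  map : ∀ {i j : J} (h : i ≤ j), obj i →ₛₗ[R.map h] obj j
  map_deg : ∀ {i j : J} (h : i ≤ j) (n : ℤ) (x : obj i), x ∈ deg i n → map h x ∈ deg j n
  map_id : ∀ (j : J) (x : obj j), map (le_refl j) x = x
  map_comp : ∀ {i j k : J} (h : i ≤ j) (h' : j ≤ k) (x : obj i),
    map (h.trans h') x = map h' (map h x)
  d : ∀ j, obj j →ₗ[R.ring j] obj j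
  d_deg : ∀ (j : J) (n : ℤ) (x : obj j), x ∈ deg j n → d j x ∈ deg j (n + 1)
  d_d : ∀ (j : J) (x : obj j), d j (d j x) = 0
  d_map : ∀ {i j : J} (h : i ≤ j) (x : obj i), d j (map h x) = map h (d i x)

/-- The module with a given structure. -/
def DGStructure.toDGMod {obj : J → Type} (D : DGStructure R obj) : DGMod R :=
  letI := D.addCommGroup
  letI := D.module
  { obj := obj
    deg := D.deg
    internal := D.internal
    smul_mem := D.smul_mem
    map := D.map
    map_deg := D.map_deg
    map_id := D.map_id
    map_comp := D.map_comp
    d := D.d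
    d_deg := D.d_deg
    d_d := D.d_d
    d_map := D.d_map }

/-- Transport of structure along bijections of the underlying sets. -/
theorem exists_structure_iso (M : DGMod R) {obj : J → Type} (e : ∀ j, M.obj j ≃ obj j) :
    ∃ D : DGStructure R obj, Nonempty (M ≅ D.toDGMod) := by
  let _ : ∀ j, AddCommGroup (obj j) := fun j => (e j).symm.addCommGroup
  let _ : ∀ j, Module (R.ring j) (obj j) := fun j => (e j).symm.module (R.ring j)
  let l : ∀ j, obj j ≃ₗ[R.ring j] M.obj j := fun j => (e j).symm.linearEquiv (R.ring j)
  let deg : ∀ j, ℤ → AddSubgroup (obj j) := fun j n =>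
    (M.deg j n).comap (l j).toLinearMap.toAddMonoidHom
  have hdeg : ∀ j n x, x ∈ deg j n ↔ l j x ∈ M.deg j n := fun _ _ _ => Iff.rfl
  let D : DGStructure R obj :=
    { deg := deg
      internal := fun j => by
        refine isInternal_of_components (deg j) (l j).toLinearMap.toAddMonoidHom (l j).injective
          (fun n => (M.proj j n).comp (l j).toLinearMap.toAddMonoidHom) ?_ ?_ ?_
        · intro n x hx
          exact component'_of_mem (M.internal j) hx
        · intro m n h x hx
          exact component'_of_mem_ne (M.internal j) h hx
        · intro x
          have := homogeneous_induction (C := fun y => (l j).symm y ∈ ⨆ n, deg j n)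
            (M.internal j) (l j x) (by simp)
            (fun n x hx => AddSubgroup.mem_iSup_of_mem n (by simpa [hdeg] using hx))
            (fun x y hx hy => by simpa using add_mem hx hy)
          simpa using this
      smul_mem := fun j m n a x ha hx => by
        rw [hdeg] at hx ⊢
        rw [map_smul]
        exact M.smul_mem j m n a _ ha hx
      map := fun {i j} h =>
        { toFun := fun x => (l j).symm (M.map h (l i x))
          map_add' := fun x y => by simp
          map_smul' := fun a x => by simp }
      map_deg := fun h n x hx => by
        rw [hdeg] at hx ⊢
        simpa using M.map_deg h n _ hx
      map_id := fun j x => by simp [M.map_id]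
      map_comp := fun h h' x => by simp [M.map_comp h h']
      d := fun j => (l j).symm.toLinearMap ∘ₗ M.d j ∘ₗ (l j).toLinearMap
      d_deg := fun j n x hx => by
        rw [hdeg] at hx ⊢
        simpa using M.d_deg j n _ hx
      d_d := fun j x => by simp [M.d_d]
      d_map := fun h x => by simp [M.d_map] }
  let f : M ⟶ D.toDGMod :=
    { app := fun j => (l j).symm.toLinearMap
      app_deg := fun j n x hx => by
        change (l j).symm x ∈ deg j n
        simpa [hdeg] using hx
      naturality := fun {i j} h x => by
        change (l j).symm (M.map h x) = (l j).symm (M.map h (l i ((l i).symm x)))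
        simp
      app_d := fun j x => by
        change (l j).symm (M.d j x) = (l j).symm (M.d j (l j ((l j).symm x)))
        simp }
  have := DGMod.isIso_of_bijective f fun j => (l j).symm.bijective
  exact ⟨D, ⟨asIso f⟩⟩

/-! ### The criterion for local presentability -/

section Criterion

variable {P : ObjectProperty (DGMod R)} {c : Cardinal.{0}}

theorem ClosedUnderColimits.isClosedUnderColimitsOfShape (hP : ClosedUnderColimits P) (I : Type)
    [SmallCategory I] : P.IsClosedUnderColimitsOfShape I where
  colimitsOfShape_le := by
    rintro M ⟨p⟩
    exact hP I p.diag p.cocone (isPointwiseColimit_of_isColimit p.isColimit) p.prop_diag_obj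

/-- The underlying data of the standard small modules with property `P`: modules whose values are
subsets of a fixed set of cardinality `c`. -/
def SmallIndex (P : ObjectProperty (DGMod R)) (c : Cardinal.{0}) : Type :=
  {x : Σ s : J → Set c.out, DGStructure R fun j => s j // P x.2.toDGMod}

/-- The standard small modules with property `P`. -/
def smallModule (t : SmallIndex P c) : P.FullSubcategory := ⟨t.1.2.toDGMod, t.2⟩

theorem card_smallModule_le (hc : Bounds c R) (t : SmallIndex P c) :
    #(smallModule t).obj.El ≤ c := by
  change #(Σ j, t.1.1 j) ≤ c
  rw [mk_sigma]
  refine (sum_le_mk_mul_iSup _).trans (mul_le_of_le hc.aleph0_le hc.index (ciSup_le' fun j => ?_))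
  exact (mk_subtype_le _).trans (mk_out c).le

variable (hc : Bounds c R) (hsub : HasSmallSubs c P)

include hc hsub

/-- Each subset of cardinality at most `c` of a module with property `P` lies in a submodule that is
isomorphic to a standard small module. -/
theorem exists_smallModule {M : DGMod R} (hM : P M) (hP : P.IsClosedUnderIsomorphisms)
    (A : Set M.El) (hA : #A ≤ c) :
    ∃ (t : SmallIndex P c) (S : SubDG M) (_ : S.toDGMod ≅ (smallModule t).obj),
      A ⊆ S.carrier := by
  obtain ⟨S, hPS, hS, hAS⟩ := hsub.exists_sub hc hM A hA
  have hle : ∀ j, #(S.toDGMod.obj j) ≤ #c.out := fun j => by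
    rw [mk_out]
    refine (mk_le_of_injective (f := fun x => (⟨⟨j, x.1⟩, x.2⟩ : S.carrier)) ?_).trans hS
    intro x y h
    exact Subtype.ext (eq_of_heq (Sigma.mk.inj (congrArg Subtype.val h)).2)
  choose f hf using fun j => (hle j : Nonempty (S.toDGMod.obj j ↪ c.out)).elim
    fun f => (⟨f, f.injective⟩ : ∃ f : S.toDGMod.obj j → c.out, Function.Injective f)
  obtain ⟨D, ⟨e⟩⟩ := exists_structure_iso S.toDGMod
    (obj := fun j => Set.range (f j)) (fun j => Equiv.ofInjective (f j) (hf j))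
  exact ⟨⟨⟨_, D⟩, P.prop_of_iso e hPS⟩, S, e, hAS⟩

/-- The standard small modules with property `P` are a strong generator of the class of all modules
with property `P`. -/
theorem isStrongGenerator_smallModule (hP : P.IsClosedUnderIsomorphisms) :
    (ObjectProperty.ofObj (smallModule (P := P) (c := c))).IsStrongGenerator := by
  have hone : ∀ {M : DGMod R} (x : M.El), #({x} : Set M.El) ≤ c := fun x =>
    (mk_singleton x).le.trans (one_le_aleph0.trans hc.aleph0_le)
  rw [ObjectProperty.isStrongGenerator_iff]
  refine ⟨fun X Y f g h => ?_, fun X Y i _ h => ?_⟩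
  · ext
    refine DGMod.hom_ext fun j x => ?_
    obtain ⟨t, S, e, hA⟩ := exists_smallModule hc hsub X.property hP {⟨j, x⟩} (hone _)
    let k : smallModule t ⟶ X := ObjectProperty.homMk (e.inv ≫ S.incl)
    have h1 : S.incl ≫ f.hom = S.incl ≫ g.hom := by
      have := congrArg (fun u => e.hom ≫ InducedCategory.Hom.hom u)
        (h _ (ObjectProperty.ofObj_apply _ t) k)
      simpa [k] using this
    exact congrArg (fun u : S.toDGMod ⟶ Y.obj => u.app j ⟨x, hA rfl⟩) h1
  · have : IsIso i.hom := by
      refine DGMod.isIso_of_bijective _ fun j => ⟨?_, fun y => ?_⟩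
      · -- an element `z` of the kernel lies in a small submodule `S` of `X`, the image of which lies
        -- in a small submodule `S'` of `Y`; as `S' → Y` lifts to `X` and `i` is a monomorphism, the
        -- inclusion of `S` in `X` factors through the map `S → S'`, which annihilates `z`
        rw [injective_iff_map_eq_zero]
        intro z hz
        obtain ⟨t, S, e, hA⟩ := exists_smallModule hc hsub X.property hP {⟨j, z⟩} (hone _)
        let g : smallModule t ⟶ X := ObjectProperty.homMk (e.inv ≫ S.incl)
        obtain ⟨t', S', e', hA'⟩ := exists_smallModule hc hsub Y.property hP
          (Set.range fun w : (smallModule t).obj.El => ⟨w.1, (g ≫ i).hom.app w.1 w.2⟩)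
          (mk_range_le.trans (card_smallModule_le hc t))
        obtain ⟨f', hf'⟩ := h _ (ObjectProperty.ofObj_apply _ t')
          (ObjectProperty.homMk (e'.inv ≫ S'.incl))
        have hl : ∀ j w, (g ≫ i).hom.app j w ∈ S'.sub j := fun j w => hA' ⟨⟨j, w⟩, rfl⟩
        let l : (smallModule t).obj ⟶ S'.toDGMod := S'.lift (g ≫ i).hom hl
        let k : smallModule t ⟶ smallModule t' := ObjectProperty.homMk (l ≫ e'.hom)
        have hk : k ≫ f' = g := by
          rw [← cancel_mono i, Category.assoc]
          have : f' ≫ i = ObjectProperty.homMk (e'.inv ≫ S'.incl) := hf'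
          rw [this]
          ext
          simp only [k, ObjectProperty.FullSubcategory.comp_hom, ObjectProperty.homMk_hom,
            Category.assoc, Iso.hom_inv_id_assoc]
          rfl
        have h2 : (e.hom ≫ k.hom ≫ f'.hom).app j ⟨z, hA rfl⟩ = z := by
          have : e.hom ≫ k.hom ≫ f'.hom = S.incl := by
            have := congrArg InducedCategory.Hom.hom hk
            rw [ObjectProperty.FullSubcategory.comp_hom] at this
            rw [this]
            simp [g]
          rw [this]
          rfl
        have h3 : (e.hom ≫ l).app j ⟨z, hA rfl⟩ = 0 := by
          refine Subtype.ext ?_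
          change (e.hom ≫ (g ≫ i).hom).app j ⟨z, hA rfl⟩ = 0
          have : e.hom ≫ (g ≫ i).hom = S.incl ≫ i.hom := by simp [g]
          rw [this]
          exact hz
        have h4 : e.hom ≫ k.hom ≫ f'.hom = (e.hom ≫ l) ≫ e'.hom ≫ f'.hom := by
          simp [k]
        rw [← h2, h4]
        exact (congrArg ((e'.hom ≫ f'.hom).app j) h3).trans
          (map_zero ((e'.hom ≫ f'.hom).app j))
      · obtain ⟨t, S, e, hA⟩ := exists_smallModule hc hsub Y.property hP {⟨j, y⟩} (hone _)
        obtain ⟨f, hf⟩ := h _ (ObjectProperty.ofObj_apply _ t)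
          (ObjectProperty.homMk (e.inv ≫ S.incl))
        refine ⟨(e.hom ≫ f.hom).app j ⟨y, hA rfl⟩, ?_⟩
        have : (e.hom ≫ f.hom) ≫ i.hom = S.incl := by
          have := congrArg InducedCategory.Hom.hom hf
          change f.hom ≫ i.hom = e.inv ≫ S.incl at this
          rw [Category.assoc, this, Iso.hom_inv_id_assoc]
        exact congrArg (fun u : S.toDGMod ⟶ Y.obj => u.app j ⟨y, hA rfl⟩) this
    exact (ObjectProperty.isIso_hom_iff i).1 this

/-- A class of differential modules that is closed under colimits, and all of whose members are the
unions of their small submodules that belong to the class, is a locally presentable category. -/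
theorem isLocallyPresentable_of_hasSmallSubs (hP : ClosedUnderColimits P) :
    IsLocallyPresentable.{0} P.FullSubcategory := by
  have hreg : Fact (succ c).IsRegular := ⟨isRegular_succ hc.aleph0_le⟩
  have hcl : ∀ (I : Type) [SmallCategory I], P.IsClosedUnderColimitsOfShape I := fun I _ =>
    hP.isClosedUnderColimitsOfShape I
  have : HasColimitsOfSize.{0, 0} P.FullSubcategory :=
    { has_colimits_of_shape := fun I _ => inferInstance }
  have hiso : P.IsClosedUnderIsomorphisms := by
    -- an isomorphism is a colimit cocone on a diagram with one object
    refine ⟨fun {X Y} e hX => ?_⟩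
    let s : Cocone ((Functor.const (Discrete PUnit.{1})).obj X) :=
      { pt := Y, ι := { app := fun _ => e.hom } }
    have hs : IsColimit s :=
      { desc := fun u => e.inv ≫ u.ι.app ⟨⟨⟩⟩
        fac := fun u j => by
          change e.hom ≫ e.inv ≫ _ = _
          rw [Iso.hom_inv_id_assoc]
        uniq := fun u m hm => by
          rw [← hm]
          change m = e.inv ≫ e.hom ≫ m
          rw [Iso.inv_hom_id_assoc] }
    exact hP _ _ s (isPointwiseColimit_of_isColimit hs) fun _ => hX
  refine ⟨succ c, hreg, ?_⟩
  rw [IsCardinalLocallyPresentable.iff_exists_isStrongGenerator]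
  refine ⟨_, inferInstance, isStrongGenerator_smallModule hc hsub hiso, ?_⟩
  rintro _ ⟨t⟩
  have h1 := isCardinalPresentable_of_card_le hc (card_smallModule_le hc t)
  -- presentability is inherited from the category of all modules, as `P` is closed under colimits
  have : P.ι.IsCardinalAccessible (succ c) := ⟨fun I _ _ => inferInstance⟩
  have e : P.ι ⋙ coyoneda.obj (op (smallModule t).obj) ≅ coyoneda.obj (op (smallModule t)) :=
    NatIso.ofComponents (fun Y => Equiv.toIso
      { toFun := fun f => ObjectProperty.homMk f
        invFun := fun f => f.hom
        left_inv := fun _ => rfl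
        right_inv := fun _ => rfl })
  exact Functor.isCardinalAccessible_of_natIso e (succ c)

end Criterion

end TorusModel

namespace TorusModel

open Limits Cardinal

/-! ### Extension of scalars -/

section Extension

variable {R S M N : Type} [CommRing R] [CommRing S] [AddCommGroup M] [AddCommGroup N]
  [Module R M] [Module S N] {φ : R →+* S} {f : M →ₛₗ[φ] N}

/-- Extension of scalars in terms of its universal property. -/
theorem isExtension_iff_lift : IsExtension φ f ↔
    ∀ (Q : Type) [AddCommGroup Q] [Module S Q] (g : M →ₛₗ[φ] Q),
      ∃! g' : N →ₗ[S] Q, ∀ x, g' (f x) = g x := by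
  let _ : Algebra R S := φ.toAlgebra
  let _ : Module R N := Module.compHom N φ
  have : IsScalarTower R S N := ⟨fun a s x => mul_smul (φ a) s x⟩
  constructor
  · intro h Q _ _ g
    let _ : Module R Q := Module.compHom Q φ
    have : IsScalarTower R S Q := ⟨fun a s x => mul_smul (φ a) s x⟩
    let gR : M →ₗ[R] Q := { toFun := g, map_add' := g.map_add, map_smul' := g.map_smulₛₗ }
    have hb : IsBaseChange S ({ toFun := f, map_add' := f.map_add, map_smul' := f.map_smulₛₗ } :
      M →ₗ[R] N) := h
    refine ⟨hb.lift gR, fun x => hb.lift_eq gR x, fun g' hg' => ?_⟩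
    exact hb.algHom_ext _ _ fun x => (hg' x).trans (hb.lift_eq gR x).symm
  · intro h
    change IsBaseChange S ({ toFun := f, map_add' := f.map_add, map_smul' := f.map_smulₛₗ } :
      M →ₗ[R] N)
    refine IsBaseChange.of_lift_unique _ fun Q _ _ _ _ g => ?_
    let _ : AddCommGroup Q := Module.addCommMonoidToAddCommGroup S
    have hφ : ∀ (a : R) (q : Q), a • q = φ a • q := fun a q => (algebraMap_smul S a q).symm
    obtain ⟨g', hg', hu⟩ := h Q
      { toFun := g, map_add' := g.map_add, map_smul' := fun a x => by rw [map_smul, hφ] }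
    exact ⟨g', LinearMap.ext hg', fun g'' h'' => hu g'' fun x => LinearMap.congr_fun h'' x⟩

theorem IsExtension.exists_sum (h : IsExtension φ f) (y : N) :
    ∃ (F : Finset M) (s : M → S), y = ∑ x ∈ F, s x • f x := by
  let _ : Algebra R S := φ.toAlgebra
  let _ : Module R N := Module.compHom N φ
  have : IsScalarTower R S N := ⟨fun a s x => mul_smul (φ a) s x⟩
  have hb : IsBaseChange S ({ toFun := f, map_add' := f.map_add, map_smul' := f.map_smulₛₗ } :
    M →ₗ[R] N) := h
  obtain ⟨v, hv⟩ := TensorProduct.exists_finsupp_right (hb.equiv.symm y)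
  refine ⟨v.support, v, ?_⟩
  rw [← hb.equiv.apply_symm_apply y, hv, Finsupp.sum, map_sum]
  exact Finset.sum_congr rfl fun x _ => hb.equiv_tmul _ _

/-- A linear relation in an extension of scalars already holds in the extension of scalars of every
submodule that contains a suitable finite set. -/
theorem IsExtension.exists_witness (h : IsExtension φ f) (F : Finset M) (s : M → S)
    (h0 : ∑ x ∈ F, s x • f x = 0) :
    letI : Algebra R S := φ.toAlgebra
    ∃ W : Finset M, ∀ (P : Submodule R M) (hF : ∀ x ∈ F, x ∈ P), (∀ x ∈ W, x ∈ P) →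
      ∑ x ∈ F.attach, s x.1 ⊗ₜ[R] (⟨x.1, hF x.1 x.2⟩ : P) = 0 := by
  let _ : Algebra R S := φ.toAlgebra
  let _ : Module R N := Module.compHom N φ
  have : IsScalarTower R S N := ⟨fun a s x => mul_smul (φ a) s x⟩
  have hb : IsBaseChange S ({ toFun := f, map_add' := f.map_add, map_smul' := f.map_smulₛₗ } :
    M →ₗ[R] N) := h
  have ht : ∑ x ∈ F, s x ⊗ₜ[R] x = 0 := by
    refine hb.equiv.injective ?_
    rw [map_sum, map_zero, ← h0]
    exact Finset.sum_congr rfl fun x _ => hb.equiv_tmul _ _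
  have hfg : (Submodule.span R (F : Set M)).FG := ⟨F, rfl⟩
  let t : TensorProduct R (Submodule.span R (F : Set M)) S :=
    ∑ x ∈ F.attach, (⟨x.1, Submodule.subset_span x.2⟩ : Submodule.span R (F : Set M)) ⊗ₜ[R] s x.1
  have ht' : LinearMap.rTensor S (Submodule.span R (F : Set M)).subtype t = 0 := by
    have := congrArg (TensorProduct.comm R S M) ht
    rw [map_sum, map_zero, ← Finset.sum_attach] at this
    simp only [TensorProduct.comm_tmul] at this
    simp only [t, map_sum, LinearMap.rTensor_tmul]
    exact this
  obtain ⟨Q, hQ, ⟨W, hW⟩, h0⟩ := TensorProduct.eq_zero_of_fg_of_subtype_eq_zero hfg ht'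
  refine ⟨W, fun P hF hP => ?_⟩
  have hQP : Q ≤ P := by
    rw [← hW, Submodule.span_le]
    exact hP
  have := congrArg (fun z => TensorProduct.comm R P S
    (LinearMap.rTensor S (Submodule.inclusion hQP) z)) h0
  simp only [t, map_sum, LinearMap.rTensor_tmul, TensorProduct.comm_tmul, map_zero] at this
  exact this

/-- The restriction of an extension of scalars to submodules is an extension of scalars if the
smaller submodule contains generators and witnesses of relations. -/
theorem isExtension_restrict {P : Submodule R M} {P' : Submodule S N} (f' : P →ₛₗ[φ] P')
    (hf' : ∀ x, (f' x : N) = f x)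
    (hgen : ∀ y ∈ P', ∃ (F : Finset M) (s : M → S), (∀ x ∈ F, x ∈ P) ∧ y = ∑ x ∈ F, s x • f x)
    (hrel : letI : Algebra R S := φ.toAlgebra
      ∀ (F : Finset M) (s : M → S) (hF : ∀ x ∈ F, x ∈ P), ∑ x ∈ F, s x • f x = 0 →
        ∑ x ∈ F.attach, s x.1 ⊗ₜ[R] (⟨x.1, hF x.1 x.2⟩ : P) = 0) :
    IsExtension φ f' := by
  classical
  let _ : Algebra R S := φ.toAlgebra
  let _ : Module R P' := Module.compHom P' φ
  have : IsScalarTower R S P' := ⟨fun a s x => mul_smul (φ a) s x⟩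
  let l : P →ₗ[R] P' := { toFun := f', map_add' := f'.map_add, map_smul' := f'.map_smulₛₗ }
  change Function.Bijective
    (TensorProduct.lift
      (((Algebra.linearMap S <| Module.End S (P →ₗ[R] P')).flip l).restrictScalars R))
  have hl : ∀ (s : S) (x : P), TensorProduct.lift (((Algebra.linearMap S <|
      Module.End S (P →ₗ[R] P')).flip l).restrictScalars R) (s ⊗ₜ x) = s • f' x := by
    intro s x
    rfl
  constructor
  · rw [injective_iff_map_eq_zero]
    intro t ht
    obtain ⟨v, rfl⟩ := TensorProduct.exists_finsupp_right t
    rw [Finsupp.sum, map_sum] at ht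
    simp only [hl] at ht
    let F : Finset M := v.support.map (Function.Embedding.subtype _)
    let s : M → S := fun x => if hx : x ∈ P then v ⟨x, hx⟩ else 0
    have hs : ∀ x : P, s x.1 = v x := fun x => dif_pos x.2
    have hF : ∀ x ∈ F, x ∈ P := by
      intro x hx
      obtain ⟨x, -, rfl⟩ := Finset.mem_map.1 hx
      exact x.2
    have h0 : ∑ x ∈ F, s x • f x = 0 := by
      rw [Finset.sum_map]
      have := congrArg (P'.subtype) ht
      rw [map_sum, map_zero] at this
      rw [← this]
      refine Finset.sum_congr rfl fun x _ => ?_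
      rw [map_smul, Submodule.subtype_apply, hf']
      exact congrArg (· • f x.1) (hs x)
    have := hrel F s hF h0
    rw [Finsupp.sum, ← this]
    refine Finset.sum_bij (fun x hx => ⟨x.1, Finset.mem_map_of_mem _ hx⟩) ?_ ?_ ?_ ?_
    · intro x _
      exact Finset.mem_attach _ _
    · intro x _ y _ h
      exact Subtype.ext (congrArg (fun z => z.1) h)
    · rintro ⟨x, hx⟩ _
      obtain ⟨x', hx', rfl⟩ := Finset.mem_map.1 hx
      exact ⟨x', hx', rfl⟩
    · intro x _
      rw [hs]
  · intro y
    obtain ⟨F, s, hF, hy⟩ := hgen y.1 y.2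
    refine ⟨∑ x ∈ F.attach, s x.1 ⊗ₜ ⟨x.1, hF x.1 x.2⟩, ?_⟩
    rw [map_sum]
    simp only [hl]
    refine Subtype.ext ?_
    rw [AddSubmonoidClass.coe_finsetSum, hy, ← Finset.sum_attach F fun x => s x • f x]
    exact Finset.sum_congr rfl fun x _ => by rw [Submodule.coe_smul, hf']

/-- A surjective semilinear map is an extension of scalars along a surjective ring map if its kernel
is annihilated by an element with image `1`. For the projection of a ring onto a direct factor such
an element is the idempotent of that factor. -/
theorem isExtension_of_surjective (hφ : Function.Surjective φ) (hf : Function.Surjective f) (e : R)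
    (he : φ e = 1) (hker : ∀ x, f x = 0 → e • x = 0) : IsExtension φ f := by
  rw [isExtension_iff_lift]
  intro Q _ _ g
  have hg : ∀ x, f x = 0 → g x = 0 := fun x hx => by
    rw [← one_smul S (g x), ← he, ← LinearMap.map_smulₛₗ, hker x hx, map_zero]
  choose σ hσ using hf
  have hgσ : ∀ x y, f x = y → g (σ y) = g x := fun x y h => by
    rw [← sub_eq_zero, ← map_sub]
    exact hg _ (by rw [map_sub, hσ, h, sub_self])
  refine ⟨{ toFun := fun y => g (σ y), map_add' := fun y y' => ?_, map_smul' := fun s y => ?_ },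
    fun x => hgσ x _ rfl, fun g' h' => LinearMap.ext fun y => ?_⟩
  · rw [← map_add, hgσ (σ y + σ y') _ (by rw [map_add, hσ, hσ])]
  · obtain ⟨a, rfl⟩ := hφ s
    rw [RingHom.id_apply, ← LinearMap.map_smulₛₗ, hgσ (a • σ y) _ (by rw [LinearMap.map_smulₛₗ, hσ])]
  · change g' y = g (σ y)
    rw [← h', hσ]

end Extension

variable {J : Type} [Preorder J] {R : RingDiagram J}

/-- Extensions of scalars are closed under colimits, as they have a universal property. -/
theorem closedUnderColimits_isExtension {i j : J} (h : i ≤ j) :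
    ClosedUnderColimits fun M : DGMod R => IsExtension (R.map h) (M.map h) := by
  intro I _ F c hc hF
  rw [isExtension_iff_lift]
  intro Q _ _ g
  -- the lifts at the stages are compatible by uniqueness, and define a map on the colimit
  choose l hl hu using fun k => isExtension_iff_lift.1 (hF k) Q (g.comp ((leg c k).app i))
  obtain ⟨G, hG⟩ := hc.exists_desc j (fun k => (l k).toAddMonoidHom) (fun {k k'} φ x => by
    refine LinearMap.congr_fun (hu k ((l k').comp ((F.map φ).app j)) fun x => ?_) x
    rw [LinearMap.comp_apply, (F.map φ).naturality, hl]
    change g ((leg c k').app i ((F.map φ).app i x)) = g ((leg c k).app i x)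
    rw [leg_w])
  have hGf : ∀ x, G (c.pt.map h x) = g x := by
    intro x
    refine hc.induction i (C := fun x => G (c.pt.map h x) = g x) x (by simp) ?_ ?_ ?_
    · intro k x
      rw [← (leg c k).naturality, hG]
      exact hl k x
    · intro x y hx hy
      simp [hx, hy]
    · intro x hx
      simp [hx]
  refine ⟨{ G with map_smul' := fun a x => ?_ }, hGf, fun g' hg' => ?_⟩
  · refine hc.induction j (C := fun x => G (a • x) = a • G x) x (by simp) ?_ ?_ ?_
    · intro k x
      rw [← map_smul, hG, hG]
      exact (l k).map_smul a x
    · intro x y hx hy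
      simp [hx, hy]
    · intro x hx
      simp [hx]
  · refine LinearMap.ext fun x => ?_
    refine hc.induction j (C := fun x => g' x = G x) x (by simp) ?_ ?_ ?_
    · intro k x
      rw [hG]
      refine LinearMap.congr_fun (hu k (g'.comp ((leg c k).app j)) fun x => ?_) x
      rw [LinearMap.comp_apply, (leg c k).naturality, hg']
      rfl
    · intro x y hx hy
      rw [map_add, hx, hy, map_add]
    · intro x hx
      rw [map_neg, hx, map_neg]

/-- Submodules inherit an extension of scalars if they contain, with each element of the target,
elements of the source that generate it, and, with each relation, the elements that witness it. -/
theorem hasSmallSubs_isExtension {b : Cardinal.{0}} (hb : Bounds b R) {i j : J} (h : i ≤ j) :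
    HasSmallSubs b fun M : DGMod R => IsExtension (R.map h) (M.map h) := by
  classical
  intro M hM
  choose gen coef hgen using fun y => IsExtension.exists_sum (f := M.map h) hM y
  have hw : ∀ (F : Finset (M.obj i)) (s : M.obj i → R.ring j), ∃ G : Finset (M.obj i),
      ∑ x ∈ F, s x • M.map h x = 0 → letI : Algebra (R.ring i) (R.ring j) := (R.map h).toAlgebra
        ∀ (P : Submodule (R.ring i) (M.obj i)) (hF : ∀ x ∈ F, x ∈ P), (∀ x ∈ G, x ∈ P) →
          ∑ x ∈ F.attach, s x.1 ⊗ₜ[R.ring i] (⟨x.1, hF x.1 x.2⟩ : P) = 0 := by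
    intro F s
    by_cases h0 : ∑ x ∈ F, s x • M.map h x = 0
    · obtain ⟨G, hG⟩ := IsExtension.exists_witness hM F s h0
      exact ⟨G, fun _ => hG⟩
    · exact ⟨∅, fun h1 => absurd h1 h0⟩
  choose wit hwit using hw
  -- the part of a finite set that lies in the value at `k`
  let part : ∀ k, Finset M.El → Finset (M.obj k) := fun k F =>
    F.preimage (Sigma.mk k) sigma_mk_injective.injOn
  -- the extension by zero of coefficients on a finite set
  let ext : ∀ F : Finset (M.obj i), (F → R.ring j) → (M.obj i → R.ring j) := fun F s x =>
    if hx : x ∈ F then s ⟨x, hx⟩ else 0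
  let cl : Finset M.El → Set M.El := fun F =>
    (⋃ y : part j F, Sigma.mk i '' (gen y.1 : Set (M.obj i))) ∪
    ⋃ s : part i F → R.ring j, Sigma.mk i '' (wit (part i F) (ext (part i F) s) : Set (M.obj i))
  have hcl₁ : ∀ (F : Finset M.El) (y : part j F) (x : M.obj i), x ∈ gen y.1 →
      (⟨i, x⟩ : M.El) ∈ cl F := fun F y x hx =>
    Set.mem_union_left _ (Set.mem_iUnion.2 ⟨y, Set.mem_image_of_mem _ hx⟩)
  have hcl₂ : ∀ (F : Finset M.El) (s : part i F → R.ring j) (x : M.obj i),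
      x ∈ wit (part i F) (ext (part i F) s) → (⟨i, x⟩ : M.El) ∈ cl F := fun F s x hx =>
    Set.mem_union_right _ (Set.mem_iUnion.2 ⟨s, Set.mem_image_of_mem _ hx⟩)
  have h0 := hb.aleph0_le
  refine ⟨cl, fun F => (mk_union_le _ _).trans (add_le_of_le h0 ?_ ?_), fun S hS => ?_⟩
  · refine (mk_iUnion_le _).trans (mul_le_of_le h0 ((lt_aleph0_of_finite _).le.trans h0)
      (ciSup_le' fun y => mk_image_le.trans ((lt_aleph0_of_finite _).le.trans h0)))
  · refine (mk_iUnion_le _).trans (mul_le_of_le h0 ?_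
      (ciSup_le' fun y => mk_image_le.trans ((lt_aleph0_of_finite _).le.trans h0)))
    rw [← power_def]
    obtain ⟨n, hn⟩ := lt_aleph0.1 (lt_aleph0_of_finite (part i F))
    rw [hn, power_natCast]
    exact (pow_le_pow_left' (hb.ring j) n).trans (power_nat_le h0)
  · have hgen' : ∀ y ∈ S.sub j, ∃ (F : Finset (M.obj i)) (s : M.obj i → R.ring j),
        (∀ x ∈ F, x ∈ S.sub i) ∧ y = ∑ x ∈ F, s x • M.map h x := by
      intro y hy
      refine ⟨gen y, coef y, fun x hx => ?_, hgen y⟩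
      let F₀ : Finset M.El := {⟨j, y⟩}
      have hyp : y ∈ part j F₀ := by simp [part, F₀]
      have hF₀ : (F₀ : Set M.El) ⊆ S.carrier := by
        rw [Finset.coe_singleton, Set.singleton_subset_iff]
        exact hy
      have hx' : (⟨i, x⟩ : M.El) ∈ cl F₀ := hcl₁ F₀ ⟨y, hyp⟩ x hx
      exact hS F₀ hF₀ hx'
    have hrel' : letI : Algebra (R.ring i) (R.ring j) := (R.map h).toAlgebra
        ∀ (F : Finset (M.obj i)) (s : M.obj i → R.ring j) (hF : ∀ x ∈ F, x ∈ S.sub i),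
          ∑ x ∈ F, s x • M.map h x = 0 →
            ∑ x ∈ F.attach, s x.1 ⊗ₜ[R.ring i] (⟨x.1, hF x.1 x.2⟩ : S.sub i) = 0 := by
      intro F s hF hs
      let F' : Finset M.El := F.map ⟨Sigma.mk i, sigma_mk_injective⟩
      have hpart : part i F' = F := by
        ext x
        simp [part, F']
      have hs' : ∑ x ∈ F, ext F (fun x => s x.1) x • M.map h x = 0 := by
        rw [← hs]
        exact Finset.sum_congr rfl fun x hx => by simp only [ext, dif_pos hx]
      have hF' : (F' : Set M.El) ⊆ S.carrier := by
        intro z hz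
        obtain ⟨x, hx, rfl⟩ := Finset.mem_map.1 (Finset.mem_coe.1 hz)
        exact hF x hx
      have hG : ∀ x ∈ wit F (ext F fun x => s x.1), x ∈ S.sub i := fun x hx => by
        have hx' : x ∈ wit (part i F') (ext (part i F') fun x => s x.1) := by
          rw [hpart]
          exact hx
        have hx'' : (⟨i, x⟩ : M.El) ∈ cl F' := hcl₂ F' (fun x => s x.1) x hx'
        exact hS F' hF' hx''
      have key := hwit F _ hs' (S.sub i) hF hG
      rw [← key]
      exact Finset.sum_congr rfl fun x _ => by simp only [ext, dif_pos x.2]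
    exact isExtension_restrict (f := M.map h) (P := S.sub i) (P' := S.sub j) (S.toDGMod.map h)
      (fun _ => rfl) hgen' hrel'

end TorusModel

namespace TorusModel

open Limits Cardinal

/-! ### Uniform denominators -/

section Continuity

variable {J : Type} [Preorder J] {R : RingDiagram J} {j₀ : J} {Λ 𝒱 : Type} {j₁ j₂ : Λ → J}
  (h₀ : ∀ l, j₀ ≤ j₂ l) (h₁ : ∀ l, j₁ l ≤ j₂ l) (e : 𝒱 → ∀ l, R.ring (j₂ l))

/-- The abstract form of `𝓕`-continuity at a pair of subgroups: every element of `M(j₀)` has a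
multiple `e V • x` that comes from `M(j₁ l)` for all `l` simultaneously. -/
def HasUniformDenominators (M : GrMod R) : Prop :=
  ∀ x : M.obj j₀, ∃ V : 𝒱, ∀ l, ∃ y : M.obj (j₁ l), M.map (h₁ l) y = e V l • M.map (h₀ l) x

/-- Uniform denominators are closed under colimits if any two denominators have a common multiple,
with cofactors from the rings at `j₁ l`. -/
theorem closedUnderColimits_hasUniformDenominators [Nonempty 𝒱]
    (he : ∀ V W, ∃ U, ∀ l, ∃ a b, e U l = R.map (h₁ l) a * e V l ∧ e U l = R.map (h₁ l) b * e W l) :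
    ClosedUnderColimits fun M : DGMod R => HasUniformDenominators h₀ h₁ e M.toGrMod := by
  intro I _ F c hc hF x
  obtain ⟨V₀⟩ := ‹Nonempty 𝒱›
  refine hc.induction j₀ (C := fun x => ∃ V : 𝒱, ∀ l, ∃ y : c.pt.obj (j₁ l),
    c.pt.map (h₁ l) y = e V l • c.pt.map (h₀ l) x) x ⟨V₀, fun l => ⟨0, by simp⟩⟩ ?_ ?_ ?_
  · intro k x
    obtain ⟨V, hV⟩ := hF k x
    refine ⟨V, fun l => ?_⟩
    obtain ⟨y, hy⟩ := hV l
    refine ⟨(leg c k).app _ y, ?_⟩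
    rw [← (leg c k).naturality, ← (leg c k).naturality, hy, map_smul]
  · rintro x y ⟨V, hV⟩ ⟨W, hW⟩
    obtain ⟨U, hU⟩ := he V W
    refine ⟨U, fun l => ?_⟩
    obtain ⟨a, b, ha, hb⟩ := hU l
    obtain ⟨x', hx'⟩ := hV l
    obtain ⟨y', hy'⟩ := hW l
    refine ⟨a • x' + b • y', ?_⟩
    rw [map_add, LinearMap.map_smulₛₗ, LinearMap.map_smulₛₗ, hx', hy', smul_smul, smul_smul, ← ha,
      ← hb, map_add, smul_add]
  · rintro x ⟨V, hV⟩
    refine ⟨V, fun l => ?_⟩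
    obtain ⟨y, hy⟩ := hV l
    exact ⟨-y, by rw [map_neg, hy, map_neg, smul_neg]⟩

theorem hasSmallSubs_hasUniformDenominators {c : Cardinal.{0}} (hc : ℵ₀ ≤ c) (hΛ : #Λ ≤ c) :
    HasSmallSubs c fun M : DGMod R => HasUniformDenominators h₀ h₁ e M.toGrMod := by
  intro M hM
  choose V y hy using hM
  let part : Finset M.El → Finset (M.obj j₀) := fun F =>
    F.preimage (Sigma.mk j₀) sigma_mk_injective.injOn
  let cl : Finset M.El → Set M.El := fun F =>
    Set.range fun z : part F × Λ => (⟨j₁ z.2, y z.1.1 z.2⟩ : M.El)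
  refine ⟨cl, fun F => mk_range_le.trans ?_, fun S hS x => ⟨V x.1, fun l => ?_⟩⟩
  · rw [mk_prod, lift_id, lift_id]
    exact mul_le_of_le hc ((lt_aleph0_of_finite _).le.trans hc) hΛ
  · let F₀ : Finset M.El := {⟨j₀, x.1⟩}
    have hx : x.1 ∈ part F₀ := by simp [part, F₀]
    have hF₀ : (F₀ : Set M.El) ⊆ S.carrier := by
      rw [Finset.coe_singleton, Set.singleton_subset_iff]
      exact x.2
    have hmem : (⟨j₁ l, y x.1 l⟩ : M.El) ∈ cl F₀ := ⟨(⟨x.1, hx⟩, l), rfl⟩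
    exact ⟨⟨y x.1 l, hS F₀ hF₀ hmem⟩, Subtype.ext (hy x.1 l)⟩

end Continuity

/-! ### Graded modules as differential modules with zero differential -/

section Models

variable {J : Type} [Preorder J] {R : RingDiagram J} (Q : ObjectProperty (GrMod R))

/-- The differential modules whose underlying graded module belongs to a given class, and, if `Z`
holds, whose differential is zero. -/
def dgProp (Z : Prop) : ObjectProperty (DGMod R) := fun M =>
  (Z → ∀ j (x : M.obj j), M.d j x = 0) ∧ Q M.toGrMod

theorem closedUnderColimits_zeroDifferential (Z : Prop) :
    ClosedUnderColimits fun M : DGMod R => Z → ∀ j (x : M.obj j), M.d j x = 0 := by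
  intro I _ F c hc hF hZ j x
  refine hc.induction j (C := fun x => c.pt.d j x = 0) x (map_zero _) ?_ ?_ ?_
  · intro k x
    rw [← (leg c k).app_d, hF k hZ, map_zero]
  · intro x y hx hy
    rw [map_add, hx, hy, add_zero]
  · intro x hx
    rw [map_neg, hx, neg_zero]

theorem hasSmallSubs_zeroDifferential (c : Cardinal.{0}) (Z : Prop) :
    HasSmallSubs c fun M : DGMod R => Z → ∀ j (x : M.obj j), M.d j x = 0 :=
  fun M hM => ⟨fun _ => ∅, fun _ => by simp,
    fun S _ hZ j x => Subtype.ext (hM hZ j x.1)⟩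

variable {Q} in
theorem isLocallyPresentable_dgProp {c : Cardinal.{0}} (hc : Bounds c R)
    (hQ : ClosedUnderColimits fun M : DGMod R => Q M.toGrMod)
    (hQ' : HasSmallSubs c fun M : DGMod R => Q M.toGrMod) (Z : Prop) :
    IsLocallyPresentable.{0} (dgProp Q Z).FullSubcategory :=
  isLocallyPresentable_of_hasSmallSubs hc
    ((hasSmallSubs_zeroDifferential c Z).and hc.aleph0_le hQ')
    ((closedUnderColimits_zeroDifferential Z).and hQ)

/-- A graded module with the zero differential. -/
def GrMod.withZeroDifferential (M : GrMod R) : DGMod R :=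
  { M with
    d := fun _ => 0
    d_deg := fun _ _ _ _ => AddSubgroup.zero_mem _
    d_d := fun _ _ => rfl
    d_map := fun h _ => (map_zero (M.map h)).symm }

/-- The functor that forgets the zero differential. -/
def forgetZeroDifferential : (dgProp Q True).FullSubcategory ⥤ Q.FullSubcategory where
  obj M := ⟨M.obj.toGrMod, M.property.2⟩
  map f := ObjectProperty.homMk f.hom.toHom

instance : (forgetZeroDifferential Q).Faithful where
  map_injective {_ _} f g h := by
    have h' : f.hom.toHom = g.hom.toHom :=
      congrArg (fun f => f.hom) h
    exact ObjectProperty.hom_ext _ (DGMod.Hom.ext (congrArg GrMod.Hom.app h'))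

instance : (forgetZeroDifferential Q).Full where
  map_surjective {M N} f := by
    refine ⟨ObjectProperty.homMk
      { toHom := f.hom, app_d := fun j x => ?_ }, rfl⟩
    rw [M.property.1 trivial, N.property.1 trivial, map_zero]

instance : (forgetZeroDifferential Q).EssSurj where
  mem_essImage M := ⟨⟨M.obj.withZeroDifferential, fun _ _ _ => rfl, M.property⟩, ⟨Iso.refl _⟩⟩

instance : (forgetZeroDifferential Q).IsEquivalence where

/-- Both versions of a model are instances of `dgProp`: graded modules are the same as differential
modules with zero differential. -/
theorem isLocallyPresentable_both
    (h : ∀ Z, IsLocallyPresentable.{0} (dgProp Q Z).FullSubcategory) :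
    IsLocallyPresentable.{0} Q.FullSubcategory ∧ IsLocallyPresentable.{0}
      (ObjectProperty.FullSubcategory fun M : DGMod R => Q M.toGrMod) := by
  have h1 := h True
  have h2 := h False
  have e : dgProp Q False = fun M : DGMod R => Q M.toGrMod :=
    funext fun M => propext ⟨fun h => h.2, fun h => ⟨False.elim, h⟩⟩
  rw [e] at h2
  exact ⟨(forgetZeroDifferential Q).asEquivalence.isLocallyPresentable, h2⟩

end Models

/-! ### Quasi-coherent extended modules -/

section Qce

/-- There is a cardinal that bounds a given diagram and a given type. -/
theorem exists_bounds {J : Type} [Preorder J] (R : RingDiagram J) (A : Type) :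
    ∃ c, Bounds c R ∧ #A ≤ c := by
  refine ⟨max (max ℵ₀ #J) (max #A #(Σ j, R.ring j)), ⟨?_, ?_, fun j => ?_⟩, ?_⟩
  · exact (le_max_left _ _).trans (le_max_left _ _)
  · exact (le_max_right _ _).trans (le_max_left _ _)
  · exact (mk_le_of_injective sigma_mk_injective).trans
      ((le_max_right _ _).trans (le_max_right _ _))
  · exact (le_max_left _ _).trans (le_max_right _ _)

variable {P : Type} [PartialOrder P]

theorem closedUnderColimits_isQcePairs (R : RingDiagram (NonemptyInterval P)) :
    ClosedUnderColimits fun M : DGMod R => IsQcePairs M.toGrMod :=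
  .forall fun p => .and (closedUnderColimits_isExtension (pure_fst_le p))
    (closedUnderColimits_isExtension (pure_snd_le p))

theorem hasSmallSubs_isQcePairs {R : RingDiagram (NonemptyInterval P)} {c : Cardinal.{0}}
    (hc : Bounds c R) : HasSmallSubs c fun M : DGMod R => IsQcePairs M.toGrMod :=
  .forall hc.aleph0_le hc.index fun p => .and hc.aleph0_le
    (hasSmallSubs_isExtension hc (pure_fst_le p)) (hasSmallSubs_isExtension hc (pure_snd_le p))

theorem closedUnderColimits_isQceFlags (R : RingDiagram (FinFlag P)) :
    ClosedUnderColimits fun M : DGMod R => IsQceFlags M.toGrMod :=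
  .forall fun E => .and (closedUnderColimits_isExtension (FinFlag.single_le E.bot_mem))
    (closedUnderColimits_isExtension (FinFlag.single_le E.top_mem))

theorem hasSmallSubs_isQceFlags {R : RingDiagram (FinFlag P)} {c : Cardinal.{0}}
    (hc : Bounds c R) : HasSmallSubs c fun M : DGMod R => IsQceFlags M.toGrMod :=
  .forall hc.aleph0_le hc.index fun E => .and hc.aleph0_le
    (hasSmallSubs_isExtension hc (FinFlag.single_le E.bot_mem))
    (hasSmallSubs_isExtension hc (FinFlag.single_le E.top_mem))

theorem isLocallyPresentable_qcePairs (R : RingDiagram (NonemptyInterval P)) (Z : Prop) :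
    IsLocallyPresentable.{0} (dgProp (R := R) IsQcePairs Z).FullSubcategory := by
  obtain ⟨c, hc, -⟩ := exists_bounds R Unit
  exact isLocallyPresentable_dgProp hc (closedUnderColimits_isQcePairs R)
    (hasSmallSubs_isQcePairs hc) Z

theorem isLocallyPresentable_qceFlags (R : RingDiagram (FinFlag P)) (Z : Prop) :
    IsLocallyPresentable.{0} (dgProp (R := R) IsQceFlags Z).FullSubcategory := by
  obtain ⟨c, hc, -⟩ := exists_bounds R Unit
  exact isLocallyPresentable_dgProp hc (closedUnderColimits_isQceFlags R)
    (hasSmallSubs_isQceFlags hc) Z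

end Qce

/-! ### `𝓕`-continuous modules -/

section FContinuous

variable {r : ℕ}

/-- The subgroups with identity component `L` that are cotoral in `K`. -/
abbrev CotoralOver (K : AllSub r) (L : ConnSub r) : Type :=
  {L' : AllSub r // L' ≤ K ∧ L.toSubgroup ≤ L'.toSubgroup ∧
    L.toSubgroup.relIndex L'.toSubgroup ≠ 0}

/-- The representations `V` with `V^K = 0`. -/
abbrev RepNoFixed (K : AllSub r) : Type := {V : Multiset (Fin r → ℤ) // NoFixed V K.toSubgroup}

instance (K : AllSub r) : Nonempty (RepNoFixed K) :=
  ⟨⟨0, fun _ h => absurd h (Multiset.notMem_zero _)⟩⟩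

theorem eulerA_add_left (p : NonemptyInterval (AllSub r)) (V W : Multiset (Fin r → ℤ)) :
    eulerA p (V + W) = (Rap r).map (pure_fst_le p) (eulerA (NonemptyInterval.pure p.fst) W) *
      eulerA p V :=
  Subtype.ext (funext fun _ => (eulerFrac_add V W _).trans (mul_comm _ _))

/-- `𝓕`-continuity, split into one condition for each pair of a closed subgroup `K` and a connected
subgroup `L`. -/
theorem isFContinuousPairs_iff (M : GrMod (Rap r)) : IsFContinuousPairs M ↔
    ∀ z : AllSub r × ConnSub r, HasUniformDenominators (R := Rap r)
      (j₀ := NonemptyInterval.pure z.1)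
      (j₁ := fun L' : CotoralOver z.1 z.2 => NonemptyInterval.pure L'.1)
      (fun L' => pure_snd_le ⟨(L'.1, z.1), L'.2.1⟩) (fun L' => pure_fst_le ⟨(L'.1, z.1), L'.2.1⟩)
      (fun (V : RepNoFixed z.1) L' => eulerA ⟨(L'.1, z.1), L'.2.1⟩ V.1) M :=
  ⟨fun h z x => by
    obtain ⟨V, hV, hL⟩ := h z.1 x z.2
    exact ⟨⟨V, hV⟩, fun L' => hL L'.1 L'.2.1 L'.2.2.1 L'.2.2.2⟩,
  fun h K x L => by
    obtain ⟨V, hL⟩ := h (K, L) x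
    exact ⟨V.1, V.2, fun L' h h' h'' => hL ⟨L', h, h', h''⟩⟩⟩

theorem isFContinuousFlags_iff (M : GrMod (Raf r)) : IsFContinuousFlags M ↔
    ∀ z : AllSub r × ConnSub r, HasUniformDenominators (R := Raf r)
      (j₀ := FinFlag.single z.1) (j₁ := fun L' : CotoralOver z.1 z.2 => FinFlag.single L'.1)
      (fun L' => FinFlag.single_le (right_mem_pair L'.2.1))
      (fun L' => FinFlag.single_le (left_mem_pair L'.2.1))
      (fun (V : RepNoFixed z.1) L' => eulerAFlag (FinFlag.pair L'.2.1) V.1) M :=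
  ⟨fun h z x => by
    obtain ⟨V, hV, hL⟩ := h z.1 x z.2
    exact ⟨⟨V, hV⟩, fun L' => hL L'.1 L'.2.1 L'.2.2.1 L'.2.2.2⟩,
  fun h K x L => by
    obtain ⟨V, hL⟩ := h (K, L) x
    exact ⟨V.1, V.2, fun L' h h' h'' => hL ⟨L', h, h', h''⟩⟩⟩

theorem FinFlag.bot_single {P : Type} [PartialOrder P] (x : P) : (FinFlag.single x).bot = x :=
  Finset.mem_singleton.1 (FinFlag.single x).bot_mem

theorem FinFlag.bot_pair {P : Type} [PartialOrder P] {x y : P} (h : x ≤ y) :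
    (FinFlag.pair h).bot = x := by
  classical
  refine le_antisymm ((FinFlag.pair h).bot_le (left_mem_pair h)) ?_
  have hb : (FinFlag.pair h).bot ∈ ({x, y} : Finset P) := by
    convert (FinFlag.pair h).bot_mem
    simp [FinFlag.pair]
  rcases Finset.mem_insert.1 hb with hb | hb
  · exact hb.ge
  · rw [Finset.mem_singleton.1 hb]
    exact h

theorem eulerAFlag_add {K L : AllSub r} (h : L ≤ K) (V W : Multiset (Fin r → ℤ)) :
    eulerAFlag (FinFlag.pair h) (V + W) =
      (Raf r).map (FinFlag.single_le (left_mem_pair h)) (eulerAFlag (FinFlag.single L) W) *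
        eulerAFlag (FinFlag.pair h) V := by
  refine Subtype.ext (funext fun _ => ?_)
  change eulerFrac (V + W) (FinFlag.pair h).bot.toSubgroup =
    eulerFrac W (FinFlag.single L).bot.toSubgroup * eulerFrac V (FinFlag.pair h).bot.toSubgroup
  rw [FinFlag.bot_single, FinFlag.bot_pair, eulerFrac_add, mul_comm]

theorem isLocallyPresentable_fContinuousPairs (r : ℕ) (Z : Prop) :
    IsLocallyPresentable.{0} (dgProp (R := Rap r)
      (fun M => IsQcePairs M ∧ IsFContinuousPairs M) Z).FullSubcategory := by
  obtain ⟨c, hc, hA⟩ := exists_bounds (Rap r) (AllSub r ⊕ AllSub r × ConnSub r)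
  have hA₁ : #(AllSub r) ≤ c := (mk_le_of_injective Sum.inl_injective).trans hA
  have hA₂ : #(AllSub r × ConnSub r) ≤ c := (mk_le_of_injective Sum.inr_injective).trans hA
  refine isLocallyPresentable_dgProp hc (.and (closedUnderColimits_isQcePairs _) ?_)
    (.and hc.aleph0_le (hasSmallSubs_isQcePairs hc) ?_) Z
  · simp only [isFContinuousPairs_iff]
    refine .forall fun z => closedUnderColimits_hasUniformDenominators _ _ _
      fun V W => ⟨⟨V.1 + W.1, V.2.add W.2⟩, fun L' => ⟨_, _, eulerA_add_left _ _ _,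
        (congrArg _ (add_comm _ _)).trans (eulerA_add_left _ _ _)⟩⟩
  · simp only [isFContinuousPairs_iff]
    exact .forall hc.aleph0_le hA₂ fun z =>
      hasSmallSubs_hasUniformDenominators _ _ _ hc.aleph0_le ((mk_subtype_le _).trans hA₁)

theorem isLocallyPresentable_fContinuousFlags (r : ℕ) (Z : Prop) :
    IsLocallyPresentable.{0} (dgProp (R := Raf r)
      (fun M => IsQceFlags M ∧ IsFContinuousFlags M) Z).FullSubcategory := by
  obtain ⟨c, hc, hA⟩ := exists_bounds (Raf r) (AllSub r ⊕ AllSub r × ConnSub r)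
  have hA₁ : #(AllSub r) ≤ c := (mk_le_of_injective Sum.inl_injective).trans hA
  have hA₂ : #(AllSub r × ConnSub r) ≤ c := (mk_le_of_injective Sum.inr_injective).trans hA
  refine isLocallyPresentable_dgProp hc (.and (closedUnderColimits_isQceFlags _) ?_)
    (.and hc.aleph0_le (hasSmallSubs_isQceFlags hc) ?_) Z
  · simp only [isFContinuousFlags_iff]
    refine .forall fun z => closedUnderColimits_hasUniformDenominators _ _ _
      fun V W => ⟨⟨V.1 + W.1, V.2.add W.2⟩, fun L' => ⟨_, _, eulerAFlag_add _ _ _,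
        (congrArg _ (add_comm _ _)).trans (eulerAFlag_add _ _ _)⟩⟩
  · simp only [isFContinuousFlags_iff]
    exact .forall hc.aleph0_le hA₂ fun z =>
      hasSmallSubs_hasUniformDenominators _ _ _ hc.aleph0_le ((mk_subtype_le _).trans hA₁)

end FContinuous

end TorusModel

namespace TorusModel

open MeasureTheory

/-! ### Duality for closed subgroups of the torus -/

section Duality

variable {r : ℕ}

/-- The character `t ↦ ∏ i, t i ^ n i` of the torus. -/
noncomputable def character (n : Fin r → ℤ) : Torus r →* Circle where
  toFun t := ∏ i, t i ^ n i
  map_one' := by simp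
  map_mul' s t := by simp [mul_zpow, Finset.prod_mul_distrib]

theorem continuous_character (n : Fin r → ℤ) : Continuous (character n) :=
  continuous_finsetProd Finset.univ (f := fun i (t : Torus r) => t i ^ n i) fun i _ =>
    (continuous_apply i).zpow (n i)

theorem mem_ann_iff {K : Subgroup (Torus r)} {n : Fin r → ℤ} :
    n ∈ ann K ↔ ∀ t ∈ K, character n t = 1 := Iff.rfl

/-- The torus as a product of additive circles. -/
noncomputable def torusHomeomorph (r : ℕ) : UnitAddTorus (Fin r) ≃ₜ Torus r :=
  Homeomorph.piCongrRight fun _ => AddCircle.homeomorphCircle one_ne_zero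

/-- The monomials of Fourier analysis on the torus are the characters. -/
theorem mFourier_torusHomeomorph_symm (n : Fin r → ℤ) (t : Torus r) :
    UnitAddTorus.mFourier n ((torusHomeomorph r).symm t) = (character n t : ℂ) := by
  obtain ⟨x, rfl⟩ := (torusHomeomorph r).surjective t
  rw [Homeomorph.symm_apply_apply]
  have h : ∀ i, torusHomeomorph r x i = AddCircle.toCircle (x i) := fun i =>
    AddCircle.homeomorphCircle_apply _ _
  change ∏ i, ((AddCircle.toCircle (n i • x i) : Circle) : ℂ) =
    Circle.coeHom (∏ i, torusHomeomorph r x i ^ n i)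
  rw [map_prod]
  refine Finset.prod_congr rfl fun i _ => ?_
  rw [h, AddCircle.toCircle_zsmul]
  rfl

/-- Duality for closed subgroups of the torus: they are intersections of kernels of characters.
Otherwise, for a point `t` outside `K` at which the characters of `T / K` are trivial, integration
over `K` and integration over its translate by `t` agree on all characters, hence, by the
Stone–Weierstrass theorem, on all continuous functions, in particular on the distance to `K`. -/
theorem mem_of_forall_character_eq_one {K : Subgroup (Torus r)} (hK : IsClosed (K : Set (Torus r)))
    {t : Torus r} (ht : ∀ n ∈ ann K, character n t = 1) : t ∈ K := by
  by_contra htK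
  have : CompactSpace K := isCompact_iff_compactSpace.1 hK.isCompact
  let _ : MeasurableSpace K := borel K
  have : BorelSpace K := ⟨rfl⟩
  let μ : Measure K := Measure.haar
  have hint : ∀ f : K → ℂ, Continuous f → Integrable f μ := fun f hf =>
    hf.integrable_of_hasCompactSupport (HasCompactSupport.of_compactSpace f)
  let ψ : C(K, UnitAddTorus (Fin r)) :=
    ⟨fun k => (torusHomeomorph r).symm k,
      (torusHomeomorph r).symm.continuous.comp continuous_subtype_val⟩
  let ψ' : C(K, UnitAddTorus (Fin r)) :=
    ⟨fun k => (torusHomeomorph r).symm (t * k),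
      (torusHomeomorph r).symm.continuous.comp (continuous_const.mul continuous_subtype_val)⟩
  -- the functions on which the two integrals agree
  let S : Submodule ℂ C(UnitAddTorus (Fin r), ℂ) :=
    { carrier := {f | ∫ k, f (ψ k) ∂μ = ∫ k, f (ψ' k) ∂μ}
      zero_mem' := by simp
      add_mem' := by
        intro f g hf hg
        simp only [Set.mem_ofPred_eq, ContinuousMap.add_apply] at hf hg ⊢
        rw [integral_add, integral_add, hf, hg]
        all_goals exact hint _ (by fun_prop)
      smul_mem' := by
        intro c f hf
        simp only [Set.mem_ofPred_eq, ContinuousMap.smul_apply] at hf ⊢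
        rw [integral_smul, integral_smul, hf] }
  have hcont : ∀ φ : C(K, UnitAddTorus (Fin r)),
      Continuous fun f : C(UnitAddTorus (Fin r), ℂ) => ∫ k, f (φ k) ∂μ := by
    intro φ
    refine (LipschitzWith.of_dist_le_mul (K := ⟨μ.real Set.univ, measureReal_nonneg⟩)
      fun f f' => ?_).continuous
    rw [dist_eq_norm, dist_eq_norm, ← integral_sub (hint _ (by fun_prop)) (hint _ (by fun_prop)),
      mul_comm]
    exact norm_integral_le_of_norm_le_const
      (Filter.Eventually.of_forall fun k => (f - f').norm_coe_le_norm (φ k))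
  have hS : IsClosed (S : Set C(UnitAddTorus (Fin r), ℂ)) :=
    isClosed_eq (hcont ψ) (hcont ψ')
  have hchar : ∀ n : Fin r → ℤ, UnitAddTorus.mFourier n ∈ S := by
    intro n
    change ∫ k, UnitAddTorus.mFourier n ((torusHomeomorph r).symm k) ∂μ =
      ∫ k : K, UnitAddTorus.mFourier n ((torusHomeomorph r).symm (t * k)) ∂μ
    simp only [mFourier_torusHomeomorph_symm, map_mul, Circle.coe_mul]
    by_cases hn : n ∈ ann K
    · simp only [ht n hn, Circle.coe_one, one_mul]
    · -- a nontrivial character of `K` has integral zero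
      have h0 : ∫ k : K, (character n k : ℂ) ∂μ = 0 := by
        rw [mem_ann_iff] at hn
        push Not at hn
        obtain ⟨k₀, hk₀, hne⟩ := hn
        have h1 := integral_mul_left_eq_self (μ := μ) (fun k : K => (character n k : ℂ)) ⟨k₀, hk₀⟩
        simp only [Subgroup.coe_mul, map_mul, Circle.coe_mul] at h1
        rw [integral_const_mul] at h1
        by_contra h0
        exact hne (Circle.ext (by simpa using (mul_eq_right₀ h0).1 h1))
      rw [integral_const_mul, h0, mul_zero]
  have htop : S = ⊤ := by
    rw [eq_top_iff, ← UnitAddTorus.span_mFourier_closure_eq_top]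
    exact Submodule.topologicalClosure_minimal _
      (Submodule.span_le.2 (Set.range_subset_iff.2 hchar)) hS
  let g : Torus r → ℝ := fun s => Metric.infDist s (K : Set (Torus r))
  have hg : Continuous g := Metric.continuous_infDist_pt _
  let f : C(UnitAddTorus (Fin r), ℂ) :=
    ⟨fun x => (g (torusHomeomorph r x) : ℂ),
      Complex.continuous_ofReal.comp (hg.comp (torusHomeomorph r).continuous)⟩
  have hf : f ∈ S := htop ▸ Submodule.mem_top
  have hf' : ∫ k : K, ((g k : ℝ) : ℂ) ∂μ = ∫ k : K, ((g (t * k) : ℝ) : ℂ) ∂μ := by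
    have := hf
    change ∫ k : K, ((g (torusHomeomorph r ((torusHomeomorph r).symm k)) : ℝ) : ℂ) ∂μ =
      ∫ k : K, ((g (torusHomeomorph r ((torusHomeomorph r).symm (t * k))) : ℝ) : ℂ) ∂μ at this
    simpa only [Homeomorph.apply_symm_apply] using this
  replace hf' : ∫ k : K, g k ∂μ = ∫ k : K, g (t * k) ∂μ := by
    have e₁ := integral_ofReal (μ := μ) (𝕜 := ℂ) (f := fun k : K => g k)
    have e₂ := integral_ofReal (μ := μ) (𝕜 := ℂ) (f := fun k : K => g (t * k))
    exact Complex.ofReal_injective (e₁.symm.trans (hf'.trans e₂))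
  have h0 : ∫ k : K, g k ∂μ = 0 := by
    rw [← integral_zero K ℝ (μ := μ)]
    exact integral_congr_ae (Filter.Eventually.of_forall fun k =>
      Metric.infDist_zero_of_mem k.2)
  have hpos : 0 < ∫ k : K, g (t * k) ∂μ := by
    refine Continuous.integral_pos_of_hasCompactSupport_nonneg_nonzero (x := (1 : K))
      (hg.comp (continuous_const.mul continuous_subtype_val))
      (HasCompactSupport.of_compactSpace _) (fun _ => Metric.infDist_nonneg) ?_
    have : 0 < Metric.infDist t (K : Set (Torus r)) :=
      (hK.notMem_iff_infDist_pos ⟨1, K.one_mem⟩).1 htK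
    simpa [g] using this.ne'
  rw [← hf', h0] at hpos
  exact lt_irrefl _ hpos

/-- The group of the characters of `T / K` is saturated if `K` is connected: if a multiple of a
character is trivial on `K`, its image is a connected set of roots of unity. -/
theorem ConnSub.mem_ann_of_zsmul_mem (K : ConnSub r) {n : Fin r → ℤ} {a : ℤ} (ha : a ≠ 0)
    (h : a • n ∈ ann K.toSubgroup) : n ∈ ann K.toSubgroup := by
  have hfin : {z : Circle | z ^ a = 1}.Finite := by
    have h1 : {z : ℂ | z ^ a.natAbs = 1}.Finite := by
      refine (Polynomial.nthRoots a.natAbs (1 : ℂ)).toFinset.finite_toSet.subset fun z hz => ?_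
      simpa [Polynomial.mem_nthRoots (Int.natAbs_pos.2 ha)] using hz
    have h2 : ∀ z : Circle, z ^ a = 1 → (z : ℂ) ^ a.natAbs = 1 := fun z hz => by
      have hz' : z ^ a.natAbs = 1 := by
        rcases Int.natAbs_eq a with e | e
        · rw [← zpow_natCast, ← e]
          exact hz
        · rw [← zpow_natCast, ← inv_eq_one, ← zpow_neg, ← e]
          exact hz
      rw [← Circle.coe_pow, hz', Circle.coe_one]
    exact (h1.preimage (f := ((↑) : Circle → ℂ)) Circle.coe_injective.injOn).subset h2
  have hpre : IsPreconnected (character n '' (K.toSubgroup : Set (Torus r))) :=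
    K.isConnected.isPreconnected.image _ (continuous_character n).continuousOn
  have hsub : character n '' (K.toSubgroup : Set (Torus r)) ⊆ {z : Circle | z ^ a = 1} := by
    rintro _ ⟨t, ht, rfl⟩
    have e : character n t ^ a = character (a • n) t := by
      change (∏ i, t i ^ n i) ^ a = ∏ i, t i ^ (a * n i)
      rw [← Finset.prod_zpow]
      exact Finset.prod_congr rfl fun i _ => by rw [← zpow_mul, mul_comm]
    exact e.trans (h t ht)
  have hs : (character n '' (K.toSubgroup : Set (Torus r))).Subsingleton := by
    by_contra hns
    exact hpre.infinite_of_nontrivial (Set.not_subsingleton_iff.1 hns) (hfin.subset hsub)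
  intro t ht
  exact hs ⟨t, ht, rfl⟩ ⟨1, K.toSubgroup.one_mem, map_one _⟩

/-- Nested connected closed subgroups of the same dimension are equal: the map of character groups
modulo the characters of the quotients is surjective, with torsion kernel as the ranks agree, so
each character that is trivial on `K` has a nonzero multiple that is trivial on `H`. -/
theorem ConnSub.eq_of_le_of_dim_eq {K H : ConnSub r} (h : K ≤ H) (hd : K.dim = H.dim) : K = H := by
  refine le_antisymm h fun t ht => mem_of_forall_character_eq_one K.isClosed fun n hn => ?_
  let f : ((Fin r → ℤ) ⧸ ann H.toSubgroup) →ₗ[ℤ] ((Fin r → ℤ) ⧸ ann K.toSubgroup) :=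
    (QuotientAddGroup.map _ _ (AddMonoidHom.id _) (ann_anti h)).toIntLinearMap
  have hsurj : Function.Surjective f := fun x => by
    obtain ⟨x, rfl⟩ := QuotientAddGroup.mk_surjective x
    exact ⟨QuotientAddGroup.mk x, rfl⟩
  have hfinite : Module.Finite ℤ ((Fin r → ℤ) ⧸ ann H.toSubgroup) :=
    Module.Finite.of_surjective (QuotientAddGroup.mk' (ann H.toSubgroup)).toIntLinearMap
      (QuotientAddGroup.mk'_surjective _)
  have hrank := Submodule.finrank_quotient_add_finrank (LinearMap.ker f)
  rw [(f.quotKerEquivOfSurjective hsurj).finrank_eq] at hrank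
  have hker : Module.finrank ℤ (LinearMap.ker f) = 0 := by
    unfold ConnSub.dim at hd
    omega
  rw [Module.finrank_eq_zero_iff] at hker
  have hmem : (QuotientAddGroup.mk n : (Fin r → ℤ) ⧸ ann H.toSubgroup) ∈ LinearMap.ker f :=
    (QuotientAddGroup.eq_zero_iff n).2 hn
  obtain ⟨a, ha, e⟩ := hker ⟨_, hmem⟩
  have e' : a • n ∈ ann H.toSubgroup :=
    (QuotientAddGroup.eq_zero_iff (a • n)).1 (congrArg Subtype.val e)
  exact H.mem_ann_of_zsmul_mem ha e' t ht

theorem ConnSub.dim_le (K : ConnSub r) : K.dim ≤ r := by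
  have := LinearMap.finrank_le_finrank_of_surjective
    (f := (QuotientAddGroup.mk' (ann K.toSubgroup)).toIntLinearMap)
    (QuotientAddGroup.mk'_surjective _)
  rwa [Module.finrank_fin_fun] at this

end Duality

end TorusModel

namespace TorusModel

/-! ### Flags of connected subgroups -/

section Flags

variable {r : ℕ}

/-- The terms of a flag are distinguished by their dimensions. -/
theorem dim_injOn (E : FinFlag (ConnSub r)) {K H : ConnSub r} (hK : K ∈ E.carrier)
    (hH : H ∈ E.carrier) (h : K.dim = H.dim) : K = H := by
  rcases E.chain.total hK hH with h' | h'
  exacts [ConnSub.eq_of_le_of_dim_eq h' h, (ConnSub.eq_of_le_of_dim_eq h' h.symm).symm]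

theorem mem_dims {E : FinFlag (ConnSub r)} {K : ConnSub r} (h : K ∈ E.carrier) :
    K.dim ∈ dims E := by
  classical exact Finset.mem_image_of_mem _ h

theorem dims_mono {E E' : FinFlag (ConnSub r)} (h : E ≤ E') : dims E ⊆ dims E' := by
  classical exact Finset.image_subset_image h

/-- The dimension vector of a flag of connected subgroups. -/
noncomputable def dimVec (E : FinFlag (ConnSub r)) : DimVec r :=
  ⟨dims E, ⟨_, mem_dims E.top_mem⟩, fun i hi => by
    classical
    obtain ⟨K, _, rfl⟩ := Finset.mem_image.1 hi
    exact K.dim_le⟩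

/-- A flag, as a flag of its own dimension vector. -/
noncomputable def selfFlag (E : FinFlag (ConnSub r)) : FlagOfDim (dimVec E) := ⟨E, rfl⟩

theorem dimVec_mono {E E' : FinFlag (ConnSub r)} (h : E ≤ E') : dimVec E ≤ dimVec E' := dims_mono h

/-- A flag has at most one subflag of a given dimension vector. -/
theorem FlagOfDim.res_eq {d d' : DimVec r} (h : d ≤ d') {E' : FlagOfDim d'} {E : FlagOfDim d}
    (hE : E.1 ≤ E'.1) : E'.res h = E := by
  classical
  refine Subtype.ext (FinFlag.ext (Finset.ext fun K => ?_))
  change K ∈ E'.1.carrier.filter (fun K => K.dim ∈ d.1) ↔ K ∈ E.1.carrier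
  have hd : K.dim ∈ d.1 ↔ K.dim ∈ dims E.1 := by rw [E.2]
  rw [Finset.mem_filter, hd]
  constructor
  · rintro ⟨hK, hd⟩
    obtain ⟨H, hH, e⟩ := Finset.mem_image.1 hd
    rwa [← dim_injOn E'.1 (hE hH) hK e]
  · exact fun hK => ⟨hE hK, mem_dims hK⟩

theorem FlagOfDim.res_res {d d' d'' : DimVec r} (h : d ≤ d') (h' : d' ≤ d'') (E : FlagOfDim d'') :
    (E.res h').res h = E.res (h.trans h') :=
  (FlagOfDim.res_eq _ ((FlagOfDim.res_le h _).trans (FlagOfDim.res_le h' _))).symm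

end Flags

/-! ### The factors of the iterated products -/

section Rings

variable {r : ℕ}

theorem IsHomogFrac.one : IsHomogFrac 0 (1 : Frac r) :=
  Or.inr ⟨1, 1, 0, 0, MvPolynomial.isHomogeneous_one _ _, MvPolynomial.isHomogeneous_one _ _,
    one_ne_zero, by simp, by simp⟩

theorem IsHomogFrac.mul {m m' : ℤ} {q q' : Frac r} (h : IsHomogFrac m q)
    (h' : IsHomogFrac m' q') : IsHomogFrac (m + m') (q * q') := by
  rcases h with rfl | ⟨p, s, k, l, hp, hs, hs0, hq, hm⟩
  · exact Or.inl (zero_mul _)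
  rcases h' with rfl | ⟨p', s', k', l', hp', hs', hs0', hq', hm'⟩
  · exact Or.inl (mul_zero _)
  · refine Or.inr ⟨p * p', s * s', k + k', l + l', hp.mul hp', hs.mul hs', mul_ne_zero hs0 hs0', ?_,
      by push_cast; omega⟩
    simp only [map_mul, ← hq, ← hq']
    ring

/-- The elements of a graded ring of functions are sums of homogeneous elements. -/
theorem gr_induction {I : Type} {A : Subring (I → Frac r)} {C : gr A → Prop}
    (homog : ∀ (m : ℤ) (a : gr A), a ∈ grHomog A m → C a) (add : ∀ a b, C a → C b → C (a + b))
    (a : gr A) : C a := by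
  let S : Submonoid (I → Frac r) :=
    { carrier := {a | a ∈ A ∧ ∃ m, ∀ i, IsHomogFrac m (a i)}
      one_mem' := ⟨A.one_mem, 0, fun _ => IsHomogFrac.one⟩
      mul_mem' := fun ⟨ha, m, hm⟩ ⟨hb, n, hn⟩ =>
        ⟨A.mul_mem ha hb, m + n, fun i => (hm i).mul (hn i)⟩ }
  have hle : (S : Set (I → Frac r)) ⊆ gr A := Subring.subset_closure
  have hcl : AddSubgroup.closure (S : Set (I → Frac r)) ≤ (gr A).toAddSubgroup :=
    (AddSubgroup.closure_le _).2 hle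
  have ha : a.1 ∈ AddSubgroup.closure (S : Set (I → Frac r)) := by
    have h := Subring.mem_closure_iff.1 a.2
    rwa [show {a | a ∈ A ∧ ∃ m, ∀ i, IsHomogFrac m (a i)} = (S : Set (I → Frac r)) from rfl,
      Submonoid.closure_eq] at h
  have key : ∀ b (hb : b ∈ AddSubgroup.closure (S : Set (I → Frac r))), C ⟨b, hcl hb⟩ := by
    intro b hb
    induction hb using AddSubgroup.closure_induction'' with
    | zero => exact homog 0 _ fun _ => Or.inl rfl
    | mem b hb =>
      obtain ⟨_, m, hm⟩ := hb
      exact homog m _ hm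
    | neg_mem b hb =>
      obtain ⟨_, m, hm⟩ := hb
      exact homog m _ fun i => (hm i).neg
    | add b b' _ _ h h' => exact add _ _ h h'
  exact key a.1 ha

theorem Rdf_induction {d : DimVec r} {C : (Rdf r).ring d → Prop}
    (homog : ∀ (m : ℤ) (a : (Rdf r).ring d), a ∈ (Rdf r).homog d m → C a)
    (add : ∀ a b, C a → C b → C (a + b)) (a : (Rdf r).ring d) : C a :=
  gr_induction homog add a

theorem component_map {d d' : DimVec r} (h : d ≤ d') (E : FlagOfDim d') (a : (Rdf r).ring d) :
    component E ((Rdf r).map h a) = (Rcf r).map (E.res_le h) (component (E.res h) a) :=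
  rfl

theorem component_homog {d : DimVec r} (E : FlagOfDim d) {m : ℤ} {a : (Rdf r).ring d}
    (ha : a ∈ (Rdf r).homog d m) : component E a ∈ (Rcf r).homog E.1 m :=
  fun x => ha (E.incl x)

open Classical in
/-- The extension of a function on the factors that belong to the flag `E` to all factors of the
iterated product, by zero. -/
noncomputable def extendZero {d : DimVec r} (E : FlagOfDim d)
    (b : FinOver E.1.bot.toSubgroup → Frac r) (x : DimIndex d) : Frac r :=
  if h : x.1.1 = E.1 then b ⟨x.1.2, h ▸ x.2.2⟩ else 0

theorem extendZero_incl {d : DimVec r} (E : FlagOfDim d)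
    (b : FinOver E.1.bot.toSubgroup → Frac r) (x : FinOver E.1.bot.toSubgroup) :
    extendZero E b (E.incl x) = b x :=
  dif_pos rfl

theorem extendZero_of_ne {d : DimVec r} {E : FlagOfDim d}
    (b : FinOver E.1.bot.toSubgroup → Frac r) {x : DimIndex d} (h : x.1.1 ≠ E.1) :
    extendZero E b x = 0 :=
  dif_neg h

theorem extendZero_mem_ringD {d : DimVec r} (E : FlagOfDim d)
    {b : FinOver E.1.bot.toSubgroup → Frac r} (hb : b ∈ ringC E.1.toInterval) :
    extendZero E b ∈ ringD d := by
  classical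
  obtain ⟨_, ⟨V, hV, rfl⟩, hVb⟩ := hb
  -- the denominator of `b` is inverted at the first stage
  refine ⟨_, ⟨fun _ H => if H = E.1.top then V else 0, fun S H => ?_, rfl⟩, fun x => ?_⟩
  · dsimp only
    split_ifs with h
    · rw [h]
      exact hV
    · exact fun _ h => absurd h (Multiset.notMem_zero _)
  · by_cases hx : x.1.1 = E.1
    · obtain ⟨y, rfl⟩ : ∃ y, x = E.incl y :=
        ⟨⟨x.1.2, hx ▸ x.2.2⟩, Subtype.ext (Prod.ext hx rfl)⟩
      rw [Pi.mul_apply, extendZero_incl]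
      have e : ∏ H ∈ E.1.carrier, eulerFrac (if H = E.1.top then V else 0) y.1 =
          eulerFrac V y.1 := by
        rw [Finset.prod_eq_single E.1.top, if_pos rfl]
        · intro H _ hH
          rw [if_neg hH, eulerFrac_zero]
        · exact fun h => absurd E.1.top_mem h
      change (∏ H ∈ E.1.carrier, eulerFrac (if H = E.1.top then V else 0) y.1) * b y ∈ _
      rw [e]
      exact hVb y
    · rw [Pi.mul_apply, extendZero_of_ne _ hx, mul_zero]
      exact Subring.zero_mem _

theorem extendZero_mem_gr {d : DimVec r} (E : FlagOfDim d)
    {b : FinOver E.1.bot.toSubgroup → Frac r} (hb : b ∈ gr (ringC E.1.toInterval)) :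
    extendZero E b ∈ gr (ringD d) := by
  have hhom : ∀ (m : ℤ) (b : FinOver E.1.bot.toSubgroup → Frac r), (∀ i, IsHomogFrac m (b i)) →
      ∀ x, IsHomogFrac m (extendZero E b x) := by
    intro m b hm x
    unfold extendZero
    split_ifs with h
    · exact hm _
    · exact Or.inl rfl
  have hgen : ∀ b ∈ ringC E.1.toInterval, (∃ m, ∀ i, IsHomogFrac m (b i)) →
      extendZero E b ∈ gr (ringD d) := fun b hb ⟨m, hm⟩ =>
    Subring.subset_closure ⟨extendZero_mem_ringD E hb, m, hhom m b hm⟩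
  induction hb using Subring.closure_induction with
  | mem b hb => exact hgen b hb.1 hb.2
  | zero => exact hgen 0 (Subring.zero_mem _) ⟨0, fun _ => Or.inl rfl⟩
  | one => exact hgen 1 (Subring.one_mem _) ⟨0, fun _ => IsHomogFrac.one⟩
  | add b b' _ _ h h' =>
    convert Subring.add_mem _ h h' using 1
    funext x
    simp only [Pi.add_apply, extendZero]
    split_ifs
    exacts [rfl, (add_zero 0).symm]
  | neg b _ h =>
    convert Subring.neg_mem _ h using 1
    funext x
    simp only [Pi.neg_apply, extendZero]
    split_ifs
    exacts [rfl, neg_zero.symm]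
  | mul b b' _ _ h h' =>
    convert Subring.mul_mem _ h h' using 1
    funext x
    simp only [Pi.mul_apply, extendZero]
    split_ifs
    exacts [rfl, (mul_zero 0).symm]

/-- The ring `R_c^f(E)` is a direct factor of the ring `R_d^f(d)`. -/
theorem exists_component_eq {d : DimVec r} (E : FlagOfDim d) (b : (Rcf r).ring E.1) :
    ∃ a : (Rdf r).ring d, component E a = b ∧ ∀ E', E' ≠ E → component E' a = 0 :=
  ⟨⟨extendZero E b.1, extendZero_mem_gr E b.2⟩,
    Subtype.ext (funext fun x => extendZero_incl E b.1 x),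
    fun _ h => Subtype.ext (funext fun _ => extendZero_of_ne b.1 fun e => h (Subtype.ext e))⟩

theorem component_surjective {d : DimVec r} (E : FlagOfDim d) :
    Function.Surjective (component E) := fun b =>
  (exists_component_eq E b).imp fun _ h => h.1

end Rings

end TorusModel

namespace TorusModel

/-! ### The `p`-product of a module over `R_c^f` -/

section Families

variable {r : ℕ}

/-- The product of the values of `N` at the flags of dimension vector `d`, a module over `R_d^f(d)`
through its projections to the rings `R_c^f(E)`. -/
def Family (N : GrMod (Rcf r)) (d : DimVec r) : Type := ∀ E : FlagOfDim d, N.obj E.1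

variable {N N' : GrMod (Rcf r)} {d d' d'' : DimVec r}

namespace Family

noncomputable instance : AddCommGroup (Family N d) :=
  inferInstanceAs (AddCommGroup (∀ E : FlagOfDim d, N.obj E.1))

noncomputable instance : Module ((Rdf r).ring d) (Family N d) where
  smul a x := fun E => component E a • x E
  one_smul x := funext fun E => by
    change component E 1 • x E = x E
    rw [map_one, one_smul]
  mul_smul a b x := funext fun E => by
    change component E (a * b) • x E = component E a • component E b • x E
    rw [map_mul, mul_smul]
  smul_zero a := funext fun E => smul_zero (component E a)
  smul_add a x y := funext fun E => smul_add (component E a) (x E) (y E)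
  add_smul a b x := funext fun E => by
    change component E (a + b) • x E = component E a • x E + component E b • x E
    rw [map_add, add_smul]
  zero_smul x := funext fun E => by
    change component E 0 • x E = 0
    rw [map_zero, zero_smul]

theorem smul_apply (a : (Rdf r).ring d) (x : Family N d) (E : FlagOfDim d) :
    (a • x) E = component E a • x E := rfl

theorem add_apply (x y : Family N d) (E : FlagOfDim d) : (x + y) E = x E + y E := rfl

theorem zero_apply (E : FlagOfDim d) : (0 : Family N d) E = 0 := rfl

/-- The image of a family at a larger dimension vector. -/
noncomputable def push (h : d ≤ d') : Family N d →ₛₗ[(Rdf r).map h] Family N d' where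
  toFun x := pushFamily N h x
  map_add' x y := funext fun E => map_add (N.map (E.res_le h)) (x (E.res h)) (y (E.res h))
  map_smul' a x := funext fun E => by
    change N.map (E.res_le h) (component (E.res h) a • x (E.res h)) =
      component E ((Rdf r).map h a) • N.map (E.res_le h) (x (E.res h))
    rw [LinearMap.map_smulₛₗ, component_map]

theorem push_apply (h : d ≤ d') (x : Family N d) (E : FlagOfDim d') :
    push h x E = N.map (E.res_le h) (x (E.res h)) := rfl

theorem map_congr (x : Family N d) {E₁ E₂ : FlagOfDim d} (e : E₁ = E₂) {G : FinFlag (ConnSub r)}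
    (h₁ : E₁.1 ≤ G) (h₂ : E₂.1 ≤ G) : N.map h₁ (x E₁) = N.map h₂ (x E₂) := by
  subst e
  rfl

theorem push_push (h : d ≤ d') (h' : d' ≤ d'') (x : Family N d) :
    push h' (push h x) = push (h.trans h') x := funext fun E => by
  rw [push_apply, push_apply, push_apply, ← N.map_comp]
  exact map_congr x (FlagOfDim.res_res h h' E) _ _

theorem push_refl (x : Family N d) : push (le_refl d) x = x := funext fun E => by
  have e : E.res (le_refl d) = E := FlagOfDim.res_eq _ le_rfl
  rw [push_apply, map_congr x e (E.res_le _) le_rfl, N.map_id]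

/-- The map of families induced by linear maps of the values. -/
noncomputable def mapValues (f : ∀ E, N.obj E →ₗ[(Rcf r).ring E] N'.obj E) :
    Family N d →ₗ[(Rdf r).ring d] Family N' d where
  toFun x E := f E.1 (x E)
  map_add' x y := funext fun E => map_add (f E.1) (x E) (y E)
  map_smul' a x := funext fun E => map_smul (f E.1) (component E a) (x E)

end Family

open Family

/-- Extended families, with sums over arbitrary finite types. -/
theorem isExtendedFamily_iff {x : Family N d} : IsExtendedFamily N x ↔
    ∀ H : ConnSub r, ∃ (ι : Type) (_ : Fintype ι) (a : ι → (Rdf r).ring d)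
      (m : ι → N.obj (FinFlag.single H)), ∀ (E : FlagOfDim d) (h : E.1.top = H),
        x E = ∑ i, component E (a i) • N.map (single_le_of_top_eq h) (m i) := by
  constructor
  · intro hx H
    obtain ⟨k, a, m, h⟩ := hx H
    exact ⟨Fin k, inferInstance, a, m, h⟩
  · intro hx H
    obtain ⟨ι, _, a, m, h⟩ := hx H
    refine ⟨Fintype.card ι, a ∘ (Fintype.equivFin ι).symm, m ∘ (Fintype.equivFin ι).symm,
      fun E hE => ?_⟩
    rw [h E hE]
    exact (Equiv.sum_comp (Fintype.equivFin ι).symm fun i =>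
      component E (a i) • N.map (single_le_of_top_eq hE) (m i)).symm

variable (N d) in
/-- The extended families form a submodule of the product. -/
noncomputable def extendedFamilies : Submodule ((Rdf r).ring d) (Family N d) where
  carrier := {x | IsExtendedFamily N x}
  zero_mem' := isExtendedFamily_iff.2 fun H =>
    ⟨Empty, inferInstance, Empty.elim, fun i => i.elim, fun E h => by simp [zero_apply]⟩
  add_mem' {x y} hx hy := isExtendedFamily_iff.2 fun H => by
    obtain ⟨ι, _, a, m, h⟩ := isExtendedFamily_iff.1 hx H
    obtain ⟨ι', _, a', m', h'⟩ := isExtendedFamily_iff.1 hy H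
    refine ⟨ι ⊕ ι', inferInstance, Sum.elim a a', Sum.elim m m', fun E hE => ?_⟩
    rw [Fintype.sum_sum_type, add_apply, h E hE, h' E hE]
    rfl
  smul_mem' b x hx := isExtendedFamily_iff.2 fun H => by
    obtain ⟨ι, _, a, m, h⟩ := isExtendedFamily_iff.1 hx H
    refine ⟨ι, inferInstance, fun i => b * a i, m, fun E hE => ?_⟩
    rw [smul_apply, h E hE, Finset.smul_sum]
    exact Finset.sum_congr rfl fun i _ => by rw [map_mul, mul_smul]

theorem mapValues_mem_extendedFamilies (f : ∀ E, N.obj E →ₗ[(Rcf r).ring E] N'.obj E)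
    (hf : ∀ {E E' : FinFlag (ConnSub r)} (h : E ≤ E') (x : N.obj E),
      f E' (N.map h x) = N'.map h (f E x)) {x : Family N d} (hx : x ∈ extendedFamilies N d) :
    mapValues f x ∈ extendedFamilies N' d := isExtendedFamily_iff.2 fun H => by
  obtain ⟨ι, _, a, m, h⟩ := isExtendedFamily_iff.1 hx H
  refine ⟨ι, inferInstance, a, fun i => f _ (m i), fun E hE => ?_⟩
  change f E.1 (x E) = _
  rw [h E hE, map_sum]
  exact Finset.sum_congr rfl fun i _ => by rw [map_smul, hf]

variable (N d) in
/-- The homogeneous families whose images at all larger dimension vectors are extended. -/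
noncomputable def homogFamilies (n : ℤ) : AddSubgroup (Family N d) where
  carrier := {x | (∀ E, x E ∈ N.deg E.1 n) ∧ ∀ (d' : DimVec r) (h : d ≤ d'),
    push h x ∈ extendedFamilies N d'}
  zero_mem' := ⟨fun _ => AddSubgroup.zero_mem _, fun d' h => by
    rw [map_zero]
    exact Submodule.zero_mem _⟩
  add_mem' := fun ⟨hx, hx'⟩ ⟨hy, hy'⟩ =>
    ⟨fun E => AddSubgroup.add_mem _ (hx E) (hy E), fun d' h => by
      rw [map_add]
      exact Submodule.add_mem _ (hx' d' h) (hy' d' h)⟩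
  neg_mem' := fun ⟨hx, hx'⟩ => ⟨fun E => AddSubgroup.neg_mem _ (hx E), fun d' h => by
    rw [map_neg]
    exact Submodule.neg_mem _ (hx' d' h)⟩

theorem push_mem_homogFamilies (h : d ≤ d') {n : ℤ} {x : Family N d} (hx : x ∈ homogFamilies N d n) :
    push h x ∈ homogFamilies N d' n :=
  ⟨fun E => N.map_deg _ n _ (hx.1 _), fun d'' h' => by
    rw [push_push]
    exact hx.2 d'' _⟩

theorem smul_mem_homogFamilies {m n : ℤ} {a : (Rdf r).ring d} (ha : a ∈ (Rdf r).homog d m)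
    {x : Family N d} (hx : x ∈ homogFamilies N d n) : a • x ∈ homogFamilies N d (n + 2 * m) :=
  ⟨fun E => N.smul_mem _ _ _ _ _ (component_homog E ha) (hx.1 E), fun d' h => by
    rw [LinearMap.map_smulₛₗ]
    exact Submodule.smul_mem _ _ (hx.2 d' h)⟩

theorem mapValues_mem_homogFamilies (f : ∀ E, N.obj E →ₗ[(Rcf r).ring E] N'.obj E) (k : ℤ)
    (hdeg : ∀ E n, ∀ x ∈ N.deg E n, f E x ∈ N'.deg E (n + k))
    (hf : ∀ {E E' : FinFlag (ConnSub r)} (h : E ≤ E') (x : N.obj E),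
      f E' (N.map h x) = N'.map h (f E x)) {n : ℤ} {x : Family N d}
    (hx : x ∈ homogFamilies N d n) : mapValues f x ∈ homogFamilies N' d (n + k) :=
  ⟨fun E => hdeg _ _ _ (hx.1 E), fun d' h => by
    have e : push h (mapValues f x) = mapValues f (push h x) :=
      funext fun E => (hf (E.res_le h) (x (E.res h))).symm
    rw [e]
    exact mapValues_mem_extendedFamilies f hf (hx.2 d' h)⟩

variable (N d) in
/-- The value of the `p`-product of `N` at `d`: the finite sums of the homogeneous families whose
images at all larger dimension vectors are extended. -/
noncomputable def pProductObj : Submodule ((Rdf r).ring d) (Family N d) where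
  __ := (⨆ n, homogFamilies N d n : AddSubgroup (Family N d))
  smul_mem' a x hx := by
    change x ∈ ⨆ n, homogFamilies N d n at hx
    change a • x ∈ ⨆ n, homogFamilies N d n
    refine Rdf_induction (C := fun a => a • x ∈ ⨆ n, homogFamilies N d n) ?_ ?_ a
    · intro m a ha
      refine AddSubgroup.iSup_induction (C := fun x => a • x ∈ ⨆ n, homogFamilies N d n) _ hx
        ?_ ?_ ?_
      · exact fun n x hx => AddSubgroup.mem_iSup_of_mem _ (smul_mem_homogFamilies ha hx)
      · rw [smul_zero]
        exact AddSubgroup.zero_mem _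
      · intro x y hx hy
        rw [smul_add]
        exact AddSubgroup.add_mem _ hx hy
    · intro a b ha hb
      rw [add_smul]
      exact AddSubgroup.add_mem _ ha hb

theorem mem_pProductObj {n : ℤ} {x : Family N d} (hx : x ∈ homogFamilies N d n) :
    x ∈ pProductObj N d :=
  AddSubgroup.mem_iSup_of_mem (S := homogFamilies N d) n hx

theorem pProductObj_induction {C : Family N d → Prop} {x : Family N d} (hx : x ∈ pProductObj N d)
    (homog : ∀ n, ∀ x ∈ homogFamilies N d n, C x) (zero : C 0)
    (add : ∀ x y, C x → C y → C (x + y)) : C x :=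
  AddSubgroup.iSup_induction (C := C) (homogFamilies N d) hx homog zero add

theorem push_mem_pProductObj (h : d ≤ d') {x : Family N d} (hx : x ∈ pProductObj N d) :
    push h x ∈ pProductObj N d' := by
  refine pProductObj_induction (C := fun x => push h x ∈ pProductObj N d') hx
    (fun n x hx => mem_pProductObj (push_mem_homogFamilies h hx)) ?_ fun x y hx hy => ?_
  · rw [map_zero]
    exact Submodule.zero_mem _
  · rw [map_add]
    exact Submodule.add_mem _ hx hy

theorem mapValues_mem_pProductObj (f : ∀ E, N.obj E →ₗ[(Rcf r).ring E] N'.obj E) (k : ℤ)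
    (hdeg : ∀ E n, ∀ x ∈ N.deg E n, f E x ∈ N'.deg E (n + k))
    (hf : ∀ {E E' : FinFlag (ConnSub r)} (h : E ≤ E') (x : N.obj E),
      f E' (N.map h x) = N'.map h (f E x)) {x : Family N d}
    (hx : x ∈ pProductObj N d) : mapValues f x ∈ pProductObj N' d := by
  refine pProductObj_induction (C := fun x => mapValues f x ∈ pProductObj N' d) hx
    (fun n x hx => mem_pProductObj (mapValues_mem_homogFamilies f k hdeg hf hx)) ?_
    fun x y hx hy => ?_
  · rw [map_zero]
    exact Submodule.zero_mem _
  · rw [map_add]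
    exact Submodule.add_mem _ hx hy

/-- The `p`-product of a module over `R_c^f`, graded by the homogeneous families. -/
noncomputable def pProduct (N : GrMod (Rcf r)) : GrMod (Rdf r) where
  obj d := pProductObj N d
  deg d n := (homogFamilies N d n).comap (pProductObj N d).subtype.toAddMonoidHom
  internal d := by
    refine isInternal_of_components _ (pProductObj N d).subtype.toAddMonoidHom
      (pProductObj N d).injective_subtype
      (fun n => { toFun := fun x E => N.proj E.1 n (x.1 E)
                  map_zero' := funext fun E => map_zero _
                  map_add' := fun x y => funext fun E => map_add _ _ _ }) ?_ ?_ ?_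
    · exact fun n x hx => funext fun E => component'_of_mem (N.internal E.1) (hx.1 E)
    · exact fun m n hmn x hx => funext fun E => component'_of_mem_ne (N.internal E.1) hmn (hx.1 E)
    · rintro ⟨x, hx⟩
      refine AddSubgroup.iSup_induction' (C := fun x hx => (⟨x, hx⟩ : pProductObj N d) ∈ _)
        (homogFamilies N d) ?_ ?_ ?_ hx
      · exact fun n x hx => AddSubgroup.mem_iSup_of_mem n hx
      · exact AddSubgroup.zero_mem _
      · exact fun x y _ _ hx hy => AddSubgroup.add_mem _ hx hy
  smul_mem d m n a x ha hx := smul_mem_homogFamilies ha hx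
  map h := ((push h).comp (pProductObj N _).subtype).codRestrict _ fun x =>
    push_mem_pProductObj h x.2
  map_deg h n x hx := push_mem_homogFamilies h hx
  map_id d x := Subtype.ext (push_refl x.1)
  map_comp h h' x := Subtype.ext (push_push h h' x.1).symm

end Families

end TorusModel

namespace TorusModel

open Family

/-! ### Families concentrated at one flag -/

section Single

variable {r : ℕ} {N : GrMod (Rcf r)} {d : DimVec r}

/-- The extendedness condition at a flag, with the largest term of the flag as a variable. -/
theorem IsQceFlags.isExtension_of_top_eq (hN : IsQceFlags N) {G : FinFlag (ConnSub r)}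
    {H : ConnSub r} (h : FinFlag.single H ≤ G) (hH : G.top = H) :
    IsExtension ((Rcf r).map h) (N.map h) := by
  subst hH
  exact (hN G).2

open Classical in
/-- The family with the value `y` at the flag `E` and zero elsewhere. -/
noncomputable def singleFamily (E : FlagOfDim d) (y : N.obj E.1) : Family N d := Pi.single E y

theorem singleFamily_self (E : FlagOfDim d) (y : N.obj E.1) : singleFamily E y E = y := by
  classical exact Pi.single_eq_same (M := fun E : FlagOfDim d => N.obj E.1) E y

theorem singleFamily_of_ne {E E' : FlagOfDim d} (h : E' ≠ E) (y : N.obj E.1) :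
    singleFamily E y E' = 0 := by
  classical exact Pi.single_eq_of_ne (M := fun E : FlagOfDim d => N.obj E.1) h y

/-- If `E` is a subflag of `E'`, the flag `G` obtained from `E` by adding the largest term of `E'` is
the smallest flag containing `E` with that largest term. -/
theorem exists_insert_top {E E' : FinFlag (ConnSub r)} (h : E ≤ E') :
    ∃ G : FinFlag (ConnSub r), E ≤ G ∧ G ≤ E' ∧ G.top = E'.top ∧
      ∀ E'' : FinFlag (ConnSub r), E ≤ E'' → E''.top = E'.top → G ≤ E'' := by
  classical
  have hsub : insert E'.top E.carrier ⊆ E'.carrier := Finset.insert_subset E'.top_mem h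
  let G : FinFlag (ConnSub r) :=
    ⟨insert E'.top E.carrier, Finset.insert_nonempty _ _, E'.chain.mono (Finset.coe_subset.2 hsub)⟩
  refine ⟨G, Finset.subset_insert _ _, hsub, ?_, fun E'' h1 h2 => ?_⟩
  · exact le_antisymm (E'.le_top (hsub G.top_mem)) (G.le_top (Finset.mem_insert_self _ _))
  · exact Finset.insert_subset (h2 ▸ E''.top_mem) h1

/-- For a quasi-coherent extended module all families concentrated at one flag `E` are extended,
also after passing to larger dimension vectors: at the flags with largest term `H` the value at `E`
is first extended from `N(H)` at the flag `E ∪ {H}`, and the coefficients used there are extended by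
zero to the other flags of the same dimension vector. -/
theorem push_singleFamily_mem (hN : IsQceFlags N) (E : FlagOfDim d) (y : N.obj E.1) {d' : DimVec r}
    (h : d ≤ d') :
    push h (singleFamily E y) ∈ extendedFamilies N d' := isExtendedFamily_iff.2 fun H => by
  have hzero : ∀ E' : FlagOfDim d', ¬ E.1 ≤ E'.1 → push h (singleFamily E y) E' = 0 := by
    intro E' hE'
    rw [push_apply, singleFamily_of_ne, map_zero]
    rintro rfl
    exact hE' (E'.res_le h)
  by_cases hex : ∃ E' : FlagOfDim d', E.1 ≤ E'.1 ∧ E'.1.top = H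
  swap
  · exact ⟨Empty, inferInstance, Empty.elim, fun i => i.elim, fun E' hE' => by
      rw [hzero E' fun hle => hex ⟨E', hle, hE'⟩]
      simp⟩
  obtain ⟨E₀, hE₀, hH⟩ := hex
  -- `G = E ∪ {H}`
  obtain ⟨G, hEG, hGE₀, hG, hGmin⟩ := exists_insert_top hE₀
  rw [hH] at hG hGmin
  have hg : dimVec G ≤ d' := fun i hi => by
    have := dims_mono hGE₀ hi
    rwa [E₀.2] at this
  have hHG : FinFlag.single H ≤ G := FinFlag.single_le (hG ▸ G.top_mem)
  obtain ⟨F, s, hs⟩ := (hN.isExtension_of_top_eq hHG hG).exists_sum (N.map hEG y)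
  choose a ha ha' using fun x => exists_component_eq (selfFlag G) (s x)
  refine ⟨F, inferInstance, fun x => (Rdf r).map hg (a x.1), fun x => x.1, fun E' hE' => ?_⟩
  simp only [component_map]
  by_cases hGE' : G ≤ E'.1
  · have e : E'.res hg = selfFlag G := FlagOfDim.res_eq hg hGE'
    have e' : E'.res h = E := FlagOfDim.res_eq h (hEG.trans hGE')
    have hc : ∀ x, (Rcf r).map (E'.res_le hg) (component (E'.res hg) (a x)) =
        (Rcf r).map hGE' (s x) := by
      intro x
      rw [← ha x]
      generalize E'.res_le hg = hle
      revert hle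
      rw [e]
      exact fun _ => rfl
    rw [push_apply, map_congr _ e' _ (hEG.trans hGE'), singleFamily_self, N.map_comp hEG hGE', hs,
      map_sum, Finset.sum_coe_sort F fun x =>
        (Rcf r).map (E'.res_le hg) (component (E'.res hg) (a x)) •
          N.map (single_le_of_top_eq hE') x]
    refine Finset.sum_congr rfl fun x _ => ?_
    rw [LinearMap.map_smulₛₗ, hc, ← N.map_comp]
  · have hne : E'.res hg ≠ selfFlag G := by
      intro e
      have := E'.res_le hg
      rw [e] at this
      exact hGE' this
    rw [hzero E' fun hle => hGE' (hGmin E'.1 hle hE')]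
    refine (Finset.sum_eq_zero fun x _ => ?_).symm
    rw [ha' _ _ hne, map_zero, zero_smul]

theorem singleFamily_mem_homogFamilies (hN : IsQceFlags N) (E : FlagOfDim d) {n : ℤ} {y : N.obj E.1}
    (hy : y ∈ N.deg E.1 n) : singleFamily E y ∈ homogFamilies N d n := by
  refine ⟨fun E' => ?_, fun d' h => push_singleFamily_mem hN E y h⟩
  by_cases h : E' = E
  · subst h
    rwa [singleFamily_self]
  · rw [singleFamily_of_ne h]
    exact AddSubgroup.zero_mem _

/-- The projection of the `p`-product onto the value at a flag. -/
noncomputable def pProductProj (N : GrMod (Rcf r)) (d : DimVec r) (E : FlagOfDim d) :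
    (pProduct N).obj d →ₛₗ[component E] N.obj E.1 where
  toFun x := x.1 E
  map_add' _ _ := rfl
  map_smul' _ _ := rfl

theorem pProductProj_surjective (hN : IsQceFlags N) (E : FlagOfDim d) :
    Function.Surjective (pProductProj N d E) := by
  intro y
  refine homogeneous_induction (C := fun y => ∃ x, pProductProj N d E x = y) (N.internal E.1) y
    ⟨0, map_zero _⟩ ?_ ?_
  · exact fun n y hy => ⟨⟨singleFamily E y,
      mem_pProductObj (singleFamily_mem_homogFamilies hN E hy)⟩, singleFamily_self E y⟩
  · rintro _ _ ⟨x, rfl⟩ ⟨x', rfl⟩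
    exact ⟨x + x', map_add _ _ _⟩

/-- The module of families constructed from `N` is a `p`-product of `N`. -/
theorem isPProduct_pProduct (hN : IsQceFlags N) : IsPProduct (pProduct N) N (pProductProj N) where
  map_deg d E n x hx := hx.1 E
  naturality h E x := rfl
  isExtension d E := by
    obtain ⟨e, he, he'⟩ := exists_component_eq E 1
    refine isExtension_of_surjective (component_surjective E) (pProductProj_surjective hN E) e he
      fun x hx => Subtype.ext (funext fun E' => ?_)
    change component E' e • x.1 E' = 0
    by_cases h : E' = E
    · subst h
      rw [show x.1 E' = 0 from hx, smul_zero]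
    · rw [he' E' h, zero_smul]
  injective d n x _ hx := Subtype.ext (funext hx)
  range d n x hx := by
    constructor
    · rintro ⟨y, hy, hyx⟩ d' h
      obtain rfl : y.1 = x := funext hyx
      exact hy.2 d' h
    · exact fun h => ⟨⟨x, mem_pProductObj ⟨hx, h⟩⟩, ⟨hx, h⟩, fun _ => rfl⟩

end Single

/-! ### The `p`-product as a functor -/

section Functor

variable {r : ℕ}

/-- The `p`-product of a differential module. -/
noncomputable def pProductDG (N : DGMod (Rcf r)) : DGMod (Rdf r) where
  toGrMod := pProduct N.toGrMod
  d _ := (mapValues N.d).restrict fun _ hx => mapValues_mem_pProductObj N.d 1 N.d_deg N.d_map hx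
  d_deg _ _ _ hx := mapValues_mem_homogFamilies N.d 1 N.d_deg N.d_map hx
  d_d _ x := Subtype.ext (funext fun E => N.d_d E.1 (x.1 E))
  d_map h x := Subtype.ext (funext fun E => N.d_map (E.res_le h) (x.1 (E.res h)))

/-- The `p`-product of a morphism. -/
noncomputable def pProductMap {N N' : DGMod (Rcf r)} (f : N ⟶ N') :
    pProductDG N ⟶ pProductDG N' where
  app d := ((mapValues f.app).comp (pProductObj N.toGrMod d).subtype).codRestrict
    (pProductObj N'.toGrMod d) fun x => mapValues_mem_pProductObj f.app 0
      (by simpa using f.app_deg) f.naturality x.2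
  app_deg d n x hx := by
    have := mapValues_mem_homogFamilies f.app 0 (by simpa using f.app_deg) f.naturality hx
    rwa [add_zero] at this
  naturality h x := Subtype.ext (funext fun E => f.naturality (E.res_le h) (x.1 (E.res h)))
  app_d d x := Subtype.ext (funext fun E => f.app_d E.1 (x.1 E))

variable (r) in
/-- The `p`-product as a functor from the quasi-coherent extended modules over `R_c^f` to the
product-quasi-coherent extended modules over `R_d^f`. -/
noncomputable def pProductFunctor (Z : Prop) :
    (dgProp (R := Rcf r) IsQceFlags Z).FullSubcategory ⥤
      (dgProp (R := Rdf r) IsPqce Z).FullSubcategory where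
  obj N := ⟨pProductDG N.obj,
    fun hZ d x => Subtype.ext (funext fun E => N.property.1 hZ E.1 (x.1 E)),
    N.obj.toGrMod, N.property.2, _, isPProduct_pProduct N.property.2⟩
  map f := ObjectProperty.homMk (pProductMap f.hom)

end Functor

end TorusModel

namespace TorusModel

open Family

/-! ### Descent from `p`-products to the values at flags -/

section Descent

variable {r : ℕ} {M M' : GrMod (Rdf r)} {N N' : GrMod (Rcf r)}
  {π : ∀ (d : DimVec r) (E : FlagOfDim d), M.obj d →ₛₗ[component E] N.obj E.1}
  {π' : ∀ (d : DimVec r) (E : FlagOfDim d), M'.obj d →ₛₗ[component E] N'.obj E.1}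

namespace IsPProduct

theorem surjective (h : IsPProduct M N π) {d : DimVec r} (E : FlagOfDim d) :
    Function.Surjective (π d E) := by
  intro y
  obtain ⟨F, s, rfl⟩ := (h.isExtension d E).exists_sum y
  choose a ha using fun x => component_surjective E (s x)
  refine ⟨∑ x ∈ F, a x • x, ?_⟩
  rw [map_sum]
  exact Finset.sum_congr rfl fun x _ => by rw [LinearMap.map_smulₛₗ, ha]

theorem map_proj (h : IsPProduct M N π) {d : DimVec r} (E : FlagOfDim d) (n : ℤ) (x : M.obj d) :
    π d E (M.proj d n x) = N.proj E.1 n (π d E x) := by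
  have := map_component' (M.internal d) (N.internal E.1) (π d E : M.obj d →+ N.obj E.1) 0
    (by simpa using h.map_deg d E) n x
  rw [add_zero] at this
  exact this.symm

theorem exists_homogeneous (h : IsPProduct M N π) {d : DimVec r} (E : FlagOfDim d) {n : ℤ}
    {y : N.obj E.1} (hy : y ∈ N.deg E.1 n) : ∃ x ∈ M.deg d n, π d E x = y := by
  obtain ⟨x, rfl⟩ := h.surjective E y
  exact ⟨M.proj d n x, component'_mem (M.internal d) n x,
    (h.map_proj E n x).trans (component'_of_mem (N.internal E.1) hy)⟩

/-- Natural linear maps of `p`-products that shift the degree by `k` descend to the values at the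
flags, by the universal property of extension of scalars. For `k = 0` this applies to morphisms, for
`k = 1` to differentials. -/
theorem exists_descent (h : IsPProduct M N π) (h' : IsPProduct M' N' π') (k : ℤ)
    (φ : ∀ d, M.obj d →ₗ[(Rdf r).ring d] M'.obj d)
    (hdeg : ∀ d n, ∀ x ∈ M.deg d n, φ d x ∈ M'.deg d (n + k))
    (hnat : ∀ {d d' : DimVec r} (hd : d ≤ d') (x : M.obj d), φ d' (M.map hd x) = M'.map hd (φ d x)) :
    ∃ ψ : ∀ E, N.obj E →ₗ[(Rcf r).ring E] N'.obj E,
      (∀ (d : DimVec r) (E : FlagOfDim d) (x : M.obj d), ψ E.1 (π d E x) = π' d E (φ d x)) ∧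
      (∀ E n, ∀ y ∈ N.deg E n, ψ E y ∈ N'.deg E (n + k)) ∧
      ∀ {E E' : FinFlag (ConnSub r)} (hE : E ≤ E') (y : N.obj E),
        ψ E' (N.map hE y) = N'.map hE (ψ E y) := by
  have hex : ∀ E, ∃ ψ : N.obj E →ₗ[(Rcf r).ring E] N'.obj E, ∀ x,
      ψ (π (dimVec E) (selfFlag E) x) = π' (dimVec E) (selfFlag E) (φ (dimVec E) x) := fun E =>
    (isExtension_iff_lift.1 (h.isExtension (dimVec E) (selfFlag E)) (N'.obj (selfFlag E).1)
      ((π' (dimVec E) (selfFlag E)).comp (φ (dimVec E)))).exists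
  choose ψ hψ using hex
  have hψ' : ∀ (d : DimVec r) (E : FlagOfDim d) (x : M.obj d),
      ψ E.1 (π d E x) = π' d E (φ d x) := by
    rintro d ⟨E, hE⟩ x
    obtain rfl : d = dimVec E := Subtype.ext hE.symm
    exact hψ E x
  refine ⟨ψ, hψ', fun E n y hy => ?_, fun {E E'} hE y => ?_⟩
  · obtain ⟨x, hx, rfl⟩ := h.exists_homogeneous (selfFlag E) hy
    have hmem := h'.map_deg _ (selfFlag E) _ _ (hdeg _ _ _ hx)
    rwa [← hψ' _ (selfFlag E)] at hmem
  · -- `E` is the restriction of `E'` to the dimension vector of `E`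
    obtain ⟨x, rfl⟩ := h.surjective (selfFlag E) y
    have e : (selfFlag E').res (dimVec_mono hE) = selfFlag E := FlagOfDim.res_eq _ hE
    have key : ∀ (G : FlagOfDim (dimVec E)) (hG : G.1 ≤ E'), (selfFlag E').res (dimVec_mono hE) = G →
        ψ E' (N.map hG (π _ G x)) = N'.map hG (ψ G.1 (π _ G x)) := by
      rintro _ hG rfl
      have h1 := h.naturality (dimVec_mono hE) (selfFlag E') x
      have h2 := h'.naturality (dimVec_mono hE) (selfFlag E') (φ _ x)
      have h3 := hψ' _ (selfFlag E') (M.map (dimVec_mono hE) x)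
      rw [h1, hnat, h2] at h3
      exact h3.trans (congrArg (N'.map hG) (hψ' _ _ x).symm)
    exact key (selfFlag E) hE e

theorem mem_homogFamilies (h : IsPProduct M N π) {d : DimVec r} {n : ℤ} {x : M.obj d}
    (hx : x ∈ M.deg d n) : (fun E => π d E x : Family N d) ∈ homogFamilies N d n :=
  ⟨fun E => h.map_deg d E n x hx, (h.range d n _ fun E => h.map_deg d E n x hx).1
    ⟨x, hx, fun _ => rfl⟩⟩

end IsPProduct

end Descent

/-! ### The equivalence of pqce modules and qce modules -/

section Equivalence

variable (r : ℕ) (Z : Prop)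

instance : (pProductFunctor r Z).Faithful where
  map_injective {N N'} f g h := by
    refine ObjectProperty.hom_ext _ (DGMod.hom_ext fun E y => ?_)
    obtain ⟨x, rfl⟩ := pProductProj_surjective N.property.2 (selfFlag E) y
    have h' : pProductMap f.hom = pProductMap g.hom := congrArg (fun f => f.hom) h
    have h'' : (pProductMap f.hom).app (dimVec E) x = (pProductMap g.hom).app (dimVec E) x := by
      rw [h']
    exact congrFun (congrArg Subtype.val h'') (selfFlag E)

instance : (pProductFunctor r Z).Full where
  map_surjective {N N'} φ := by
    obtain ⟨ψ, hψ, hdeg, hnat⟩ := (isPProduct_pProduct N.property.2).exists_descent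
      (isPProduct_pProduct N'.property.2) 0 φ.hom.app
      (fun d n x hx => by
        rw [add_zero]
        exact φ.hom.app_deg d n x hx)
      φ.hom.naturality
    let f : N.obj ⟶ N'.obj :=
      { app := ψ
        app_deg := by simpa using hdeg
        naturality := hnat
        app_d := fun E y => by
          obtain ⟨x, rfl⟩ := pProductProj_surjective N.property.2 (selfFlag E) y
          have h1 := hψ _ (selfFlag E) ((pProductDG N.obj).d _ x)
          have h2 := hψ _ (selfFlag E) x
          have h3 : φ.hom.app _ ((pProductDG N.obj).d _ x) =
              (pProductDG N'.obj).d _ (φ.hom.app _ x) := φ.hom.app_d _ x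
          exact h1.trans ((congrArg (pProductProj _ _ (selfFlag E)) h3).trans
            (congrArg (N'.obj.d E) h2.symm)) }
    exact ⟨ObjectProperty.homMk f, ObjectProperty.hom_ext _ (DGMod.hom_ext fun d x =>
      Subtype.ext (funext fun E => hψ d E x))⟩

/-- Every `p`-product is isomorphic to the one constructed from families; a differential on it
descends to the values at the flags. -/
theorem exists_iso_pProductDG (M : DGMod (Rdf r)) (hM : IsPqce M.toGrMod) :
    ∃ N : DGMod (Rcf r), IsQceFlags N.toGrMod ∧
      ((∀ d (x : M.obj d), M.d d x = 0) → ∀ E (y : N.obj E), N.d E y = 0) ∧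
      Nonempty (M ≅ pProductDG N) := by
  obtain ⟨N, hN, π, h⟩ := hM
  obtain ⟨δ, hδ, hdeg, hnat⟩ := h.exists_descent h 1 M.d M.d_deg M.d_map
  let N' : DGMod (Rcf r) :=
    { N with
      d := δ
      d_deg := hdeg
      d_d := fun E y => by
        obtain ⟨x, rfl⟩ := h.surjective (selfFlag E) y
        refine (congrArg (δ E) (hδ _ (selfFlag E) x)).trans ((hδ _ (selfFlag E) _).trans ?_)
        rw [M.d_d]
        exact map_zero _
      d_map := hnat }
  refine ⟨N', hN, fun hd E y => ?_, ?_⟩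
  · obtain ⟨x, rfl⟩ := h.surjective (selfFlag E) y
    refine (hδ _ (selfFlag E) x).trans ?_
    rw [hd]
    exact map_zero _
  · let Φ : ∀ d, M.obj d →ₗ[(Rdf r).ring d] Family N d := fun d =>
      { toFun := fun x E => π d E x
        map_add' := fun x y => funext fun E => map_add (π d E) x y
        map_smul' := fun a x => funext fun E => LinearMap.map_smulₛₗ (π d E) a x }
    have hΦ : ∀ d x, Φ d x ∈ pProductObj N d := fun d x =>
      homogeneous_induction (C := fun x => Φ d x ∈ pProductObj N d) (M.internal d) x
        (by rw [map_zero]; exact Submodule.zero_mem _)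
        (fun n x hx => mem_pProductObj (h.mem_homogFamilies hx))
        (fun x y hx hy => by rw [map_add]; exact Submodule.add_mem _ hx hy)
    let f : M ⟶ pProductDG N' :=
      { app := fun d => (Φ d).codRestrict _ (hΦ d)
        app_deg := fun d n x hx => h.mem_homogFamilies hx
        naturality := fun hd x => Subtype.ext (funext fun E => h.naturality hd E x)
        app_d := fun d x => Subtype.ext (funext fun E => (hδ d E x).symm) }
    have : IsIso f := DGMod.isIso_of_bijective f fun d => by
      constructor
      · refine (injective_iff_map_eq_zero (f.app d)).2 fun x hx => ?_
        have hx' : ∀ E, π d E x = 0 := fun E => congrFun (congrArg Subtype.val hx) E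
        refine eq_zero_of_component' (M.internal d) fun n =>
          h.injective d n _ (component'_mem _ n x) fun E => ?_
        exact (h.map_proj E n x).trans (by rw [hx', map_zero])
      · rintro ⟨x, hx⟩
        suffices ∃ y, Φ d y = x from this.imp fun y hy => Subtype.ext hy
        refine pProductObj_induction (C := fun x => ∃ y, Φ d y = x) hx ?_ ⟨0, map_zero _⟩ ?_
        · intro n x hx
          obtain ⟨y, -, hy⟩ := (h.range d n x hx.1).2 hx.2
          exact ⟨y, funext hy⟩
        · rintro _ _ ⟨y, rfl⟩ ⟨y', rfl⟩
          exact ⟨y + y', map_add _ _ _⟩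
    exact ⟨asIso f⟩

instance : (pProductFunctor r Z).EssSurj where
  mem_essImage M := by
    obtain ⟨N, hN, hd, ⟨e⟩⟩ := exists_iso_pProductDG r M.obj M.property.2
    exact ⟨⟨N, fun hZ => hd (M.property.1 hZ), hN⟩, ⟨ObjectProperty.isoMk _ e.symm⟩⟩

instance : (pProductFunctor r Z).IsEquivalence where

theorem isLocallyPresentable_pqce :
    IsLocallyPresentable.{0} (dgProp (R := Rdf r) IsPqce Z).FullSubcategory :=
  have := isLocallyPresentable_qceFlags (Rcf r) Z
  (pProductFunctor r Z).asEquivalence.isLocallyPresentable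

end Equivalence

end TorusModel

/-- All algebraic models for rational `T`-spectra, `T` a torus of rank `r`, and their differential
versions, are locally presentable categories. -/
theorem mainTheorem8 (r : ℕ) :
    CategoryTheory.IsLocallyPresentable.{0} (TorusModel.Aap r) ∧
    CategoryTheory.IsLocallyPresentable.{0} (TorusModel.Aaf r) ∧
    CategoryTheory.IsLocallyPresentable.{0} (TorusModel.Acp r) ∧
    CategoryTheory.IsLocallyPresentable.{0} (TorusModel.Acf r) ∧
    CategoryTheory.IsLocallyPresentable.{0} (TorusModel.Adf r) ∧
    CategoryTheory.IsLocallyPresentable.{0} (TorusModel.dAap r) ∧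
    CategoryTheory.IsLocallyPresentable.{0} (TorusModel.dAaf r) ∧
    CategoryTheory.IsLocallyPresentable.{0} (TorusModel.dAcp r) ∧
    CategoryTheory.IsLocallyPresentable.{0} (TorusModel.dAcf r) ∧
    CategoryTheory.IsLocallyPresentable.{0} (TorusModel.dAdf r) := by
  obtain ⟨h1, h1'⟩ :=
    TorusModel.isLocallyPresentable_both _ (TorusModel.isLocallyPresentable_fContinuousPairs r)
  obtain ⟨h2, h2'⟩ :=
    TorusModel.isLocallyPresentable_both _ (TorusModel.isLocallyPresentable_fContinuousFlags r)
  obtain ⟨h3, h3'⟩ := TorusModel.isLocallyPresentable_both _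
    (TorusModel.isLocallyPresentable_qcePairs (TorusModel.Rcp r))
  obtain ⟨h4, h4'⟩ := TorusModel.isLocallyPresentable_both _
    (TorusModel.isLocallyPresentable_qceFlags (TorusModel.Rcf r))
  obtain ⟨h5, h5'⟩ :=
    TorusModel.isLocallyPresentable_both _ (TorusModel.isLocallyPresentable_pqce r)
  exact ⟨h1, h2, h3, h4, h5, h1', h2', h3', h4', h5'⟩
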